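/- For $z\in\mathbb{C}\setminus[0,1]$ and a word $a_1,\dots,a_n\in\{0,1,z\}$ with $a_1\neq0$ and $a_n\neq1$ put $$I(0;a_1,\dots,a_n;1)=\int_0^1\frac{dt_n}{t_n-a_n}\int_0^{t_n}\frac{dt_{n-1}}{t_{n-1}-a_{n-1}}\cdots\int_0^{t_2}\frac{dt_1}{t_1-a_1}$$ (equal to $1$ for $n=0$). Let $\mathcal{A}=\mathbb{Q}\langle e_0,e_1,e_z\rangle$ be the algebra of non-commutative polynomials, let $\mathcal{A}^0=\mathbb{Q}+\mathbb{Q}e_z+e_z\mathcal{A}e_z+e_z\mathcal{A}e_0+e_1\mathcal{A}e_z+e_1\mathcal{A}e_0$, and let $L$ be the $\mathbb{Q}$-linear map on $\mathcal{A}^0$ with $L(e_{a_1}\cdots e_{a_n})=I(0;a_1,\dots,a_n;1)$. For positive integers $k_1,\dots,k_r$ with $k_r\ge2$ let $\zeta(k_1,\dots,k_r)=\sum_{0<m_1<\cdots<m_r}m_1^{-k_1}\cdots m_r^{-k_r}$. **Theorem 1.2 (Sum formula).** For every word in $\mathcal{A}^0$ the iterated integral converges absolutely for all $z\in\mathbb{C}\setminus[0,1]$,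 and $L(w)$ is a holomorphic function of $z\in\mathbb{C}\setminus[0,1]$ for every $w\in\mathcal{A}^0$. For all integers $k\ge2$ and $k\ge r\ge1$, all arguments of $L$ below lie in $\mathcal{A}^0$, and for all $z\in\mathbb{C}\setminus[0,1]$ $$(-1)^r\sum_{\substack{k_1+\cdots+k_r=k\\k_i\ge1,\ k_r\ge2}}L(e_ze_0^{k_1-1}e_1e_0^{k_2-1}\cdots e_1e_0^{k_r-1})=-L(e_1e_0^{k-1})+L\big((e_1-e_z)(e_0-e_z)^{r-1}e_0^{k-r}\big).$$ Moreover, if $k>r$, then as $z\to1$ along real $z>1$ the left-hand side tends to $\sum_{k_1+\cdots+k_r=k,\ k_i\ge1,\ k_r\ge2}\zeta(k_1,\dots,k_r)$ and the right-hand side tends to $\zeta(k)$ (all these series converge), so that $$\sum_{\substack{k_1+\cdots+k_r=k\\k_i\ge1,\ k_r\ge2}}\zeta(k_1,\dots,k_r)=\zeta(k).$$ -/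

import Mathlib

open MeasureTheory Filter Topology
open scoped ENNReal

noncomputable section

namespace SumFormula

/-- The three letters `e_0`, `e_1`, `e_z` (as indices `0`, `1`, `z`). -/
inductive Letter : Type
  | zero
  | one
  | z

/-- The singular point `0`, `1` or `z` that belongs to a letter. -/
def Letter.pt (z : ℂ) : Letter → ℂ
  | .zero => 0
  | .one => 1
  | .z => z

/-- The algebra `ℚ⟨e_0, e_1, e_z⟩` of non-commutative polynomials. -/
abbrev A : Type := FreeAlgebra ℚ Letter

/-- The generator `e_0`. -/
def e0 : A := FreeAlgebra.ι ℚ Letter.zero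

/-- The generator `e_1`. -/
def e1 : A := FreeAlgebra.ι ℚ Letter.one

/-- The generator `e_z`. -/
def ez : A := FreeAlgebra.ι ℚ Letter.z

/-- The monomial `e_{a_1} e_{a_2} ⋯ e_{a_n}`. -/
def word (w : List Letter) : A := (w.map (FreeAlgebra.ι ℚ)).prod

/-- The subspace `ℚ + ℚ e_z + e_z A e_z + e_z A e_0 + e_1 A e_z + e_1 A e_0` of `A`. -/
def A0 : Submodule ℚ A :=
  Submodule.span ℚ {1} ⊔ Submodule.span ℚ {ez}
    ⊔ Submodule.span ℚ {ez} * ⊤ * Submodule.span ℚ {ez}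
    ⊔ Submodule.span ℚ {ez} * ⊤ * Submodule.span ℚ {e0}
    ⊔ Submodule.span ℚ {e1} * ⊤ * Submodule.span ℚ {ez}
    ⊔ Submodule.span ℚ {e1} * ⊤ * Submodule.span ℚ {e0}

/-- The domain `ℂ ∖ [0,1]`. -/
def slit : Set ℂ := (((↑) : ℝ → ℂ) '' Set.Icc 0 1)ᶜ

/-- The iterated integral with upper end point `x`. The list holds the letters from the outermost
integration variable to the innermost: on `[a_n, …, a_1]` the value is
`∫_0^x dt_n/(t_n - a_n) ∫_0^{t_n} dt_{n-1}/(t_{n-1} - a_{n-1}) ⋯ ∫_0^{t_2} dt_1/(t_1 - a_1)`. -/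
def iterAux (z : ℂ) : List Letter → ℝ → ℂ
  | [], _ => 1
  | a :: w, x => ∫ t in (0 : ℝ)..x, ((t : ℂ) - a.pt z)⁻¹ * iterAux z w t

/-- `I(0; a_1, …, a_n; 1)` for the list `[a_1, …, a_n]`. -/
def iter (z : ℂ) (w : List Letter) : ℂ := iterAux z w.reverse 1

/-- The same nested integral with every factor `1/(t_i - a_i)` replaced by its absolute value,
as an extended nonnegative number. -/
def absIterAux (z : ℂ) : List Letter → ℝ → ℝ≥0∞
  | [], _ => 1
  | a :: w, x => ∫⁻ t in Set.Ioo (0 : ℝ) x, ‖((t : ℂ) - a.pt z)⁻¹‖ₑ * absIterAux z w t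

/-- The iterated integral `I(0; a_1, …, a_n; 1)` converges absolutely. -/
def ConvergesAbsolutely (z : ℂ) (w : List Letter) : Prop := absIterAux z w.reverse 1 < ⊤

/-- The `ℚ`-linear map `L` with `L(e_{a_1} ⋯ e_{a_n}) = I(0; a_1, …, a_n; 1)`, at the point `z`.
It is written on all of `A`; only its values on `A0` have a meaning. -/
def L (z : ℂ) : A →ₗ[ℚ] ℂ :=
  (FreeAlgebra.basisFreeMonoid ℚ Letter).constr ℚ fun w => iter z w.toList

theorem L_word (z : ℂ) (w : List Letter) : L z (word w) = iter z w := by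
  have h : word w = FreeAlgebra.basisFreeMonoid ℚ Letter (FreeMonoid.ofList w) := by
    simp [word, FreeAlgebra.basisFreeMonoid, FreeAlgebra.equivMonoidAlgebraFreeMonoid]
  rw [h, L, Module.Basis.constr_basis]
  rfl

/-- The tuples `(k_1, …, k_r)` of integers with `k_1 + ⋯ + k_r = k`, all `k_i ≥ 1`, and
`k_r ≥ 2`. -/
def indices (k r : ℕ) : Finset (Fin r → ℕ) :=
  (Finset.Nat.antidiagonalTuple r k).filter fun κ =>
    (∀ i, 1 ≤ κ i) ∧ ∀ i : Fin r, (i : ℕ) + 1 = r → 2 ≤ κ i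

/-- The monomial `e_z e_0^{k_1 - 1} e_1 e_0^{k_2 - 1} ⋯ e_1 e_0^{k_r - 1}`. -/
def zWord {r : ℕ} (κ : Fin r → ℕ) : A :=
  (List.ofFn fun i : Fin r => (if (i : ℕ) = 0 then ez else e1) * e0 ^ (κ i - 1)).prod

/-- The sequences `0 < m_1 < ⋯ < m_r` of integers. -/
abbrev IncSeq (r : ℕ) : Type := {m : Fin r → ℕ // (∀ i, 0 < m i) ∧ StrictMono m}

/-- The term `1 / (m_1^{k_1} ⋯ m_r^{k_r})`. -/
def mzvTerm {r : ℕ} (κ : Fin r → ℕ) (m : IncSeq r) : ℝ := 1 / ∏ i, (m.1 i : ℝ) ^ κ i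

/-- The multiple zeta value `ζ(k_1, …, k_r)`. -/
def mzv {r : ℕ} (κ : Fin r → ℕ) : ℝ := ∑' m : IncSeq r, mzvTerm κ m

end SumFormula

end

open SumFormula

/-! Convergence. The weight `rho t = √(t/(1-t))` satisfies `∫₀ˣ rho t / (t(1-t)) dt = 2 rho x`, and
every form `dt/(t-a)` is at most a constant times `dt/(t(1-t))` on `(0,1)`. If the innermost letter
is not `e_0`, an iterated integral of length `n` up to `x < 1` is therefore at most `(2C)^n rho x`
(`absIterAux_le`). An outermost letter other than `e_1` costs only `C/t`, and `rho t / t` is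
integrable up to `1`. The constant can be chosen locally uniformly in `z`, which gives holomorphy by
differentiation under the integral; for real `z ≥ 1` it can be taken to be `1`, which gives the
limit `z → 1` by dominated convergence.

Sum formula. Put `r = b + 1` and `k = a + b + 2`. The words on the left are exactly the words `e_z u
e_0` in which `u` runs over all arrangements of `a` letters `e_0` and `b` letters `e_1`; their sum
is `J a b * e0`. Summed over all arrangements, the integrals from `s` to `t` factor into powers of
logarithms, so (`Lx_J`) `L(J a b e_0) = ∫₀¹ dt/t ∫₀ᵗ ds/(s-z) · log(t/s)^a/a! ·
log((1-t)/(1-s))^b/b!`. The scaling `s = T t` turns the first logarithm into `-log T`, and then the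
substitution `t = (1-v)/(1-vT)` turns the second into `log v`. On the right, `e_1 e_0^b` gives
`-Li_{b+1}(x)` at end point `x`, and `(e_1-e_z)(e_0-e_z)^b` gives `-Li_{b+1}(w)` with `w =
(z-1)x/(z-x)`, because this Möbius map pulls the forms `dw/(w-1)` and `dw/w` back to the differences
of letters (`Lx_e1_sub_ez_mul_pow`). With `Li_{b+1}` written as an integral against `(-log v)^b/b!`,
and with the remaining `e_0^{a+1}` contributing `(-log T)^a/a! dT/T`, both sides become the same
double integral up to the sign `(-1)^{b+1}` (`rhs_eq`, `L_J_mul_e0`). For `r = k` the left side is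
empty and the two terms on the right cancel, since the Möbius map fixes `1`.

Limit. At `z = 1` the letters `e_1` and `e_z` coincide, so the last term dies. Each form has
constant sign on `(0,1)`, so the integrals equal a sign times their absolute versions, and these are
expanded into power series by Tonelli's theorem; this yields convergence and value of the multiple
zeta series together (`absIterAux_zLetters`). -/

namespace SumFormula

/-! ### The weight `√(t / (1 - t))` -/

/-- The weight that controls all iterated integrals on `(0,1)`. -/
noncomputable def rho (t : ℝ) : ℝ := √(t / (1 - t))

lemma rho_nonneg (t : ℝ) : 0 ≤ rho t := Real.sqrt_nonneg _

/-- Starts the induction: an innermost form without a pole at `0` is at most `C/(1-t)`, hence at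
most `C rho t / (t(1-t))`. -/
lemma le_rho {t : ℝ} (h0 : 0 < t) (h1 : t < 1) : t ≤ rho t := by
  apply Real.le_sqrt_of_sq_le
  rw [le_div_iff₀ (by linarith)]
  nlinarith [mul_pos h0 h0, mul_pos (mul_pos h0 h0) h0]

lemma continuousOn_rho : ContinuousOn rho (Set.Iio 1) := by
  apply ContinuousOn.sqrt
  apply ContinuousOn.div (by fun_prop) (by fun_prop)
  intro t ht
  have : t < 1 := ht
  linarith

/-- The logarithmic derivative of `rho` is `1/(2t(1-t))`. This is the reason for the choice of
weight: integration against `dt/(t(1-t))` reproduces it up to the factor `2`. -/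
lemma hasDerivAt_two_rho {t : ℝ} (h0 : 0 < t) (h1 : t < 1) :
    HasDerivAt (fun t => 2 * rho t) (rho t / (t * (1 - t))) t := by
  have h2 : 0 < 1 - t := by linarith
  have hq : 0 < t / (1 - t) := div_pos h0 h2
  have hd : HasDerivAt (fun t : ℝ => t / (1 - t)) ((1 * (1 - t) - t * (-1)) / (1 - t) ^ 2) t :=
    (hasDerivAt_id' t).div ((hasDerivAt_id' t).const_sub 1) h2.ne'
  have := (hd.sqrt hq.ne').const_mul 2
  refine this.congr_deriv ?_
  have hs : rho t * rho t = t / (1 - t) := Real.mul_self_sqrt hq.le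
  have hs0 : rho t ≠ 0 := (Real.sqrt_pos.2 hq).ne'
  change 2 * ((1 * (1 - t) - t * (-1)) / (1 - t) ^ 2 / (2 * rho t)) = _
  have h2' := h2.ne'
  field_simp
  rw [sq, hs]
  field_simp
  ring

lemma integrableOn_rho_div_mul {x : ℝ} (hx : x < 1) :
    IntegrableOn (fun t => rho t / (t * (1 - t))) (Set.Ioc 0 x) := by
  apply intervalIntegral.integrableOn_deriv_of_nonneg (g := fun t => 2 * rho t)
  · exact (continuousOn_rho.mono fun t ht => lt_of_le_of_lt ht.2 hx).const_mul 2
      |>.congr fun _ _ => rfl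
  · intro t ht
    exact hasDerivAt_two_rho ht.1 (ht.2.trans hx)
  · intro t ht
    have := ht.2
    exact div_nonneg (rho_nonneg t) (mul_nonneg ht.1.le (by linarith))

lemma integral_rho_div_mul {x : ℝ} (hx0 : 0 ≤ x) (hx : x < 1) :
    ∫ t in Set.Ioc 0 x, rho t / (t * (1 - t)) = 2 * rho x := by
  rw [← intervalIntegral.integral_of_le hx0,
    intervalIntegral.integral_eq_sub_of_hasDerivAt_of_le hx0 (f := fun t => 2 * rho t)
      ((continuousOn_rho.mono fun t ht => lt_of_le_of_lt ht.2 hx).const_mul 2)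
      (fun t ht => hasDerivAt_two_rho ht.1 (ht.2.trans hx))
      ((intervalIntegrable_iff_integrableOn_Ioc_of_le hx0).2 (integrableOn_rho_div_mul hx))]
  simp [rho]

lemma lintegral_rho_div_mul {x : ℝ} (hx0 : 0 ≤ x) (hx : x < 1) :
    ∫⁻ t in Set.Ioo 0 x, ENNReal.ofReal (rho t / (t * (1 - t))) = ENNReal.ofReal (2 * rho x) := by
  rw [setLIntegral_congr Ioo_ae_eq_Ioc, ← integral_rho_div_mul hx0 hx,
    ofReal_integral_eq_lintegral_ofReal (integrableOn_rho_div_mul hx)]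
  refine (ae_restrict_iff' measurableSet_Ioc).2 (Eventually.of_forall fun t ht => ?_)
  have := ht.2
  exact div_nonneg (rho_nonneg t) (mul_nonneg ht.1.le (by linarith))

/-- Here `rho t / t = 1/√(t(1-t))`, the derivative of `2 arcsin √t`, which stays bounded up to `1`.
-/
lemma integrableOn_rho_div : IntegrableOn (fun t => rho t / t) (Set.Ioc 0 1) := by
  apply intervalIntegral.integrableOn_deriv_of_nonneg (g := fun t => 2 * Real.arcsin (√t))
  · fun_prop
  · intro t ht
    have h2 : 0 < 1 - t := by linarith [ht.2]
    have hs1 : √t < 1 := by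
      rw [Real.sqrt_lt' one_pos]; simpa using ht.2
    have h1 : HasDerivAt (fun t => 2 * Real.arcsin (√t))
        (2 * (1 / √(1 - √t ^ 2) * (1 / (2 * √t)))) t :=
      ((Real.hasDerivAt_arcsin (by linarith [Real.sqrt_nonneg t]) hs1.ne).comp t
        (Real.hasDerivAt_sqrt ht.1.ne')).const_mul 2
    refine h1.congr_deriv ?_
    rw [Real.sq_sqrt ht.1.le, rho, Real.sqrt_div ht.1.le]
    have h3 : √t ≠ 0 := (Real.sqrt_pos.2 ht.1).ne'
    have h4 : √(1 - t) ≠ 0 := (Real.sqrt_pos.2 h2).ne'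
    have h5 := ht.1.ne'
    field_simp
    rw [Real.sq_sqrt ht.1.le]
  · intro t ht
    exact div_nonneg (rho_nonneg t) ht.1.le

/-! ### Bounds for the letters -/

/-- The bound on `1 / (t - z)` used for the iterated integrals. -/
structure LetterBound (z : ℂ) (C : ℝ) : Prop where
  one_le : 1 ≤ C
  le : ∀ t ∈ Set.Ioo (0 : ℝ) 1, ‖((t : ℂ) - z)⁻¹‖ ≤ C / (1 - t)

lemma norm_inv_sub_one {t : ℝ} (h1 : t < 1) : ‖((t : ℂ) - 1)⁻¹‖ = 1 / (1 - t) := by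
  rw [norm_inv, ← Complex.ofReal_one, ← Complex.ofReal_sub, Complex.norm_real, Real.norm_eq_abs,
    abs_of_neg (by linarith), one_div, neg_sub]

lemma LetterBound.le_of_ne_zero {z : ℂ} {C : ℝ} (h : LetterBound z C) {a : Letter}
    (ha : a ≠ .zero) {t : ℝ} (ht : t ∈ Set.Ioo (0 : ℝ) 1) :
    ‖((t : ℂ) - a.pt z)⁻¹‖ ≤ C / (1 - t) := by
  have h2 : 0 < 1 - t := by linarith [ht.2]
  cases a with
  | zero => exact absurd rfl ha
  | one =>
    rw [Letter.pt, norm_inv_sub_one ht.2]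
    exact div_le_div_of_nonneg_right h.one_le h2.le
  | z => exact h.le t ht

lemma LetterBound.le_mul {z : ℂ} {C : ℝ} (h : LetterBound z C) (a : Letter) {t : ℝ}
    (ht : t ∈ Set.Ioo (0 : ℝ) 1) : ‖((t : ℂ) - a.pt z)⁻¹‖ ≤ C / (t * (1 - t)) := by
  have h1 : 0 < t := ht.1
  have h2 : 0 < 1 - t := by linarith [ht.2]
  have hC : 0 ≤ C := zero_le_one.trans h.one_le
  rcases eq_or_ne a .zero with rfl | ha
  · rw [Letter.pt, sub_zero, norm_inv, Complex.norm_real, Real.norm_of_nonneg h1.le, inv_eq_one_div]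
    apply div_le_div₀ hC h.one_le (mul_pos h1 h2)
    nlinarith
  · refine (h.le_of_ne_zero ha ht).trans (div_le_div_of_nonneg_left hC (mul_pos h1 h2) ?_)
    nlinarith

lemma isOpen_slit : IsOpen slit :=
  (isCompact_Icc.image Complex.continuous_ofReal).isClosed.isOpen_compl

lemma sub_ne_zero_of_mem_slit {z : ℂ} (hz : z ∈ slit) {t : ℝ} (ht : t ∈ Set.Icc (0 : ℝ) 1) :
    (t : ℂ) - z ≠ 0 := fun h => hz ⟨t, ht, sub_eq_zero.1 h⟩

/-- The uniformity over a ball supplies the dominating functions for holomorphy. Halving the radius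
keeps the whole ball at distance at least `ε / 2` from `[0,1]`. -/
lemma exists_bound_slit {z₀ : ℂ} (hz : z₀ ∈ slit) :
    ∃ ε > 0, ∃ C : ℝ, 1 ≤ C ∧ Metric.ball z₀ ε ⊆ slit ∧
      ∀ z ∈ Metric.ball z₀ ε, ∀ t ∈ Set.Icc (0 : ℝ) 1, ‖((t : ℂ) - z)⁻¹‖ ≤ C := by
  obtain ⟨ε, hε, hb⟩ := Metric.isOpen_iff.1 isOpen_slit z₀ hz
  refine ⟨ε / 2, by positivity, max 1 (2 / ε), le_max_left _ _,
    (Metric.ball_subset_ball (by linarith)).trans hb, fun z hz t ht => ?_⟩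
  have h1 : ε ≤ ‖(t : ℂ) - z₀‖ := by
    by_contra hlt
    push Not at hlt
    exact hb (by rwa [Metric.mem_ball, dist_eq_norm]) ⟨t, ht, rfl⟩
  have h2 : ‖z - z₀‖ < ε / 2 := by rwa [Metric.mem_ball, dist_eq_norm] at hz
  have h3 : ‖(t : ℂ) - z₀‖ ≤ ‖(t : ℂ) - z‖ + ‖z - z₀‖ := by
    simpa using norm_add_le ((t : ℂ) - z) (z - z₀)
  have h4 : ε / 2 ≤ ‖(t : ℂ) - z‖ := by linarith
  rw [norm_inv]
  refine le_trans ?_ (le_max_right _ _)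
  rw [show 2 / ε = (ε / 2)⁻¹ by field_simp]
  exact inv_anti₀ (by positivity) h4

lemma LetterBound.of_le {z : ℂ} {C : ℝ} (hC : 1 ≤ C)
    (h : ∀ t ∈ Set.Icc (0 : ℝ) 1, ‖((t : ℂ) - z)⁻¹‖ ≤ C) : LetterBound z C := by
  refine ⟨hC, fun t ht => (h t ⟨ht.1.le, ht.2.le⟩).trans ?_⟩
  rw [le_div_iff₀ (by linarith [ht.2])]
  nlinarith [ht.1]

lemma exists_letterBound {z : ℂ} (hz : z ∈ slit) : ∃ C, LetterBound z C := by
  obtain ⟨ε, hε, C, hC, -, h⟩ := exists_bound_slit hz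
  exact ⟨C, .of_le hC (h z (Metric.mem_ball_self hε))⟩

/-- One constant for all real `x ≥ 1`, the end point included, makes every later bound uniform as `z
→ 1`. -/
lemma letterBound_one_of_one_le {x : ℝ} (hx : 1 ≤ x) : LetterBound (x : ℂ) 1 := by
  refine ⟨le_rfl, fun t ht => ?_⟩
  have h2 : 0 < 1 - t := by linarith [ht.2]
  rw [norm_inv, ← Complex.ofReal_sub, Complex.norm_real, Real.norm_eq_abs,
    abs_of_neg (by linarith), inv_eq_one_div]
  exact div_le_div_of_nonneg_left zero_le_one h2 (by linarith)

/-- The form of the bound needed for the outermost letter: no singularity at `1`. -/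
lemma norm_inv_sub_le_div {z : ℂ} {C : ℝ} (hC : 1 ≤ C)
    (h : ∀ t ∈ Set.Icc (0 : ℝ) 1, ‖((t : ℂ) - z)⁻¹‖ ≤ C) {a : Letter} (ha : a ≠ .one)
    {t : ℝ} (ht : t ∈ Set.Ioo (0 : ℝ) 1) : ‖((t : ℂ) - a.pt z)⁻¹‖ ≤ C / t := by
  cases a with
  | one => exact absurd rfl ha
  | zero =>
    rw [Letter.pt, sub_zero, norm_inv, Complex.norm_real, Real.norm_of_nonneg ht.1.le,
      inv_eq_one_div]
    exact div_le_div_of_nonneg_right hC ht.1.le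
  | z =>
    refine (h t ⟨ht.1.le, ht.2.le⟩).trans ?_
    rw [le_div_iff₀ ht.1]
    nlinarith [ht.1, ht.2]

/-! ### Bounds for the iterated integrals -/

lemma setLIntegral_le_rho {D x : ℝ} (hD : 0 ≤ D) (hx0 : 0 ≤ x) (hx : x < 1) {f : ℝ → ℝ≥0∞}
    (hf : ∀ t ∈ Set.Ioo 0 x, f t ≤ ENNReal.ofReal (D * (rho t / (t * (1 - t))))) :
    ∫⁻ t in Set.Ioo 0 x, f t ≤ ENNReal.ofReal (D * (2 * rho x)) := by
  rw [ENNReal.ofReal_mul hD, ← lintegral_rho_div_mul hx0 hx,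
    ← lintegral_const_mul' _ _ ENNReal.ofReal_ne_top]
  refine setLIntegral_mono' measurableSet_Ioo fun t ht => (hf t ht).trans_eq ?_
  rw [ENNReal.ofReal_mul hD]

/-- Every letter outside the innermost one is at most `C/(t(1-t))`, so each integration multiplies
the bound by `2C` and keeps the weight `rho`. -/
lemma absIterAux_le {z : ℂ} {C : ℝ} (h : LetterBound z C) {a : Letter} (ha : a ≠ .zero)
    (u : List Letter) {x : ℝ} (hx0 : 0 ≤ x) (hx : x < 1) :
    absIterAux z (u ++ [a]) x ≤ ENNReal.ofReal ((2 * C) ^ (u.length + 1) * rho x) := by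
  have hC : 0 ≤ C := zero_le_one.trans h.one_le
  induction u generalizing x with
  | nil =>
    refine (setLIntegral_le_rho hC hx0 hx fun t ht => ?_).trans_eq (by congr 1; simp; ring)
    have ht' : t ∈ Set.Ioo (0 : ℝ) 1 := ⟨ht.1, ht.2.trans hx⟩
    have h2 : 0 < 1 - t := by linarith [ht'.2]
    have h1 := ht.1
    simp only [absIterAux, mul_one]
    rw [← ofReal_norm]
    refine ENNReal.ofReal_le_ofReal ((h.le_of_ne_zero ha ht').trans ?_)
    rw [← mul_div_assoc, div_le_div_iff₀ h2 (by positivity)]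
    nlinarith [mul_le_mul_of_nonneg_left (le_rho ht'.1 ht'.2) (mul_nonneg hC h2.le)]
  | cons b u ih =>
    refine (setLIntegral_le_rho (D := C * (2 * C) ^ (u.length + 1)) (by positivity) hx0 hx
      fun t ht => ?_).trans_eq
      (by congr 1; simp only [List.length_cons]; ring)
    have ht' : t ∈ Set.Ioo (0 : ℝ) 1 := ⟨ht.1, ht.2.trans hx⟩
    have hb : ‖((t : ℂ) - b.pt z)⁻¹‖ₑ ≤ ENNReal.ofReal (C / (t * (1 - t))) := by
      rw [← ofReal_norm]
      exact ENNReal.ofReal_le_ofReal (h.le_mul b ht')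
    refine (mul_le_mul' hb (ih ht.1.le ht'.2)).trans_eq ?_
    have h2 : 0 < 1 - t := by linarith [ht'.2]
    have h1 := ht.1
    rw [← ENNReal.ofReal_mul (by positivity)]
    congr 1
    ring

lemma enorm_iterAux_le (z : ℂ) (w : List Letter) {x : ℝ} (hx0 : 0 ≤ x) :
    ‖iterAux z w x‖ₑ ≤ absIterAux z w x := by
  induction w generalizing x with
  | nil => simp [iterAux, absIterAux]
  | cons a w ih =>
    rw [iterAux, absIterAux, intervalIntegral.integral_of_le hx0, setLIntegral_congr Ioo_ae_eq_Ioc]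
    refine (enorm_integral_le_lintegral_enorm _).trans
      (setLIntegral_mono' measurableSet_Ioc fun t ht => ?_)
    rw [enorm_mul]
    gcongr
    exact ih ht.1.le

lemma norm_iterAux_le {z : ℂ} {C : ℝ} (h : LetterBound z C) {a : Letter} (ha : a ≠ .zero)
    (u : List Letter) {x : ℝ} (hx0 : 0 ≤ x) (hx : x < 1) :
    ‖iterAux z (u ++ [a]) x‖ ≤ (2 * C) ^ (u.length + 1) * rho x := by
  have hC : 0 ≤ C := zero_le_one.trans h.one_le
  have := (enorm_iterAux_le z (u ++ [a]) hx0).trans (absIterAux_le h ha u hx0 hx)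
  rw [← ofReal_norm] at this
  exact (ENNReal.ofReal_le_ofReal_iff (mul_nonneg (by positivity) (rho_nonneg x))).1 this

/-- The words (outermost letter first) whose innermost letter is not `e_0`. -/
def Regular (w : List Letter) : Prop := ∃ u a, a ≠ Letter.zero ∧ w = u ++ [a]

lemma regular_singleton {a : Letter} (ha : a ≠ .zero) : Regular [a] := ⟨[], a, ha, rfl⟩

lemma Regular.cons {w : List Letter} (h : Regular w) (b : Letter) : Regular (b :: w) := by
  obtain ⟨u, a, ha, rfl⟩ := h
  exact ⟨b :: u, a, ha, rfl⟩

lemma regular_cons_iff {w : List Letter} {a : Letter} :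
    Regular (a :: w) ↔ (w = [] ∧ a ≠ .zero) ∨ Regular w := by
  constructor
  · rintro ⟨u, b, hb, h⟩
    cases u with
    | nil => left; simp_all
    | cons c u => right; simp only [List.cons_append, List.cons.injEq] at h; exact ⟨u, b, hb, h.2⟩
  · rintro (⟨rfl, h⟩ | h)
    · exact regular_singleton h
    · exact h.cons a

lemma Regular.exists_norm_le {w : List Letter} (hw : Regular w) {C : ℝ} (hC : 0 ≤ C) :
    ∃ D, 0 ≤ D ∧ ∀ z, LetterBound z C → ∀ x, 0 ≤ x → x < 1 → ‖iterAux z w x‖ ≤ D * rho x := by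
  obtain ⟨u, a, ha, rfl⟩ := hw
  exact ⟨(2 * C) ^ (u.length + 1), by positivity,
    fun z h x hx0 hx => norm_iterAux_le h ha u hx0 hx⟩

lemma measurable_inv_sub (a : ℂ) : Measurable fun t : ℝ => ((t : ℂ) - a)⁻¹ := by fun_prop

/-- The integrand of a regular word is dominated by a weight. -/
lemma exists_norm_integrand_le {w : List Letter} {a : Letter} (hw : Regular (a :: w)) {C : ℝ}
    (hC : 0 ≤ C) : ∃ D, 0 ≤ D ∧ ∀ z, LetterBound z C → ∀ t ∈ Set.Ioo (0 : ℝ) 1,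
      ‖((t : ℂ) - a.pt z)⁻¹ * iterAux z w t‖ ≤ D * (rho t / (t * (1 - t))) := by
  rcases regular_cons_iff.1 hw with ⟨rfl, ha⟩ | h
  · refine ⟨C, hC, fun z hz t ht => ?_⟩
    have h2 : 0 < 1 - t := by linarith [ht.2]
    have h1 := ht.1
    rw [iterAux, mul_one]
    refine (hz.le_of_ne_zero ha ht).trans ?_
    rw [← mul_div_assoc, div_le_div_iff₀ h2 (by positivity)]
    nlinarith [mul_le_mul_of_nonneg_left (le_rho ht.1 ht.2) (mul_nonneg hC h2.le)]
  · obtain ⟨D, hD, hb⟩ := h.exists_norm_le hC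
    refine ⟨C * D, by positivity, fun z hz t ht => ?_⟩
    have h2 : 0 < 1 - t := by linarith [ht.2]
    have h1 := ht.1
    rw [norm_mul]
    calc _ ≤ C / (t * (1 - t)) * (D * rho t) := by
          gcongr
          · exact hz.le_mul a ht
          · exact hb z hz t ht.1.le ht.2
      _ = _ := by ring

lemma integrableOn_of_norm_le_rho {f : ℝ → ℂ} {D x : ℝ} (hx : x < 1)
    (hf : AEStronglyMeasurable f (volume.restrict (Set.Ioc 0 x)))
    (h : ∀ t ∈ Set.Ioo (0 : ℝ) 1, ‖f t‖ ≤ D * (rho t / (t * (1 - t)))) :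
    IntegrableOn f (Set.Ioc 0 x) := by
  refine Integrable.mono' ((integrableOn_rho_div_mul hx).const_mul D) hf ?_
  exact (ae_restrict_iff' measurableSet_Ioc).2
    (Eventually.of_forall fun t ht => h t ⟨ht.1, ht.2.trans_lt hx⟩)

lemma aestronglyMeasurable_integrand (z : ℂ) {w : List Letter} (a : Letter)
    (h : ContinuousOn (iterAux z w) (Set.Ico 0 1)) :
    AEStronglyMeasurable (fun t : ℝ => ((t : ℂ) - a.pt z)⁻¹ * iterAux z w t)
      (volume.restrict (Set.Ioo 0 1)) :=
  (measurable_inv_sub _).aestronglyMeasurable.mul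
    ((h.mono Set.Ioo_subset_Ico_self).aestronglyMeasurable measurableSet_Ioo)

lemma continuousOn_iterAux {z : ℂ} {C : ℝ} (h : LetterBound z C) {w : List Letter}
    (hw : w = [] ∨ Regular w) : ContinuousOn (iterAux z w) (Set.Ico 0 1) := by
  induction w with
  | nil => exact continuousOn_const
  | cons a w ih =>
    replace hw : Regular (a :: w) := hw.resolve_left (by simp)
    have ih' := ih ((regular_cons_iff.1 hw).imp_left And.left)
    obtain ⟨D, -, hD⟩ := exists_norm_integrand_le hw (zero_le_one.trans h.one_le)
    intro x hx
    -- Integrability is known only below `1`; for `x < y < 1` the interval `[0,y]` is still a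
    -- neighbourhood of `x` within `[0,1)`.
    obtain ⟨y, hxy, hy⟩ := exists_between hx.2
    have hy0 : 0 ≤ y := hx.1.trans hxy.le
    have hint : IntegrableOn (fun t : ℝ => ((t : ℂ) - a.pt z)⁻¹ * iterAux z w t)
        (Set.uIcc 0 y) := by
      rw [Set.uIcc_of_le hy0, integrableOn_Icc_iff_integrableOn_Ioc]
      exact integrableOn_of_norm_le_rho hy
        ((aestronglyMeasurable_integrand z a ih').mono_measure
          (Measure.restrict_mono (Set.Ioc_subset_Ioo_right hy) le_rfl)) (hD z h)
    have hc := (intervalIntegral.continuousOn_primitive_interval hint) x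
      (by rw [Set.uIcc_of_le hy0]; exact ⟨hx.1, hxy.le⟩)
    refine hc.mono_of_mem_nhdsWithin ?_
    rw [Set.uIcc_of_le hy0, mem_nhdsWithin]
    exact ⟨Set.Iio y, isOpen_Iio, hxy, fun t ht => ⟨ht.2.1, (Set.mem_Iio.1 ht.1).le⟩⟩

/-- Integrability of the integrand of a regular word below `1`. -/
lemma integrableOn_integrand {z : ℂ} {C : ℝ} (h : LetterBound z C) {w : List Letter} {a : Letter}
    (hw : Regular (a :: w)) {x : ℝ} (hx : x < 1) :
    IntegrableOn (fun t : ℝ => ((t : ℂ) - a.pt z)⁻¹ * iterAux z w t) (Set.Ioc 0 x) := by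
  obtain ⟨D, -, hD⟩ := exists_norm_integrand_le hw (zero_le_one.trans h.one_le)
  exact integrableOn_of_norm_le_rho hx
    ((aestronglyMeasurable_integrand z a (continuousOn_iterAux h
      ((regular_cons_iff.1 hw).imp_left And.left))).mono_measure
        (Measure.restrict_mono (Set.Ioc_subset_Ioo_right hx) le_rfl)) (hD z h)

/-- Domination up to the end point `1`. -/
lemma exists_norm_integrand_le_rho_div {w : List Letter} (hw : Regular w) {C : ℝ} (hC : 0 ≤ C) :
    ∃ D, 0 ≤ D ∧ ∀ z, LetterBound z C → ∀ a : Letter, ∀ t ∈ Set.Ioo (0 : ℝ) 1,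
      ‖((t : ℂ) - a.pt z)⁻¹‖ ≤ C / t →
      ‖((t : ℂ) - a.pt z)⁻¹ * iterAux z w t‖ ≤ D * (rho t / t) := by
  obtain ⟨D, hD, hb⟩ := hw.exists_norm_le hC
  refine ⟨C * D, by positivity, fun z hz a t ht ha => ?_⟩
  have h1 := ht.1
  rw [norm_mul]
  calc _ ≤ C / t * (D * rho t) := by
        gcongr
        exact hb z hz t ht.1.le ht.2
    _ = _ := by ring

lemma integrableOn_integrand_one {z : ℂ} {C : ℝ} (h : LetterBound z C) {w : List Letter}
    (hw : Regular w) {a : Letter}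
    (ha : ∀ t ∈ Set.Ioo (0 : ℝ) 1, ‖((t : ℂ) - a.pt z)⁻¹‖ ≤ C / t) :
    IntegrableOn (fun t : ℝ => ((t : ℂ) - a.pt z)⁻¹ * iterAux z w t) (Set.Ioo 0 1) := by
  obtain ⟨D, -, hD⟩ := exists_norm_integrand_le_rho_div hw (zero_le_one.trans h.one_le)
  refine Integrable.mono' (((integrableOn_rho_div.mono_set Set.Ioo_subset_Ioc_self)).const_mul D)
    (aestronglyMeasurable_integrand z a (continuousOn_iterAux h (Or.inr hw))) ?_
  exact (ae_restrict_iff' measurableSet_Ioo).2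
    (Eventually.of_forall fun t ht => hD z h a t ht (ha t ht))

lemma absIterAux_one_lt_top {z : ℂ} {C : ℝ} (h : LetterBound z C) {w : List Letter}
    (hw : Regular w) {a : Letter}
    (ha : ∀ t ∈ Set.Ioo (0 : ℝ) 1, ‖((t : ℂ) - a.pt z)⁻¹‖ ≤ C / t) :
    absIterAux z (a :: w) 1 < ⊤ := by
  have hC : 0 ≤ C := zero_le_one.trans h.one_le
  obtain ⟨u, b, hb, rfl⟩ := hw
  have hint : IntegrableOn (fun t => C * (2 * C) ^ (u.length + 1) * (rho t / t)) (Set.Ioo 0 1) :=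
    (integrableOn_rho_div.mono_set Set.Ioo_subset_Ioc_self).const_mul _
  refine lt_of_le_of_lt (setLIntegral_mono' measurableSet_Ioo fun t ht => ?_)
    hint.lintegral_lt_top
  have h1 := ht.1
  have hle : ‖((t : ℂ) - a.pt z)⁻¹‖ₑ ≤ ENNReal.ofReal (C / t) := by
    rw [← ofReal_norm]
    exact ENNReal.ofReal_le_ofReal (ha t ht)
  refine (mul_le_mul' hle (absIterAux_le h hb u ht.1.le ht.2)).trans_eq ?_
  rw [← ENNReal.ofReal_mul (by positivity)]
  congr 1
  ring

lemma absIterAux_singleton_one_lt_top {z : ℂ} {C : ℝ}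
    (h : ∀ t ∈ Set.Icc (0 : ℝ) 1, ‖((t : ℂ) - z)⁻¹‖ ≤ C) :
    absIterAux z [Letter.z] 1 < ⊤ := by
  refine lt_of_le_of_lt (setLIntegral_mono' (g := fun _ => ENNReal.ofReal C) measurableSet_Ioo
    fun t ht => ?_) ?_
  · rw [absIterAux, mul_one, ← ofReal_norm]
    exact ENNReal.ofReal_le_ofReal (h t ⟨ht.1.le, ht.2.le⟩)
  · simp

/-! ### Holomorphy -/

/-- A parametric integral of holomorphic functions, locally uniformly dominated, is holomorphic. -/
lemma differentiableOn_setIntegral {U : Set ℂ} (hU : IsOpen U) {S : Set ℝ} (hS : MeasurableSet S)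
    {F : ℂ → ℝ → ℂ} (hd : ∀ t ∈ S, DifferentiableOn ℂ (fun z => F z t) U)
    (hm : ∀ z ∈ U, AEStronglyMeasurable (F z) (volume.restrict S))
    (hb : ∀ z₀ ∈ U, ∃ ε > 0, ∃ g : ℝ → ℝ, IntegrableOn g S ∧
      ∀ z ∈ Metric.ball z₀ ε, ∀ t ∈ S, ‖F z t‖ ≤ g t) :
    DifferentiableOn ℂ (fun z => ∫ t in S, F z t) U := by
  intro z₀ hz₀
  obtain ⟨ε₁, hε₁, g, hg, hgb⟩ := hb z₀ hz₀
  obtain ⟨ε₂, hε₂, hball⟩ := Metric.isOpen_iff.1 hU z₀ hz₀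
  set ε := min ε₁ ε₂ with hε
  have hε0 : 0 < ε := lt_min hε₁ hε₂
  have hsubU : Metric.ball z₀ ε ⊆ U :=
    (Metric.ball_subset_ball (min_le_right _ _)).trans hball
  have hsub1 : Metric.ball z₀ ε ⊆ Metric.ball z₀ ε₁ :=
    Metric.ball_subset_ball (min_le_left _ _)
  have hsubcb : ∀ z ∈ Metric.ball z₀ (ε / 2), Metric.closedBall z (ε / 4) ⊆ Metric.ball z₀ ε := by
    intro z hz y hy
    rw [Metric.mem_ball] at hz ⊢
    rw [Metric.mem_closedBall] at hy
    linarith [dist_triangle y z z₀]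
  have hmeas' : ∀ z ∈ Metric.ball z₀ ε, AEStronglyMeasurable (F z) (volume.restrict S) :=
    fun z hz => hm z (hsubU hz)
  -- The derivative is a pointwise limit of difference quotients along the steps `ε/(2(n+1))`, and
  -- these are measurable in `t`.
  have hderivm : AEStronglyMeasurable (fun t => deriv (fun z => F z t) z₀)
      (volume.restrict S) := by
    have hlim : ∀ t ∈ S, Tendsto (fun n : ℕ => ((ε / 2 / (n + 1) : ℝ) : ℂ)⁻¹ *
        (F (z₀ + ((ε / 2 / (n + 1) : ℝ) : ℂ)) t - F z₀ t)) atTop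
        (𝓝 (deriv (fun z => F z t) z₀)) := by
      intro t ht
      have h1 := ((hd t ht).differentiableAt (hU.mem_nhds hz₀)).hasDerivAt
      have h2 := hasDerivAt_iff_tendsto_slope_zero.1 h1
      have h3 : Tendsto (fun n : ℕ => ((ε / 2 / (n + 1) : ℝ) : ℂ)) atTop (𝓝[≠] 0) := by
        refine tendsto_nhdsWithin_iff.2 ⟨?_, Eventually.of_forall fun n => ?_⟩
        · have := (tendsto_const_div_atTop_nhds_zero_nat (ε / 2)).comp (tendsto_add_atTop_nat 1)
          have h4 : Tendsto (fun n : ℕ => (ε / 2 / (n + 1) : ℝ)) atTop (𝓝 0) := by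
            refine this.congr fun n => ?_
            simp
          exact (Complex.continuous_ofReal.tendsto 0).comp h4
        · have : (0 : ℝ) < ε / 2 / (n + 1) := by positivity
          exact Complex.ofReal_ne_zero.2 this.ne'
      exact h2.comp h3
    refine aestronglyMeasurable_of_tendsto_ae atTop (fun n => ?_)
      ((ae_restrict_iff' hS).2 (Eventually.of_forall hlim))
    have hmem : z₀ + ((ε / 2 / ((n : ℝ) + 1) : ℝ) : ℂ) ∈ Metric.ball z₀ ε := by
      rw [Metric.mem_ball, dist_eq_norm, add_sub_cancel_left, Complex.norm_real,
        Real.norm_of_nonneg (by positivity)]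
      have : (1 : ℝ) ≤ (n : ℝ) + 1 := by linarith [n.cast_nonneg (α := ℝ)]
      calc ε / 2 / ((n : ℝ) + 1) ≤ ε / 2 := div_le_self (by positivity) this
        _ < ε := by linarith
    exact ((hmeas' _ hmem).sub (hm z₀ hz₀)).const_mul _
  -- Cauchy's estimate on circles of radius `ε / 4` about points of the half ball bounds the
  -- derivative by `g t / (ε / 4)`, so domination of `F` alone suffices.
  have key := hasDerivAt_integral_of_dominated_loc_of_deriv_le (μ := volume.restrict S)
    (F := F) (F' := fun z t => deriv (fun z => F z t) z) (x₀ := z₀)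
    (s := Metric.ball z₀ (ε / 2)) (bound := fun t => g t / (ε / 4))
    (Metric.ball_mem_nhds z₀ (by positivity))
    (by filter_upwards [Metric.ball_mem_nhds z₀ hε0] with z hz using hmeas' z hz)
    (Integrable.mono' hg (hm z₀ hz₀) ((ae_restrict_iff' hS).2
      (Eventually.of_forall fun t ht => hgb z₀ (Metric.mem_ball_self hε₁) t ht)))
    hderivm
    ((ae_restrict_iff' hS).2 (Eventually.of_forall fun t ht z hz =>
      Complex.norm_deriv_le_of_forall_mem_sphere_norm_le (by positivity)
        (((hd t ht).mono hsubU).mono (hsubcb z hz) |>.diffContOnCl_ball Set.Subset.rfl)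
        fun y hy => hgb y (hsub1 (hsubcb z hz (Metric.sphere_subset_closedBall hy))) t ht))
    (hg.div_const _)
    ((ae_restrict_iff' hS).2 (Eventually.of_forall fun t ht z hz =>
      ((hd t ht).differentiableAt (hU.mem_nhds (hsubU
        (Metric.ball_subset_ball (by linarith) hz)))).hasDerivAt))
  exact key.2.differentiableAt.differentiableWithinAt

lemma differentiableOn_inv_sub_pt (a : Letter) {t : ℝ} (ht : t ∈ Set.Ioo (0 : ℝ) 1) :
    DifferentiableOn ℂ (fun z => ((t : ℂ) - a.pt z)⁻¹) slit := by
  cases a with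
  | zero => exact differentiableOn_const (c := ((t : ℂ) - 0)⁻¹)
  | one => exact differentiableOn_const (c := ((t : ℂ) - 1)⁻¹)
  | z =>
    exact ((differentiableOn_const _).sub differentiableOn_id).inv
      fun z hz => sub_ne_zero_of_mem_slit hz ⟨ht.1.le, ht.2.le⟩

lemma differentiableOn_iterAux {w : List Letter} (hw : w = [] ∨ Regular w) {x : ℝ}
    (hx0 : 0 ≤ x) (hx : x < 1) : DifferentiableOn ℂ (fun z => iterAux z w x) slit := by
  induction w generalizing x with
  | nil => exact differentiableOn_const _
  | cons a w ih =>
    replace hw : Regular (a :: w) := hw.resolve_left (by simp)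
    have hw' := (regular_cons_iff.1 hw).imp_left And.left
    simp only [iterAux, intervalIntegral.integral_of_le hx0]
    refine differentiableOn_setIntegral isOpen_slit measurableSet_Ioc (fun t ht => ?_)
      (fun z hz => ?_) fun z₀ hz₀ => ?_
    · exact (differentiableOn_inv_sub_pt a ⟨ht.1, ht.2.trans_lt hx⟩).mul
        (ih hw' ht.1.le (ht.2.trans_lt hx))
    · obtain ⟨C, hC⟩ := exists_letterBound hz
      exact (integrableOn_integrand hC hw hx).aestronglyMeasurable
    · obtain ⟨ε, hε, C, hC, -, hb⟩ := exists_bound_slit hz₀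
      obtain ⟨D, -, hD⟩ := exists_norm_integrand_le hw (zero_le_one.trans hC)
      exact ⟨ε, hε, _, (integrableOn_rho_div_mul hx).const_mul D, fun z hz t ht =>
        hD z (.of_le hC (hb z hz)) t ⟨ht.1, ht.2.trans_lt hx⟩⟩

lemma differentiableOn_iterAux_one {w : List Letter} (hw : Regular w) {a : Letter}
    (ha : a ≠ .one) : DifferentiableOn ℂ (fun z => iterAux z (a :: w) 1) slit := by
  simp only [iterAux, intervalIntegral.integral_of_le zero_le_one, integral_Ioc_eq_integral_Ioo]
  refine differentiableOn_setIntegral isOpen_slit measurableSet_Ioo (fun t ht => ?_)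
    (fun z hz => ?_) fun z₀ hz₀ => ?_
  · exact (differentiableOn_inv_sub_pt a ht).mul
      (differentiableOn_iterAux (Or.inr hw) ht.1.le ht.2)
  · obtain ⟨C, hC⟩ := exists_letterBound hz
    exact aestronglyMeasurable_integrand z a (continuousOn_iterAux hC (Or.inr hw))
  · obtain ⟨ε, hε, C, hC, -, hb⟩ := exists_bound_slit hz₀
    obtain ⟨D, -, hD⟩ := exists_norm_integrand_le_rho_div hw (zero_le_one.trans hC)
    exact ⟨ε, hε, _, (integrableOn_rho_div.mono_set Set.Ioo_subset_Ioc_self).const_mul D,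
      fun z hz t ht => hD z (.of_le hC (hb z hz)) a t ht (norm_inv_sub_le_div hC (hb z hz) ha ht)⟩

lemma differentiableOn_iterAux_singleton :
    DifferentiableOn ℂ (fun z => iterAux z [Letter.z] 1) slit := by
  simp only [iterAux, intervalIntegral.integral_of_le zero_le_one, integral_Ioc_eq_integral_Ioo,
    mul_one]
  refine differentiableOn_setIntegral isOpen_slit measurableSet_Ioo
    (fun t ht => differentiableOn_inv_sub_pt .z ht)
    (fun z _ => (measurable_inv_sub _).aestronglyMeasurable) fun z₀ hz₀ => ?_
  obtain ⟨ε, hε, C, hC, -, hb⟩ := exists_bound_slit hz₀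
  exact ⟨ε, hε, fun _ => C, by simp, fun z hz t ht => hb z hz t ⟨ht.1.le, ht.2.le⟩⟩

/-! ### Words and the subspace `A0` -/

lemma word_eq_basis (w : List Letter) :
    word w = FreeAlgebra.basisFreeMonoid ℚ Letter (FreeMonoid.ofList w) := by
  simp [word, FreeAlgebra.basisFreeMonoid, FreeAlgebra.equivMonoidAlgebraFreeMonoid]

lemma word_cons (a : Letter) (w : List Letter) : word (a :: w) = FreeAlgebra.ι ℚ a * word w := by
  simp [word]

lemma word_append (v w : List Letter) : word (v ++ w) = word v * word w := by
  simp [word]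

lemma word_singleton (a : Letter) : word [a] = FreeAlgebra.ι ℚ a := by simp [word]

lemma word_replicate (a : Letter) (n : ℕ) :
    word (List.replicate n a) = FreeAlgebra.ι ℚ a ^ n := by
  simp [word]

lemma span_range_word : Submodule.span ℚ (Set.range word) = ⊤ := by
  rw [← (FreeAlgebra.basisFreeMonoid ℚ Letter).span_eq]
  congr 1
  ext x
  constructor
  · rintro ⟨w, rfl⟩
    exact ⟨_, (word_eq_basis w).symm⟩
  · rintro ⟨w, rfl⟩
    exact ⟨w.toList, word_eq_basis _⟩

/-- The words whose iterated integral converges for all `z` off the slit. -/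
def Admissible (w : List Letter) : Prop :=
  w = [] ∨ w = [Letter.z] ∨
    ∃ a u b, a ≠ Letter.zero ∧ b ≠ Letter.one ∧ w = [a] ++ u ++ [b]

lemma span_mul_top_mul_span (x y : A) :
    Submodule.span ℚ {x} * ⊤ * Submodule.span ℚ {y} =
      Submodule.span ℚ {p | ∃ u, p = x * word u * y} := by
  rw [← span_range_word, Submodule.span_mul_span, Submodule.span_mul_span]
  congr 1
  ext p
  simp only [Set.singleton_mul, Set.mul_singleton, Set.mem_image, Set.mem_range,
    exists_exists_eq_and, Set.mem_ofPred_eq]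
  exact exists_congr fun u => eq_comm

lemma A0_le : A0 ≤ Submodule.span ℚ (word '' {w | Admissible w}) := by
  have key : ∀ a b : Letter, a ≠ .zero → b ≠ .one →
      Submodule.span ℚ {FreeAlgebra.ι ℚ a} * ⊤ * Submodule.span ℚ {FreeAlgebra.ι ℚ b} ≤
        Submodule.span ℚ (word '' {w | Admissible w}) := by
    intro a b ha hb
    rw [span_mul_top_mul_span]
    refine Submodule.span_mono ?_
    rintro p ⟨u, rfl⟩
    exact ⟨[a] ++ u ++ [b], Or.inr (Or.inr ⟨a, u, b, ha, hb, rfl⟩), by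
      simp only [word_append, word_singleton]⟩
  refine sup_le (sup_le (sup_le (sup_le (sup_le ?_ ?_) ?_) ?_) ?_) ?_
  · rw [Submodule.span_le]
    rintro _ rfl
    exact Submodule.subset_span ⟨[], Or.inl rfl, rfl⟩
  · rw [Submodule.span_le]
    rintro _ rfl
    exact Submodule.subset_span ⟨[.z], Or.inr (Or.inl rfl), word_singleton _⟩
  · exact key _ _ (by simp) (by simp)
  · exact key _ _ (by simp) (by simp)
  · exact key _ _ (by simp) (by simp)
  · exact key _ _ (by simp) (by simp)

/-- Words form a basis, so a word in the span of a set of words belongs to that set. -/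
lemma admissible_of_word_mem_A0 {w : List Letter} (h : word w ∈ A0) : Admissible w := by
  have h1 := A0_le h
  have h2 : word '' {w | Admissible w} =
      FreeAlgebra.basisFreeMonoid ℚ Letter '' (FreeMonoid.toList ⁻¹' {w | Admissible w}) := by
    ext x
    constructor
    · rintro ⟨v, hv, rfl⟩
      exact ⟨FreeMonoid.ofList v, hv, (word_eq_basis v).symm⟩
    · rintro ⟨v, hv, rfl⟩
      exact ⟨v.toList, hv, word_eq_basis _⟩
  rw [h2, word_eq_basis, Module.Basis.mem_span_image, Module.Basis.repr_self] at h1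
  exact h1 (Finset.mem_coe.2 (by simp : FreeMonoid.ofList w ∈ _))

/-- The polynomials all of whose words begin with `e_1` or `e_z`. -/
noncomputable def B : Submodule ℚ A :=
  Submodule.span ℚ {p | ∃ a u, a ≠ Letter.zero ∧ p = word ([a] ++ u)}

/-- All arguments of `L` in the theorem arise from `e_1` and `e_z` by multiplication from the right;
this keeps the condition on the first letter, and the final factor decides membership in `A0`. -/
lemma mul_e0_mem_A0 {p : A} (hp : p ∈ B) : p * e0 ∈ A0 := by
  induction hp using Submodule.span_induction with
  | mem x hx =>
    obtain ⟨a, u, ha, rfl⟩ := hx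
    rw [word_append, word_singleton]
    have h1 : FreeAlgebra.ι ℚ a * word u * e0 ∈
        Submodule.span ℚ {FreeAlgebra.ι ℚ a} * ⊤ * Submodule.span ℚ {e0} := by
      rw [span_mul_top_mul_span]
      exact Submodule.subset_span ⟨u, rfl⟩
    cases a with
    | zero => exact absurd rfl ha
    | one => exact Submodule.mem_sup_right h1
    | z => exact Submodule.mem_sup_left (Submodule.mem_sup_left (Submodule.mem_sup_right h1))
  | zero => simp
  | add x y _ _ hx hy => rw [add_mul]; exact add_mem hx hy
  | smul c x _ hx => rw [smul_mul_assoc]; exact A0.smul_mem c hx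

lemma mul_ez_mem_A0 {p : A} (hp : p ∈ B) : p * ez ∈ A0 := by
  induction hp using Submodule.span_induction with
  | mem x hx =>
    obtain ⟨a, u, ha, rfl⟩ := hx
    rw [word_append, word_singleton]
    have h1 : FreeAlgebra.ι ℚ a * word u * ez ∈
        Submodule.span ℚ {FreeAlgebra.ι ℚ a} * ⊤ * Submodule.span ℚ {ez} := by
      rw [span_mul_top_mul_span]
      exact Submodule.subset_span ⟨u, rfl⟩
    cases a with
    | zero => exact absurd rfl ha
    | one => exact Submodule.mem_sup_left (Submodule.mem_sup_right h1)
    | z =>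
      exact Submodule.mem_sup_left (Submodule.mem_sup_left (Submodule.mem_sup_left
        (Submodule.mem_sup_right h1)))
  | zero => simp
  | add x y _ _ hx hy => rw [add_mul]; exact add_mem hx hy
  | smul c x _ hx => rw [smul_mul_assoc]; exact A0.smul_mem c hx

lemma mul_ι_mem_B {p : A} (hp : p ∈ B) (b : Letter) : p * FreeAlgebra.ι ℚ b ∈ B := by
  induction hp using Submodule.span_induction with
  | mem x hx =>
    obtain ⟨a, u, ha, rfl⟩ := hx
    exact Submodule.subset_span ⟨a, u ++ [b], ha, by
      rw [← word_singleton, ← word_append, List.append_assoc]⟩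
  | zero => simp
  | add x y _ _ hx hy => rw [add_mul]; exact add_mem hx hy
  | smul c x _ hx => rw [smul_mul_assoc]; exact B.smul_mem c hx

lemma mul_e0_mem_B {p : A} (hp : p ∈ B) : p * e0 ∈ B := mul_ι_mem_B hp _
lemma mul_e1_mem_B {p : A} (hp : p ∈ B) : p * e1 ∈ B := mul_ι_mem_B hp _
lemma mul_ez_mem_B {p : A} (hp : p ∈ B) : p * ez ∈ B := mul_ι_mem_B hp _

lemma e1_mem_B : e1 ∈ B := Submodule.subset_span ⟨.one, [], by simp, by simp [word_singleton, e1]⟩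
lemma ez_mem_B : ez ∈ B := Submodule.subset_span ⟨.z, [], by simp, by simp [word_singleton, ez]⟩

lemma mul_e0_pow_mem_B {p : A} (hp : p ∈ B) (n : ℕ) : p * e0 ^ n ∈ B := by
  induction n with
  | zero => simpa using hp
  | succ n ih => rw [pow_succ, ← mul_assoc]; exact mul_e0_mem_B ih

lemma mul_e0_sub_ez_pow_mem_B {p : A} (hp : p ∈ B) (n : ℕ) : p * (e0 - ez) ^ n ∈ B := by
  induction n with
  | zero => simpa using hp
  | succ n ih =>
    rw [pow_succ, ← mul_assoc, mul_sub]
    exact sub_mem (mul_e0_mem_B ih) (mul_ez_mem_B ih)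

/-! ### The linear extension of the iterated integrals with a variable end point -/

/-- The linear map `e_{a_1} ⋯ e_{a_n} ↦ I(0; a_1, …, a_n; x)`. -/
noncomputable def Lx (z : ℂ) (x : ℝ) : A →ₗ[ℚ] ℂ :=
  (FreeAlgebra.basisFreeMonoid ℚ Letter).constr ℚ fun w => iterAux z w.toList.reverse x

lemma Lx_word (z : ℂ) (x : ℝ) (w : List Letter) : Lx z x (word w) = iterAux z w.reverse x := by
  rw [word_eq_basis, Lx, Module.Basis.constr_basis]
  rfl

lemma regular_reverse {a : Letter} (ha : a ≠ .zero) (u : List Letter) :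
    Regular ([a] ++ u).reverse := ⟨u.reverse, a, ha, by simp⟩

lemma continuousOn_Lx {z : ℂ} {C : ℝ} (h : LetterBound z C) {p : A} (hp : p ∈ B) :
    ContinuousOn (fun t => Lx z t p) (Set.Ico 0 1) := by
  induction hp using Submodule.span_induction with
  | mem x hx =>
    obtain ⟨a, u, ha, rfl⟩ := hx
    simp only [Lx_word]
    exact continuousOn_iterAux h (Or.inr (regular_reverse ha u))
  | zero => simpa using continuousOn_const
  | add x y _ _ hx hy => exact (hx.add hy).congr fun _ _ => map_add _ _ _
  | smul c x _ hx => exact (hx.const_smul c).congr fun _ _ => map_smul _ _ _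

lemma exists_norm_Lx_le {z : ℂ} {C : ℝ} (h : LetterBound z C) {p : A} (hp : p ∈ B) :
    ∃ D, 0 ≤ D ∧ ∀ x, 0 ≤ x → x < 1 → ‖Lx z x p‖ ≤ D * rho x := by
  induction hp using Submodule.span_induction with
  | mem x hx =>
    obtain ⟨a, u, ha, rfl⟩ := hx
    simp only [Lx_word]
    obtain ⟨D, hD, hb⟩ :=
      (regular_reverse ha u).exists_norm_le (zero_le_one.trans h.one_le)
    exact ⟨D, hD, hb z h⟩
  | zero => exact ⟨0, le_rfl, by simp⟩
  | add x y _ _ hx hy =>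
    obtain ⟨D, hD, hb⟩ := hx
    obtain ⟨D', hD', hb'⟩ := hy
    refine ⟨D + D', by positivity, fun t h0 h1 => ?_⟩
    rw [map_add, add_mul]
    exact (norm_add_le _ _).trans (add_le_add (hb t h0 h1) (hb' t h0 h1))
  | smul c x _ hx =>
    obtain ⟨D, hD, hb⟩ := hx
    refine ⟨‖(c : ℂ)‖ * D, by positivity, fun t h0 h1 => ?_⟩
    rw [map_smul, Rat.smul_def, norm_mul, mul_assoc]
    exact mul_le_mul_of_nonneg_left (hb t h0 h1) (norm_nonneg _)

/-- Integrability travels with the formula because additivity of the integral needs it. Leaving the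
case of single words as a hypothesis lets one induction serve end points below `1` with any letter
and the end point `1` with a letter other than `e_1`. -/
lemma Lx_mul_ι_aux {z : ℂ} {x : ℝ} (a : Letter) {p : A} (hp : p ∈ B)
    (hint : ∀ w, Regular w →
      IntervalIntegrable (fun t : ℝ => ((t : ℂ) - a.pt z)⁻¹ * iterAux z w t) volume 0 x) :
    IntervalIntegrable (fun t : ℝ => ((t : ℂ) - a.pt z)⁻¹ * Lx z t p) volume 0 x ∧
    Lx z x (p * FreeAlgebra.ι ℚ a) = ∫ t in (0 : ℝ)..x, ((t : ℂ) - a.pt z)⁻¹ * Lx z t p := by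
  induction hp using Submodule.span_induction with
  | mem q hq =>
    obtain ⟨b, u, hb, rfl⟩ := hq
    rw [← word_singleton, ← word_append]
    simp only [Lx_word, List.reverse_append (as := [b] ++ u)]
    exact ⟨hint _ (regular_reverse hb u), rfl⟩
  | zero => simp
  | add p q _ _ hp hq =>
    simp only [add_mul, map_add, mul_add]
    exact ⟨hp.1.add hq.1, by rw [intervalIntegral.integral_add hp.1 hq.1, hp.2, hq.2]⟩
  | smul c q _ hq =>
    simp only [smul_mul_assoc, map_smul, mul_smul_comm]
    exact ⟨hq.1.smul c, by rw [hq.2, intervalIntegral.integral_smul]⟩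

lemma Lx_mul_ι {z : ℂ} {C : ℝ} (h : LetterBound z C) (a : Letter) {p : A} (hp : p ∈ B) {x : ℝ}
    (hx0 : 0 ≤ x) (hx : x < 1) :
    IntervalIntegrable (fun t : ℝ => ((t : ℂ) - a.pt z)⁻¹ * Lx z t p) volume 0 x ∧
    Lx z x (p * FreeAlgebra.ι ℚ a) = ∫ t in (0 : ℝ)..x, ((t : ℂ) - a.pt z)⁻¹ * Lx z t p :=
  Lx_mul_ι_aux a hp fun _ hw => (intervalIntegrable_iff_integrableOn_Ioc_of_le hx0).2
    (integrableOn_integrand h (hw.cons a) hx)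

lemma L_mul_ι {z : ℂ} (hz : z ∈ slit) {a : Letter} (ha : a ≠ .one) {p : A} (hp : p ∈ B) :
    IntervalIntegrable (fun t : ℝ => ((t : ℂ) - a.pt z)⁻¹ * Lx z t p) volume 0 1 ∧
    L z (p * FreeAlgebra.ι ℚ a) = ∫ t in (0 : ℝ)..1, ((t : ℂ) - a.pt z)⁻¹ * Lx z t p := by
  obtain ⟨ε, hε, C, hC, -, h⟩ := exists_bound_slit hz
  have hb := h z (Metric.mem_ball_self hε)
  exact Lx_mul_ι_aux a hp fun w hw => (intervalIntegrable_iff_integrableOn_Ioo_of_le zero_le_one).2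
    (integrableOn_integrand_one (.of_le hC hb) hw fun t ht => norm_inv_sub_le_div hC hb ha ht)

lemma Lx_mul_e0 {z : ℂ} {C : ℝ} (h : LetterBound z C) {p : A} (hp : p ∈ B) {x : ℝ}
    (hx0 : 0 ≤ x) (hx : x < 1) :
    IntervalIntegrable (fun t : ℝ => (t : ℂ)⁻¹ * Lx z t p) volume 0 x ∧
    Lx z x (p * e0) = ∫ t in (0 : ℝ)..x, (t : ℂ)⁻¹ * Lx z t p := by
  simpa [Letter.pt, e0] using Lx_mul_ι h .zero hp hx0 hx

lemma L_mul_e0 {z : ℂ} (hz : z ∈ slit) {p : A} (hp : p ∈ B) :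
    IntervalIntegrable (fun t : ℝ => (t : ℂ)⁻¹ * Lx z t p) volume 0 1 ∧
    L z (p * e0) = ∫ t in (0 : ℝ)..1, (t : ℂ)⁻¹ * Lx z t p := by
  simpa [Letter.pt, e0] using L_mul_ι hz (a := .zero) (by simp) hp

/-! ### Convergence and holomorphy -/

lemma convergesAbsolutely_of_admissible {w : List Letter} (hw : Admissible w) {z : ℂ}
    (hz : z ∈ slit) : ConvergesAbsolutely z w := by
  obtain ⟨ε, hε, C, hC, -, h⟩ := exists_bound_slit hz
  have hb := h z (Metric.mem_ball_self hε)
  rcases hw with rfl | rfl | ⟨a, u, b, ha, hb', rfl⟩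
  · simp [ConvergesAbsolutely, absIterAux]
  · exact absIterAux_singleton_one_lt_top hb
  · rw [ConvergesAbsolutely, List.reverse_append]
    exact absIterAux_one_lt_top (.of_le hC hb) (regular_reverse ha u)
      fun t ht => norm_inv_sub_le_div hC hb hb' ht

lemma differentiableOn_L {p : A} (hp : p ∈ A0) : DifferentiableOn ℂ (fun z => L z p) slit := by
  have hp' := A0_le hp
  clear hp
  induction hp' using Submodule.span_induction with
  | mem q hq =>
    obtain ⟨w, hw, rfl⟩ := hq
    simp only [L_word, iter]
    rcases hw with rfl | rfl | ⟨a, u, b, ha, hb, rfl⟩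
    · exact differentiableOn_const (1 : ℂ)
    · exact differentiableOn_iterAux_singleton
    · rw [List.reverse_append]
      exact differentiableOn_iterAux_one (regular_reverse ha u) hb
  | zero => simp
  | add x y _ _ hx hy => exact (hx.add hy).congr fun _ _ => map_add _ _ _
  | smul c x _ hx => exact (hx.const_smul c).congr fun _ _ => map_smul _ _ _

/-! ### Powers of the logarithm -/

/-- The function `(-log v)^n / n!`. -/
noncomputable def ell (n : ℕ) (v : ℝ) : ℝ := (-Real.log v) ^ n / n.factorial

lemma ell_zero (v : ℝ) : ell 0 v = 1 := by simp [ell]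

lemma ell_nonneg (n : ℕ) {v : ℝ} (h0 : 0 ≤ v) (h1 : v ≤ 1) : 0 ≤ ell n v :=
  div_nonneg (pow_nonneg (neg_nonneg.2 (Real.log_nonpos h0 h1)) n) (Nat.cast_nonneg _)

/-- From `y^n/n! ≤ e^y` at `y = -log v / 8`. The exponent `1/8` is a small budget: together with the
`1/4` lost in `integral_triangle` it leaves `rho s / s * s^(-3/8)` integrable at `0`. -/
lemma ell_le (n : ℕ) {v : ℝ} (h0 : 0 < v) (h1 : v ≤ 1) :
    ell n v ≤ 8 ^ n * v ^ (-(1 / 8) : ℝ) := by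
  have hy : 0 ≤ -Real.log v / 8 := by linarith [Real.log_nonpos h0.le h1]
  have h := Real.pow_div_factorial_le_exp _ hy n
  have h2 : Real.exp (-Real.log v / 8) = v ^ (-(1 / 8) : ℝ) := by
    rw [Real.rpow_def_of_pos h0]; congr 1; ring
  rw [h2] at h
  calc ell n v = 8 ^ n * ((-Real.log v / 8) ^ n / n.factorial) := by
        rw [ell, div_pow]; field_simp
    _ ≤ _ := by gcongr

lemma measurable_ell (n : ℕ) : Measurable (ell n) := by
  unfold ell; fun_prop

lemma integrableOn_rpow_Ioo {s : ℝ} (hs : -1 < s) :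
    IntegrableOn (fun v : ℝ => v ^ s) (Set.Ioo 0 1) :=
  (intervalIntegrable_iff_integrableOn_Ioo_of_le zero_le_one).1
    (intervalIntegral.intervalIntegrable_rpow' hs)

lemma integrableOn_ell (n : ℕ) : IntegrableOn (ell n) (Set.Ioo 0 1) := by
  refine Integrable.mono' ((integrableOn_rpow_Ioo (s := -(1 / 8)) (by norm_num)).const_mul (8 ^ n))
    (measurable_ell n).aestronglyMeasurable ?_
  refine (ae_restrict_iff' measurableSet_Ioo).2 (Eventually.of_forall fun v hv => ?_)
  rw [Real.norm_of_nonneg (ell_nonneg n hv.1.le hv.2.le)]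
  exact ell_le n hv.1 hv.2.le

lemma hasDerivAt_ell_succ (n : ℕ) {v : ℝ} (h0 : 0 < v) :
    HasDerivAt (ell (n + 1)) (-(ell n v / v)) v := by
  have h := (((Real.hasDerivAt_log h0.ne').neg).pow (n + 1)).div_const ((n + 1).factorial : ℝ)
  refine h.congr_deriv ?_
  simp only [ell, Nat.factorial_succ, Nat.cast_mul, Nat.cast_add, Nat.cast_one,
    Nat.add_sub_cancel, Pi.neg_apply]
  have : (n.factorial : ℝ) ≠ 0 := Nat.cast_ne_zero.2 n.factorial_ne_zero
  have h2 : (n : ℝ) + 1 ≠ 0 := by positivity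
  field_simp

lemma continuousOn_mul_ell (n : ℕ) : ContinuousOn (fun v => v * ell n v) (Set.Icc 0 1) := by
  intro v hv
  rcases hv.1.eq_or_lt with rfl | h0
  · have h1 : Tendsto (fun v : ℝ => 8 ^ n * v ^ (7 / 8 : ℝ)) (𝓝[Set.Icc 0 1] 0) (𝓝 0) := by
      have : Continuous fun v : ℝ => 8 ^ n * v ^ (7 / 8 : ℝ) :=
        (Real.continuous_rpow_const (by norm_num)).const_mul _
      have := (this.tendsto 0).mono_left (nhdsWithin_le_nhds (s := Set.Icc 0 1))
      simpa using this
    rw [ContinuousWithinAt, zero_mul]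
    refine squeeze_zero' ?_ ?_ h1
    · filter_upwards [self_mem_nhdsWithin] with v hv
      exact mul_nonneg hv.1 (ell_nonneg n hv.1 hv.2)
    · filter_upwards [self_mem_nhdsWithin] with v hv
      rcases hv.1.eq_or_lt with rfl | h0
      · simp
      · calc v * ell n v ≤ v * (8 ^ n * v ^ (-(1 / 8) : ℝ)) :=
            mul_le_mul_of_nonneg_left (ell_le n h0 hv.2) h0.le
          _ = 8 ^ n * (v ^ (1 : ℝ) * v ^ (-(1 / 8) : ℝ)) := by rw [Real.rpow_one]; ring
          _ = 8 ^ n * v ^ (7 / 8 : ℝ) := by rw [← Real.rpow_add h0]; norm_num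
  · refine (continuousAt_id.mul ?_).continuousWithinAt
    exact (((Real.continuousAt_log h0.ne').neg).pow n).div_const _

/-- Apply `log u ≥ 1 - 1/u` to `u = v^(1/8)`; the factor `1 - v` records that the logarithm vanishes
at `1`. -/
lemma neg_log_le {v : ℝ} (h0 : 0 < v) (h1 : v ≤ 1) :
    -Real.log v ≤ 8 * ((1 - v) * v ^ (-(1 / 8) : ℝ)) := by
  have hu : 0 < v ^ (1 / 8 : ℝ) := Real.rpow_pos_of_pos h0 _
  have h2 := Real.one_sub_inv_le_log_of_pos hu
  rw [Real.log_rpow h0, ← Real.rpow_neg h0.le] at h2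
  have h3 : v * v ^ (-(1 / 8) : ℝ) ≤ 1 := by
    calc v * v ^ (-(1 / 8) : ℝ) = v ^ (1 : ℝ) * v ^ (-(1 / 8) : ℝ) := by rw [Real.rpow_one]
      _ = v ^ (7 / 8 : ℝ) := by rw [← Real.rpow_add h0]; norm_num
      _ ≤ 1 := Real.rpow_le_one h0.le h1 (by norm_num)
  nlinarith

/-- One logarithm is spent on the zero at `v = 1`, which will cancel the pole of `1/(1-v)`; the
other `n` cost only a small power of `v`. -/
lemma ell_succ_le (n : ℕ) {v : ℝ} (h0 : 0 < v) (h1 : v ≤ 1) :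
    ell (n + 1) v ≤ 8 ^ (n + 1) * ((1 - v) * v ^ (-(1 / 4) : ℝ)) := by
  have hl := neg_nonneg.2 (Real.log_nonpos h0.le h1)
  have h2 : ell (n + 1) v = ell n v * (-Real.log v) / (n + 1) := by
    simp only [ell, Nat.factorial_succ, Nat.cast_mul, Nat.cast_add, Nat.cast_one, pow_succ]
    have : (n.factorial : ℝ) ≠ 0 := Nat.cast_ne_zero.2 n.factorial_ne_zero
    field_simp
  calc ell (n + 1) v ≤ ell n v * (-Real.log v) := by
        rw [h2]
        exact div_le_self (mul_nonneg (ell_nonneg n h0.le h1) hl) (by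
          linarith [n.cast_nonneg (α := ℝ)])
    _ ≤ (8 ^ n * v ^ (-(1 / 8) : ℝ)) * (8 * ((1 - v) * v ^ (-(1 / 8) : ℝ))) :=
        mul_le_mul (ell_le n h0 h1) (neg_log_le h0 h1) hl (by positivity)
    _ = 8 ^ (n + 1) * ((1 - v) * (v ^ (-(1 / 8) : ℝ) * v ^ (-(1 / 8) : ℝ))) := by ring
    _ = _ := by rw [← Real.rpow_add h0]; norm_num

lemma integrableOn_ell_succ_div (n : ℕ) :
    IntegrableOn (fun v => ell (n + 1) v / (1 - v)) (Set.Ioo 0 1) := by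
  refine Integrable.mono' ((integrableOn_rpow_Ioo (s := -(1 / 4)) (by norm_num)).const_mul
    (8 ^ (n + 1)))
    ((measurable_ell _).div (measurable_id.const_sub 1)).aestronglyMeasurable ?_
  refine (ae_restrict_iff' measurableSet_Ioo).2 (Eventually.of_forall fun v hv => ?_)
  have h2 : 0 < 1 - v := by linarith [hv.2]
  rw [Real.norm_of_nonneg (div_nonneg (ell_nonneg _ hv.1.le hv.2.le) h2.le), div_le_iff₀ h2]
  exact (ell_succ_le n hv.1 hv.2.le).trans_eq (by ring)

/-! ### Polylogarithms -/

/-- The polylogarithm `Li_{n+1}` as an integral. -/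
noncomputable def Lam (n : ℕ) (w : ℂ) : ℂ :=
  ∫ v in Set.Ioo (0 : ℝ) 1, w / (1 - v * w) * ell n v

/-- The domain `ℂ ∖ [1,∞)` of the polylogarithms. -/
def NoPole (w : ℂ) : Prop := ∀ v ∈ Set.Icc (0 : ℝ) 1, 1 - (v : ℂ) * w ≠ 0

lemma NoPole.exists_ball {w : ℂ} (h : NoPole w) : ∃ ε > 0, ∃ c > 0, ∀ w' ∈ Metric.ball w ε,
    ∀ v ∈ Set.Icc (0 : ℝ) 1, c ≤ ‖1 - (v : ℂ) * w'‖ := by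
  have hc : ContinuousOn (fun v : ℝ => ‖1 - (v : ℂ) * w‖) (Set.Icc 0 1) := by fun_prop
  obtain ⟨v₀, hv₀, hmin⟩ := isCompact_Icc.exists_isMinOn ⟨0, by simp⟩ hc
  have hpos : 0 < ‖1 - (v₀ : ℂ) * w‖ := norm_pos_iff.2 (h v₀ hv₀)
  refine ⟨‖1 - (v₀ : ℂ) * w‖ / 2, by positivity, ‖1 - (v₀ : ℂ) * w‖ / 2, by positivity,
    fun w' hw' v hv => ?_⟩
  have h1 : ‖1 - (v₀ : ℂ) * w‖ ≤ ‖1 - (v : ℂ) * w‖ := hmin hv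
  rw [Metric.mem_ball, dist_eq_norm] at hw'
  have h2 : ‖1 - (v : ℂ) * w‖ ≤ ‖1 - (v : ℂ) * w'‖ + ‖(v : ℂ) * (w' - w)‖ := by
    rw [show 1 - (v : ℂ) * w = 1 - (v : ℂ) * w' + (v : ℂ) * (w' - w) by ring]
    exact norm_add_le _ _
  have h3 : ‖(v : ℂ) * (w' - w)‖ ≤ ‖w' - w‖ := by
    rw [norm_mul, Complex.norm_real, Real.norm_of_nonneg hv.1]
    exact mul_le_of_le_one_left (norm_nonneg _) hv.2
  linarith

lemma measurable_ell_ofReal (n : ℕ) : Measurable fun v : ℝ => (ell n v : ℂ) :=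
  Complex.measurable_ofReal.comp (measurable_ell n)

lemma norm_ell (n : ℕ) {v : ℝ} (hv : v ∈ Set.Ioo (0 : ℝ) 1) : ‖(ell n v : ℂ)‖ = ell n v := by
  rw [Complex.norm_real, Real.norm_of_nonneg (ell_nonneg n hv.1.le hv.2.le)]

lemma integrableOn_mul_ell {f : ℝ → ℂ} {C : ℝ} (n : ℕ) (hm : Measurable f)
    (hb : ∀ v ∈ Set.Ioo (0 : ℝ) 1, ‖f v‖ ≤ C) :
    IntegrableOn (fun v => f v * ell n v) (Set.Ioo 0 1) := by
  refine Integrable.mono' ((integrableOn_ell n).const_mul C)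
    (hm.mul (measurable_ell_ofReal n)).aestronglyMeasurable ?_
  refine (ae_restrict_iff' measurableSet_Ioo).2 (Eventually.of_forall fun v hv => ?_)
  rw [norm_mul, norm_ell n hv]
  exact mul_le_mul_of_nonneg_right (hb v hv) (ell_nonneg n hv.1.le hv.2.le)

lemma NoPole.integrableOn {w : ℂ} (h : NoPole w) (n : ℕ) :
    IntegrableOn (fun v : ℝ => w / (1 - v * w) * ell n v) (Set.Ioo 0 1) := by
  obtain ⟨ε, hε, c, hc, hb⟩ := h.exists_ball
  refine integrableOn_mul_ell (C := ‖w‖ / c) n (by fun_prop) fun v hv => ?_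
  rw [norm_div]
  exact div_le_div_of_nonneg_left (norm_nonneg _) hc
    (hb w (Metric.mem_ball_self hε) v ⟨hv.1.le, hv.2.le⟩)

lemma NoPole.integrableOn_sq {w : ℂ} (h : NoPole w) (n : ℕ) :
    IntegrableOn (fun v : ℝ => 1 / (1 - v * w) ^ 2 * ell n v) (Set.Ioo 0 1) := by
  obtain ⟨ε, hε, c, hc, hb⟩ := h.exists_ball
  refine integrableOn_mul_ell (C := 1 / c ^ 2) n (by fun_prop) fun v hv => ?_
  rw [norm_div, norm_one, norm_pow]
  have := hb w (Metric.mem_ball_self hε) v ⟨hv.1.le, hv.2.le⟩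
  gcongr

lemma hasDerivAt_Lam (n : ℕ) {w : ℂ} (h : NoPole w) :
    HasDerivAt (Lam n) (∫ v in Set.Ioo (0 : ℝ) 1, 1 / (1 - v * w) ^ 2 * ell n v) w := by
  obtain ⟨ε, hε, c, hc, hb⟩ := h.exists_ball
  refine (hasDerivAt_integral_of_dominated_loc_of_deriv_le
    (𝕜 := ℂ) (F := fun (w : ℂ) (v : ℝ) => w / (1 - v * w) * (ell n v : ℂ))
    (F' := fun (w : ℂ) (v : ℝ) => 1 / (1 - v * w) ^ 2 * (ell n v : ℂ))
    (bound := fun v => 1 / c ^ 2 * ell n v)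
    (Metric.ball_mem_nhds w hε) (Eventually.of_forall fun w' => ?_) (h.integrableOn n) ?_ ?_
    ((integrableOn_ell n).const_mul _) ?_).2
  · exact (Measurable.mul (by fun_prop) (measurable_ell_ofReal n)).aestronglyMeasurable
  · exact (Measurable.mul (by fun_prop) (measurable_ell_ofReal n)).aestronglyMeasurable
  · refine (ae_restrict_iff' measurableSet_Ioo).2 (Eventually.of_forall fun v hv w' hw' => ?_)
    rw [norm_mul, norm_ell n hv, norm_div, norm_one, norm_pow]
    have := hb w' hw' v ⟨hv.1.le, hv.2.le⟩
    have := ell_nonneg n hv.1.le hv.2.le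
    gcongr
  · refine (ae_restrict_iff' measurableSet_Ioo).2 (Eventually.of_forall fun v hv w' hw' => ?_)
    have hne : 1 - (v : ℂ) * w' ≠ 0 :=
      norm_pos_iff.1 (hc.trans_le (hb w' hw' v ⟨hv.1.le, hv.2.le⟩))
    have h1 : HasDerivAt (fun w' : ℂ => 1 - (v : ℂ) * w') (-((v : ℂ) * 1)) w' :=
      ((hasDerivAt_id' w').const_mul (v : ℂ)).const_sub 1
    refine (((hasDerivAt_id' w').div h1 hne).mul_const (ell n v : ℂ)).congr_deriv ?_
    congr 2
    ring

lemma hasDerivAt_div_one_sub {w : ℂ} {v : ℝ} (hne : 1 - (v : ℂ) * w ≠ 0) :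
    HasDerivAt (fun v : ℝ => (v : ℂ) / (1 - v * w)) (1 / (1 - v * w) ^ 2) v := by
  have h0 : HasDerivAt (fun v : ℝ => (v : ℂ)) 1 v := Complex.ofRealCLM.hasDerivAt
  have h1 : HasDerivAt (fun v : ℝ => 1 - (v : ℂ) * w) (-(1 * w)) v :=
    (h0.mul_const w).const_sub 1
  refine (h0.div h1 hne).congr_deriv ?_
  congr 1
  ring

/-- The derivative of `Li_1(w) = -log(1-w)`; the integrand has the primitive `v/(1-vw)`. -/
lemma integral_one_div_sq {w : ℂ} (h : NoPole w) :
    ∫ v in Set.Ioo (0 : ℝ) 1, 1 / (1 - v * w) ^ 2 * (ell 0 v : ℂ) = 1 / (1 - w) := by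
  rw [← integral_Ioc_eq_integral_Ioo, ← intervalIntegral.integral_of_le zero_le_one,
    intervalIntegral.integral_eq_sub_of_hasDerivAt_of_le zero_le_one
      (f := fun v : ℝ => (v : ℂ) / (1 - v * w))]
  · simp
  · exact ContinuousOn.div (by fun_prop) (by fun_prop) h
  · intro v hv
    simpa [ell_zero] using hasDerivAt_div_one_sub (h v ⟨hv.1.le, hv.2.le⟩)
  · exact (intervalIntegrable_iff_integrableOn_Ioo_of_le zero_le_one).2 (h.integrableOn_sq 0)

/-- The relation `w Li_{n+2}'(w) = Li_{n+1}(w)`, by parts in `v` with the primitive `v/(1-vw)`. The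
boundary terms vanish: `v * ell (n+1) v` tends to `0` at `0`, and `ell (n+1) 1 = 0`. -/
lemma integral_one_div_sq_succ {w : ℂ} (h : NoPole w) (n : ℕ) :
    w * ∫ v in Set.Ioo (0 : ℝ) 1, 1 / (1 - v * w) ^ 2 * (ell (n + 1) v : ℂ) = Lam n w := by
  have hcont : ContinuousOn (fun v : ℝ => (1 - (v : ℂ) * w)⁻¹ * ((v * ell (n + 1) v : ℝ) : ℂ))
      (Set.Icc 0 1) :=
    (ContinuousOn.inv₀ (by fun_prop) h).mul
      (Complex.continuous_ofReal.comp_continuousOn (continuousOn_mul_ell _))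
  have hderiv : ∀ v ∈ Set.Ioo (0 : ℝ) 1,
      HasDerivAt (fun v : ℝ => (1 - (v : ℂ) * w)⁻¹ * ((v * ell (n + 1) v : ℝ) : ℂ))
      (1 / (1 - v * w) ^ 2 * ell (n + 1) v - 1 / (1 - v * w) * ell n v) v := by
    intro v hv
    have hne := h v ⟨hv.1.le, hv.2.le⟩
    have h1 := (hasDerivAt_div_one_sub hne).mul (hasDerivAt_ell_succ n hv.1).ofReal_comp
    refine (h1.congr_deriv ?_).congr_of_eventuallyEq (Eventually.of_forall fun v => ?_)
    · have := Complex.ofReal_ne_zero.2 hv.1.ne'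
      push_cast
      field_simp
      ring
    · simp only [Pi.mul_apply]
      push_cast
      ring
  have hi2 : IntegrableOn (fun v : ℝ => 1 / (1 - v * w) * (ell n v : ℂ)) (Set.Ioo 0 1) := by
    obtain ⟨ε, hε, c, hc, hb⟩ := h.exists_ball
    refine integrableOn_mul_ell (C := 1 / c) n (by fun_prop) fun v hv => ?_
    rw [norm_div, norm_one]
    have := hb w (Metric.mem_ball_self hε) v ⟨hv.1.le, hv.2.le⟩
    gcongr
  have key := intervalIntegral.integral_eq_sub_of_hasDerivAt_of_le zero_le_one hcont hderiv
    ((intervalIntegrable_iff_integrableOn_Ioo_of_le zero_le_one).2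
      ((h.integrableOn_sq (n + 1)).sub hi2))
  rw [intervalIntegral.integral_of_le zero_le_one, integral_Ioc_eq_integral_Ioo,
    integral_sub (h.integrableOn_sq (n + 1)) hi2] at key
  have h1 : ell (n + 1) 1 = 0 := by simp [ell]
  simp only [h1, mul_zero, zero_mul, Complex.ofReal_zero, sub_zero] at key
  rw [sub_eq_zero.1 key, Lam, ← integral_const_mul]
  congr 1
  ext v
  ring

/-- Composition with a path `q` that starts at `0`. -/
lemma Lam_zero_comp {q q' : ℝ → ℂ} {x : ℝ} (hx0 : 0 ≤ x) (hq0 : q 0 = 0)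
    (hp : ∀ t ∈ Set.Icc 0 x, NoPole (q t)) (hq : ∀ t ∈ Set.Icc 0 x, HasDerivAt q (q' t) t)
    (hint : IntervalIntegrable (fun t => q' t / (1 - q t)) volume 0 x) :
    ∫ t in (0 : ℝ)..x, q' t / (1 - q t) = Lam 0 (q x) := by
  have hd : ∀ t ∈ Set.Icc 0 x, HasDerivAt (fun t => Lam 0 (q t)) (q' t / (1 - q t)) t := by
    intro t ht
    have := (hasDerivAt_Lam 0 (hp t ht)).comp t (hq t ht)
    rw [integral_one_div_sq (hp t ht)] at this
    exact this.congr_deriv (by ring)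
  rw [intervalIntegral.integral_eq_sub_of_hasDerivAt_of_le hx0
    (fun t ht => (hd t ht).continuousAt.continuousWithinAt)
    (fun t ht => hd t ⟨ht.1.le, ht.2.le⟩) hint, hq0]
  simp [Lam]

/-- The relation `Li_{n+2}' = Li_{n+1}/w` pulled back along a path; it is used for the identity path
and for the Möbius path `mob z`. -/
lemma Lam_succ_comp (n : ℕ) {q q' : ℝ → ℂ} {x : ℝ} (hx0 : 0 ≤ x) (hq0 : q 0 = 0)
    (hp : ∀ t ∈ Set.Icc 0 x, NoPole (q t)) (hq : ∀ t ∈ Set.Icc 0 x, HasDerivAt q (q' t) t)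
    (hne : ∀ t ∈ Set.Ioo 0 x, q t ≠ 0)
    (hint : IntervalIntegrable (fun t => q' t / q t * Lam n (q t)) volume 0 x) :
    ∫ t in (0 : ℝ)..x, q' t / q t * Lam n (q t) = Lam (n + 1) (q x) := by
  have hd := fun t ht => (hasDerivAt_Lam (n + 1) (hp t ht)).comp t (hq t ht)
  rw [intervalIntegral.integral_eq_sub_of_hasDerivAt_of_le hx0 (f := Lam (n + 1) ∘ q)
    (fun t ht => (hd t ht).continuousAt.continuousWithinAt)
    (fun t ht => (hd t ⟨ht.1.le, ht.2.le⟩).congr_deriv ?_) hint, Function.comp, Function.comp, hq0]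
  · simp [Lam]
  · have h0 := hne t ht
    rw [← integral_one_div_sq_succ (hp t ⟨ht.1.le, ht.2.le⟩), div_mul_eq_mul_div,
      mul_left_comm, mul_div_cancel_left₀ _ h0, mul_comm]

/-! ### The two families of iterated integrals that are polylogarithms -/

lemma noPole_ofReal {t : ℝ} (ht : t ∈ Set.Ico (0 : ℝ) 1) : NoPole (t : ℂ) := by
  intro v hv h
  have h1 : 1 - v * t = 0 := by exact_mod_cast h
  nlinarith [hv.1, hv.2, ht.1, ht.2]

/-- The Möbius transformation that fixes `0` and `1` and sends `z` to `∞`. -/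
noncomputable def mob (z : ℂ) (t : ℝ) : ℂ := (z - 1) * t / (z - t)

lemma z_sub_ne_zero {z : ℂ} (hz : z ∈ slit) {t : ℝ} (ht : t ∈ Set.Icc (0 : ℝ) 1) :
    z - (t : ℂ) ≠ 0 := sub_ne_zero.2 fun h => sub_ne_zero_of_mem_slit hz ht (by rw [h, sub_self])

lemma z_ne_zero {z : ℂ} (hz : z ∈ slit) : z ≠ 0 := by
  simpa using z_sub_ne_zero hz (t := 0) (by simp)

lemma z_sub_one_ne_zero {z : ℂ} (hz : z ∈ slit) : z - 1 ≠ 0 := by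
  simpa using z_sub_ne_zero hz (t := 1) (by simp)

/-- The kernel equals `(1-vt)(z-s)` with `s = t(1-v)/(1-vt)`, a point of `[0,1]`, so the distance
from `z` to `[0,1]` controls it. -/
lemma exists_kernel_bound {z : ℂ} (hz : z ∈ slit) : ∃ C, 0 < C ∧ ∀ t ∈ Set.Icc (0 : ℝ) 1,
    ∀ v ∈ Set.Icc (0 : ℝ) 1, v * t < 1 →
    (1 - v * t) / C ≤ ‖z * (1 - v * t) - t * (1 - v)‖ := by
  obtain ⟨ε, hε, C, hC, -, hb⟩ := exists_bound_slit hz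
  refine ⟨C, by linarith, fun t ht v hv hvt => ?_⟩
  have hpos : 0 < 1 - v * t := by linarith
  set s := t * (1 - v) / (1 - v * t) with hs
  have hsI : s ∈ Set.Icc (0 : ℝ) 1 := by
    refine ⟨div_nonneg (mul_nonneg ht.1 (by linarith [hv.2])) hpos.le, ?_⟩
    rw [div_le_one hpos]
    nlinarith [ht.2]
  have h1 := hb z (Metric.mem_ball_self hε) s hsI
  have hn : 0 < ‖(s : ℂ) - z‖ := norm_pos_iff.2 (sub_ne_zero_of_mem_slit hz hsI)
  rw [norm_inv, inv_le_iff_one_le_mul₀ hn] at h1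
  have h2 : z * (1 - v * t) - t * (1 - v) = ((1 - v * t : ℝ) : ℂ) * -(s - z) := by
    have : (1 - (v : ℂ) * t) ≠ 0 := by exact_mod_cast hpos.ne'
    rw [hs]
    push_cast
    field_simp
    ring
  rw [h2, norm_mul, norm_neg, Complex.norm_real, Real.norm_of_nonneg hpos.le,
    div_le_iff₀ (by linarith)]
  nlinarith

lemma kernel_ne_zero {z : ℂ} (hz : z ∈ slit) {t v : ℝ} (ht : t ∈ Set.Icc (0 : ℝ) 1)
    (hv : v ∈ Set.Icc (0 : ℝ) 1) (hvt : v * t < 1) : z * (1 - v * t) - t * (1 - v) ≠ 0 := by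
  obtain ⟨C, hC, hb⟩ := exists_kernel_bound hz
  exact norm_pos_iff.1 ((div_pos (by linarith) hC).trans_le (hb t ht v hv hvt))

lemma one_sub_mul_mob {z : ℂ} (hz : z ∈ slit) {t : ℝ} (ht : t ∈ Set.Icc (0 : ℝ) 1) (v : ℝ) :
    1 - v * mob z t = (z * (1 - v * t) - t * (1 - v)) / (z - t) := by
  have := z_sub_ne_zero hz ht
  rw [mob]
  field_simp
  ring

lemma mob_div_one_sub {z : ℂ} (hz : z ∈ slit) {t : ℝ} (ht : t ∈ Set.Icc (0 : ℝ) 1) (v : ℝ) :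
    mob z t / (1 - v * mob z t) = (z - 1) * t / (z * (1 - v * t) - t * (1 - v)) := by
  have := z_sub_ne_zero hz ht
  rw [one_sub_mul_mob hz ht, mob, div_div_div_cancel_right₀ this]

lemma noPole_mob {z : ℂ} (hz : z ∈ slit) {t : ℝ} (ht : t ∈ Set.Ico (0 : ℝ) 1) :
    NoPole (mob z t) := by
  intro v hv
  have ht' : t ∈ Set.Icc (0 : ℝ) 1 := ⟨ht.1, ht.2.le⟩
  rw [one_sub_mul_mob hz ht']
  exact div_ne_zero (kernel_ne_zero hz ht' hv (by nlinarith [hv.1, hv.2, ht.1, ht.2]))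
    (z_sub_ne_zero hz ht')

lemma hasDerivAt_mob {z : ℂ} (hz : z ∈ slit) {t : ℝ} (ht : t ∈ Set.Icc (0 : ℝ) 1) :
    HasDerivAt (mob z) ((z - 1) * z / (z - t) ^ 2) t := by
  have h0 : HasDerivAt (fun v : ℝ => (v : ℂ)) 1 t := Complex.ofRealCLM.hasDerivAt
  refine ((h0.const_mul (z - 1)).div (h0.const_sub z) (z_sub_ne_zero hz ht)).congr_deriv ?_
  congr 1
  ring

lemma Lx_e1_mul_e0_pow (z : ℂ) {C : ℝ} (h : LetterBound z C) (n : ℕ) {x : ℝ} (hx0 : 0 ≤ x)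
    (hx : x < 1) : Lx z x (e1 * e0 ^ n) = -Lam n x := by
  have hp : ∀ t ∈ Set.Icc 0 x, NoPole (t : ℂ) := fun t ht => noPole_ofReal ⟨ht.1, ht.2.trans_lt hx⟩
  have hd : ∀ t ∈ Set.Icc 0 x, HasDerivAt (fun v : ℝ => (v : ℂ)) 1 t :=
    fun t _ => Complex.ofRealCLM.hasDerivAt
  induction n generalizing x with
  | zero =>
    have hint : IntervalIntegrable (fun t : ℝ => 1 / (1 - (t : ℂ))) volume 0 x := by
      refine ContinuousOn.intervalIntegrable (ContinuousOn.div (by fun_prop) (by fun_prop) ?_)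
      rw [Set.uIcc_of_le hx0]
      intro t ht
      simpa using hp t ht 1 (by simp)
    have := Lam_zero_comp hx0 (q := fun t : ℝ => (t : ℂ)) (by simp) hp hd hint
    rw [← this, pow_zero, mul_one, e1, ← word_singleton, Lx_word, List.reverse_singleton, iterAux,
      ← intervalIntegral.integral_neg]
    congr 1
    ext t
    rw [iterAux, Letter.pt, mul_one, one_div, ← inv_neg, neg_sub]
  | succ n ih =>
    obtain ⟨hi, he⟩ := Lx_mul_e0 h (mul_e0_pow_mem_B e1_mem_B n) hx0 hx
    have hcongr : Set.EqOn (fun t : ℝ => (t : ℂ)⁻¹ * Lx z t (e1 * e0 ^ n))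
        (fun t : ℝ => -(1 / (t : ℂ) * Lam n t)) (Set.uIcc 0 x) := by
      intro t ht
      rw [Set.uIcc_of_le hx0] at ht
      simp only
      rw [ih ht.1 (ht.2.trans_lt hx) (fun s hs => hp s ⟨hs.1, hs.2.trans ht.2⟩)
        (fun s hs => hd s ⟨hs.1, hs.2.trans ht.2⟩)]
      ring
    have hi' : IntervalIntegrable (fun t : ℝ => 1 / (t : ℂ) * Lam n t) volume 0 x := by
      have := (hi.congr (hcongr.mono Set.uIoc_subset_uIcc)).neg
      simpa [Pi.neg_def] using this
    rw [pow_succ, ← mul_assoc, he, intervalIntegral.integral_congr hcongr,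
      intervalIntegral.integral_neg,
      Lam_succ_comp n hx0 (q := fun t : ℝ => (t : ℂ)) (by simp) hp hd
        (fun t ht => Complex.ofReal_ne_zero.2 ht.1.ne') hi']

/-- Under `w = mob z t` the form `dw/w` becomes `dt/t - dt/(t-z)` and `dw/(w-1)` becomes `dt/(t-1) -
dt/(t-z)`. The integral is thus that of `e_1 e_0^n` taken from `0` to `mob z x`. -/
lemma Lx_e1_sub_ez_mul_pow {z : ℂ} (hz : z ∈ slit) (n : ℕ) {x : ℝ} (hx0 : 0 ≤ x)
    (hx : x < 1) : Lx z x ((e1 - ez) * (e0 - ez) ^ n) = -Lam n (mob z x) := by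
  obtain ⟨C, hC⟩ := exists_letterBound hz
  have hI : ∀ t ∈ Set.Icc 0 x, t ∈ Set.Icc (0 : ℝ) 1 := fun t ht => ⟨ht.1, ht.2.trans hx.le⟩
  have hp : ∀ t ∈ Set.Icc 0 x, NoPole (mob z t) :=
    fun t ht => noPole_mob hz ⟨ht.1, ht.2.trans_lt hx⟩
  have hd : ∀ t ∈ Set.Icc 0 x, HasDerivAt (mob z) ((z - 1) * z / (z - t) ^ 2) t :=
    fun t ht => hasDerivAt_mob hz (hI t ht)
  have h0 : mob z 0 = 0 := by simp [mob]
  have hz0 := z_ne_zero hz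
  have hz1 := z_sub_one_ne_zero hz
  induction n generalizing x with
  | zero =>
    have hcongr : Set.EqOn (fun t : ℝ => (((t : ℂ) - 1)⁻¹ - ((t : ℂ) - z)⁻¹))
        (fun t : ℝ => -((z - 1) * z / (z - t) ^ 2 / (1 - mob z t))) (Set.uIcc 0 x) := by
      intro t ht
      rw [Set.uIcc_of_le hx0] at ht
      have h1 : (t : ℂ) - 1 ≠ 0 := by
        rw [← Complex.ofReal_one, ← Complex.ofReal_sub, Complex.ofReal_ne_zero]
        linarith [ht.2]
      have h1' : 1 - (t : ℂ) ≠ 0 := by rwa [← neg_sub, neg_ne_zero]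
      have h2 := z_sub_ne_zero hz (hI t ht)
      have h3 := one_sub_mul_mob hz (hI t ht) 1
      simp only [Complex.ofReal_one, one_mul, sub_self, mul_zero, sub_zero] at h3
      simp only
      rw [h3, ← neg_sub (z : ℂ), ← neg_sub 1 (t : ℂ)]
      field_simp
      ring
    have hi1 : IntervalIntegrable (fun t : ℝ => ((t : ℂ) - 1)⁻¹) volume 0 x := by
      have := integrableOn_integrand hC (regular_singleton (a := .one) (by simp)) hx
      simpa [iterAux, Letter.pt] using (intervalIntegrable_iff_integrableOn_Ioc_of_le hx0).2 this
    have hi2 : IntervalIntegrable (fun t : ℝ => ((t : ℂ) - z)⁻¹) volume 0 x := by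
      have := integrableOn_integrand hC (regular_singleton (a := .z) (by simp)) hx
      simpa [iterAux, Letter.pt] using (intervalIntegrable_iff_integrableOn_Ioc_of_le hx0).2 this
    have hint : IntervalIntegrable (fun t : ℝ => (z - 1) * z / (z - t) ^ 2 / (1 - mob z t))
        volume 0 x := by
      have := ((hi1.sub hi2).congr (hcongr.mono Set.uIoc_subset_uIcc)).neg
      simpa [Pi.neg_def] using this
    rw [← Lam_zero_comp hx0 h0 hp hd hint, ← intervalIntegral.integral_neg,
      ← intervalIntegral.integral_congr hcongr, intervalIntegral.integral_sub hi1 hi2,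
      pow_zero, mul_one, map_sub, e1, ez, ← word_singleton, ← word_singleton, Lx_word, Lx_word]
    simp [iterAux, Letter.pt]
  | succ n ih =>
    have hB := mul_e0_sub_ez_pow_mem_B (sub_mem e1_mem_B ez_mem_B) n
    obtain ⟨hi0, he0⟩ := Lx_mul_ι hC .zero hB hx0 hx
    obtain ⟨hiz, hez⟩ := Lx_mul_ι hC .z hB hx0 hx
    have hcongr : Set.EqOn (fun t : ℝ =>
        ((t : ℂ) - 0)⁻¹ * Lx z t ((e1 - ez) * (e0 - ez) ^ n) -
          ((t : ℂ) - z)⁻¹ * Lx z t ((e1 - ez) * (e0 - ez) ^ n))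
        (fun t : ℝ => -((z - 1) * z / (z - t) ^ 2 / mob z t * Lam n (mob z t)))
        (Set.uIcc 0 x) := by
      intro t ht
      rw [Set.uIcc_of_le hx0] at ht
      simp only
      rw [ih ht.1 (ht.2.trans_lt hx) (fun s hs => hI s ⟨hs.1, hs.2.trans ht.2⟩)
        (fun s hs => hp s ⟨hs.1, hs.2.trans ht.2⟩)
        (fun s hs => hd s ⟨hs.1, hs.2.trans ht.2⟩)]
      -- At `t = 0` the quotients are default values, but both sides vanish because `Lam n 0 = 0`.
      rcases ht.1.eq_or_lt with rfl | ht0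
      · simp [h0, Lam]
      have h1 := Complex.ofReal_ne_zero.2 ht0.ne'
      have h2 := z_sub_ne_zero hz (hI t ht)
      have h3 : (z - 1) * z / (z - t) ^ 2 / mob z t = (t : ℂ)⁻¹ - ((t : ℂ) - z)⁻¹ := by
        rw [mob, ← neg_sub z]
        field_simp
        ring
      rw [h3, sub_zero]
      ring
    have hi' : IntervalIntegrable
        (fun t : ℝ => (z - 1) * z / (z - t) ^ 2 / mob z t * Lam n (mob z t)) volume 0 x := by
      have := ((hi0.sub hiz).congr (hcongr.mono Set.uIoc_subset_uIcc)).neg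
      simpa [Pi.neg_def] using this
    change Lx z x ((e1 - ez) * (e0 - ez) ^ n * e0) = _ at he0
    change Lx z x ((e1 - ez) * (e0 - ez) ^ n * ez) = _ at hez
    rw [pow_succ, ← mul_assoc, mul_sub, map_sub, he0, hez,
      ← intervalIntegral.integral_sub hi0 hiz]
    refine (intervalIntegral.integral_congr hcongr).trans ?_
    rw [intervalIntegral.integral_neg, Lam_succ_comp n hx0 h0 hp hd
        (fun t ht => div_ne_zero (mul_ne_zero hz1 (Complex.ofReal_ne_zero.2 ht.1.ne'))
          (z_sub_ne_zero hz (hI t ⟨ht.1.le, ht.2.le⟩))) hi']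

/-! ### The end point `1` -/

/-- The polylogarithm formulas are proved below the end point `1`; continuity of the primitive
carries them to it. -/
lemma tendsto_Lx_one {z : ℂ} (hz : z ∈ slit) {a : Letter} (ha : a ≠ .one) {p : A} (hp : p ∈ B) :
    Tendsto (fun x => Lx z x (p * FreeAlgebra.ι ℚ a)) (𝓝[<] 1)
      (𝓝 (L z (p * FreeAlgebra.ι ℚ a))) := by
  obtain ⟨C, hC⟩ := exists_letterBound hz
  obtain ⟨hi, he⟩ := L_mul_ι hz ha hp
  rw [he]
  have hc := (intervalIntegral.continuousOn_primitive_interval' hi Set.left_mem_uIcc) 1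
    Set.right_mem_uIcc
  rw [Set.uIcc_of_le zero_le_one] at hc
  have h1 : Tendsto (fun x => ∫ t in (0 : ℝ)..x, ((t : ℂ) - a.pt z)⁻¹ * Lx z t p) (𝓝[<] 1)
      (𝓝 (∫ t in (0 : ℝ)..1, ((t : ℂ) - a.pt z)⁻¹ * Lx z t p)) := by
    rw [← nhdsWithin_Ioo_eq_nhdsLT (zero_lt_one' ℝ)]
    exact hc.mono_left (nhdsWithin_mono _ Set.Ioo_subset_Icc_self)
  refine h1.congr' ?_
  filter_upwards [Ioo_mem_nhdsLT (zero_lt_one' ℝ)] with x hx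
  exact (Lx_mul_ι hC a hp hx.1.le hx.2).2.symm

/-- At `w = 1` the kernel has a pole at `v = 1`, but from index `1` on the zero of `ell` there keeps
the dominating function integrable. -/
lemma tendsto_Lam_succ (n : ℕ) {ι : Type*} {l : Filter ι} [l.IsCountablyGenerated] {q : ι → ℂ}
    (hq : Tendsto q l (𝓝 1)) {C : ℝ}
    (hb : ∀ᶠ i in l, ∀ v ∈ Set.Ioo (0 : ℝ) 1, ‖q i / (1 - v * q i)‖ ≤ C / (1 - v)) :
    Tendsto (fun i => Lam (n + 1) (q i)) l (𝓝 (Lam (n + 1) 1)) := by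
  refine tendsto_integral_filter_of_dominated_convergence
    (fun v => C * (ell (n + 1) v / (1 - v))) (Eventually.of_forall fun i => ?_) ?_
    ((integrableOn_ell_succ_div n).const_mul C) ?_
  · exact (Measurable.mul (by fun_prop) (measurable_ell_ofReal _)).aestronglyMeasurable
  · filter_upwards [hb] with i hi
    refine (ae_restrict_iff' measurableSet_Ioo).2 (Eventually.of_forall fun v hv => ?_)
    rw [norm_mul, norm_ell _ hv]
    exact (mul_le_mul_of_nonneg_right (hi v hv) (ell_nonneg _ hv.1.le hv.2.le)).trans_eq (by ring)
  · refine (ae_restrict_iff' measurableSet_Ioo).2 (Eventually.of_forall fun v hv => ?_)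
    refine Tendsto.mul_const _ (hq.div (tendsto_const_nhds.sub (hq.const_mul _)) ?_)
    rw [mul_one, ← Complex.ofReal_one, ← Complex.ofReal_sub, Complex.ofReal_ne_zero]
    linarith [hv.2]

lemma L_e1_mul_e0_pow_succ {z : ℂ} (hz : z ∈ slit) (n : ℕ) :
    L z (e1 * e0 ^ (n + 1)) = -Lam (n + 1) 1 := by
  obtain ⟨C, hC⟩ := exists_letterBound hz
  have h1 := tendsto_Lx_one hz (a := .zero) (by simp) (mul_e0_pow_mem_B e1_mem_B n)
  change Tendsto (fun x => Lx z x (e1 * e0 ^ n * e0)) _ (𝓝 (L z (e1 * e0 ^ n * e0))) at h1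
  rw [mul_assoc, ← pow_succ] at h1
  refine tendsto_nhds_unique h1 ?_
  have h2 : Tendsto (fun x : ℝ => (x : ℂ)) (𝓝[<] 1) (𝓝 1) :=
    (Complex.continuous_ofReal.tendsto' 1 1 (by simp)).mono_left nhdsWithin_le_nhds
  refine (tendsto_Lam_succ n h2 (C := 1) ?_).neg.congr' ?_
  · filter_upwards [Ioo_mem_nhdsLT (zero_lt_one' ℝ)] with x hx v hv
    have h3 : 0 < 1 - v * x := by nlinarith [hv.1, hv.2, hx.1, hx.2]
    have h4 : 0 < 1 - v := by linarith [hv.2]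
    rw [show (x : ℂ) / (1 - v * x) = ((x / (1 - v * x) : ℝ) : ℂ) by push_cast; rfl,
      Complex.norm_real, Real.norm_of_nonneg (div_nonneg hx.1.le h3.le)]
    apply div_le_div₀ zero_le_one hx.2.le h4
    nlinarith [hv.1, hx.2]
  · filter_upwards [Ioo_mem_nhdsLT (zero_lt_one' ℝ)] with x hx
    exact (Lx_e1_mul_e0_pow z hC (n + 1) hx.1.le hx.2).symm

lemma norm_mob_div_le {z : ℂ} (hz : z ∈ slit) : ∃ C, ∀ t ∈ Set.Icc (0 : ℝ) 1,
    ∀ v ∈ Set.Ioo (0 : ℝ) 1, ‖mob z t / (1 - v * mob z t)‖ ≤ C * t / (1 - v * t) := by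
  obtain ⟨C, hC, hb⟩ := exists_kernel_bound hz
  refine ⟨‖z - 1‖ * C, fun t ht v hv => ?_⟩
  have h1 : 0 < 1 - v * t := by nlinarith [hv.1, hv.2, ht.1, ht.2]
  have h2 := hb t ht v ⟨hv.1.le, hv.2.le⟩ (by linarith)
  rw [mob_div_one_sub hz ht, norm_div, norm_mul, Complex.norm_real, Real.norm_of_nonneg ht.1]
  calc ‖z - 1‖ * t / ‖z * (1 - v * t) - t * (1 - v)‖ ≤ ‖z - 1‖ * t / ((1 - v * t) / C) :=
        div_le_div_of_nonneg_left (mul_nonneg (norm_nonneg _) ht.1) (by positivity) h2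
    _ = _ := by field_simp

/-- Since `mob z` fixes `1`, this is the value already found for `e_1 e_0^(n+1)`. The coincidence is
the case `r = k` of the sum formula. -/
lemma L_e1_sub_ez_mul_pow_succ {z : ℂ} (hz : z ∈ slit) (n : ℕ) :
    L z ((e1 - ez) * (e0 - ez) ^ (n + 1)) = -Lam (n + 1) 1 := by
  have hB := mul_e0_sub_ez_pow_mem_B (sub_mem e1_mem_B ez_mem_B) n
  have h1 := (tendsto_Lx_one hz (a := .zero) (by simp) hB).sub
    (tendsto_Lx_one hz (a := .z) (by simp) hB)
  simp only [← map_sub, ← mul_sub] at h1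
  change Tendsto (fun x => Lx z x ((e1 - ez) * (e0 - ez) ^ n * (e0 - ez))) _
    (𝓝 (L z ((e1 - ez) * (e0 - ez) ^ n * (e0 - ez)))) at h1
  rw [mul_assoc, ← pow_succ] at h1
  refine tendsto_nhds_unique h1 ?_
  have h2 : Tendsto (fun x : ℝ => mob z x) (𝓝[<] 1) (𝓝 1) := by
    have := (hasDerivAt_mob hz (t := 1) (by simp)).continuousAt.tendsto
    rw [mob, Complex.ofReal_one, mul_one, div_self (z_sub_one_ne_zero hz)] at this
    exact this.mono_left nhdsWithin_le_nhds
  obtain ⟨C, hC⟩ := norm_mob_div_le hz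
  refine (tendsto_Lam_succ n h2 (C := C) ?_).neg.congr' ?_
  · filter_upwards [Ioo_mem_nhdsLT (zero_lt_one' ℝ)] with x hx v hv
    have h3 : 0 < 1 - v * x := by nlinarith [hv.1, hv.2, hx.1, hx.2]
    have h4 : 0 < 1 - v := by linarith [hv.2]
    have h5 := hC x ⟨hx.1.le, hx.2.le⟩ v hv
    have hC0 : 0 ≤ C := by
      have := (norm_nonneg _).trans h5
      by_contra hneg
      push Not at hneg
      have : C * x / (1 - v * x) < 0 := div_neg_of_neg_of_pos (mul_neg_of_neg_of_pos hneg hx.1) h3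
      linarith
    refine h5.trans (div_le_div₀ hC0 (mul_le_of_le_one_right hC0 hx.2.le) h4 ?_)
    nlinarith [hv.1, hx.2]
  · filter_upwards [Ioo_mem_nhdsLT (zero_lt_one' ℝ)] with x hx
    exact (Lx_e1_sub_ez_mul_pow hz (n + 1) hx.1.le hx.2).symm

/-! ### Interchanging the order of integration on a triangle -/

/-- For `s < t` one has `1/t ≤ s^(-1/4) t^(-3/4)`, which dominates the integrand by a product of
integrable functions of `s` and of `t`, as Fubini's theorem requires. The power `s^(-3/8)` collects
`1/8` from the kernel and `1/4` from this splitting. -/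
lemma integral_triangle {x : ℝ} (hx1 : x ≤ 1) {φ : ℝ → ℂ} {K : ℝ → ℝ → ℝ} {C : ℝ}
    (hφ : AEStronglyMeasurable φ (volume.restrict (Set.Ioo 0 x)))
    (hφi : IntegrableOn (fun s => ‖φ s‖ * s ^ (-(3 / 8) : ℝ)) (Set.Ioo 0 x))
    (hK : Measurable (Function.uncurry K))
    (hKb : ∀ s t, 0 < s → s < t → t < x → |K s t| ≤ C * s ^ (-(1 / 8) : ℝ) / t) :
    ∫ t in Set.Ioo 0 x, ∫ s in Set.Ioo 0 t, φ s * K s t =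
      ∫ s in Set.Ioo 0 x, φ s * ∫ t in Set.Ioo s x, (K s t : ℂ) := by
  set μ := volume.restrict (Set.Ioo (0 : ℝ) x) with hμ
  let G : ℝ → ℝ → ℂ := fun t s => Set.indicator {s | s < t} (fun s => φ s * K s t) s
  have hGm : AEStronglyMeasurable (Function.uncurry G) (μ.prod μ) := by
    have h1 : AEStronglyMeasurable (fun p : ℝ × ℝ => φ p.2 * (K p.2 p.1 : ℂ)) (μ.prod μ) :=
      (hφ.comp_quasiMeasurePreserving Measure.quasiMeasurePreserving_snd).mul
        (Complex.measurable_ofReal.comp (hK.comp measurable_swap)).aestronglyMeasurable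
    exact h1.indicator (s := {p : ℝ × ℝ | p.2 < p.1})
      (measurableSet_lt measurable_snd measurable_fst)
  have hint : Integrable (Function.uncurry G) (μ.prod μ) := by
    have h34 : IntegrableOn (fun t : ℝ => |C| * t ^ (-(3 / 4) : ℝ)) (Set.Ioo 0 x) :=
      ((integrableOn_rpow_Ioo (by norm_num)).mono_set (Set.Ioo_subset_Ioo_right hx1)).const_mul _
    have hdom := Integrable.mul_prod (μ := μ) (ν := μ) h34 hφi
    refine Integrable.mono' hdom hGm ?_
    rw [hμ, Measure.prod_restrict]
    refine (ae_restrict_iff' (measurableSet_Ioo.prod measurableSet_Ioo)).2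
      (Eventually.of_forall ?_)
    rintro ⟨t, s⟩ ⟨ht, hs⟩
    simp only [Function.uncurry, G, Set.indicator_apply]
    have ht0 : 0 < t := ht.1
    have hs0 : 0 < s := hs.1
    split_ifs with hst
    · have hst' : s < t := hst
      have h1 := hKb s t hs0 hst' ht.2
      rw [norm_mul, Complex.norm_real, Real.norm_eq_abs]
      have h2 : t ^ (-(1 / 4) : ℝ) ≤ s ^ (-(1 / 4) : ℝ) :=
        Real.rpow_le_rpow_of_nonpos hs0 hst'.le (by norm_num)
      have h3 : t⁻¹ = t ^ (-(1 / 4) : ℝ) * t ^ (-(3 / 4) : ℝ) := by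
        rw [← Real.rpow_add ht0, ← Real.rpow_neg_one]; norm_num
      have h4 : s ^ (-(3 / 8) : ℝ) = s ^ (-(1 / 4) : ℝ) * s ^ (-(1 / 8) : ℝ) := by
        rw [← Real.rpow_add hs0]; norm_num
      have hA := Real.rpow_nonneg hs0.le (-(1 / 8))
      have hB := Real.rpow_nonneg ht0.le (-(3 / 4))
      calc ‖φ s‖ * |K s t| ≤ ‖φ s‖ * (|C| * s ^ (-(1 / 8) : ℝ) * t⁻¹) := by
            refine mul_le_mul_of_nonneg_left (h1.trans ?_) (norm_nonneg _)
            rw [div_eq_mul_inv]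
            gcongr
            exact le_abs_self C
        _ ≤ ‖φ s‖ * (|C| * s ^ (-(1 / 8) : ℝ) * (s ^ (-(1 / 4) : ℝ) * t ^ (-(3 / 4) : ℝ))) := by
            rw [h3]
            gcongr
        _ = |C| * t ^ (-(3 / 4) : ℝ) * (‖φ s‖ * s ^ (-(3 / 8) : ℝ)) := by rw [h4]; ring
    · rw [norm_zero]
      positivity
  have hswap := integral_integral_swap hint
  have h1 : ∫ t, ∫ s, G t s ∂μ ∂μ = ∫ t in Set.Ioo 0 x, ∫ s in Set.Ioo 0 t, φ s * K s t := by
    refine setIntegral_congr_fun measurableSet_Ioo fun t ht => ?_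
    simp only [G, hμ]
    rw [setIntegral_indicator (show MeasurableSet {s : ℝ | s < t} from measurableSet_Iio)]
    congr 2
    ext s
    exact ⟨fun h => ⟨h.1.1, h.2⟩, fun h => ⟨⟨h.1, h.2.trans ht.2⟩, h.2⟩⟩
  have h2 : ∫ s, ∫ t, G t s ∂μ ∂μ =
      ∫ s in Set.Ioo 0 x, φ s * ∫ t in Set.Ioo s x, (K s t : ℂ) := by
    refine setIntegral_congr_fun measurableSet_Ioo fun s hs => ?_
    simp only [hμ]
    rw [← integral_const_mul]
    have : (fun t => G t s) = Set.indicator {t | s < t} (fun t => φ s * (K s t : ℂ)) := by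
      ext t
      simp [G, Set.indicator_apply]
    rw [this, setIntegral_indicator (show MeasurableSet {t : ℝ | s < t} from measurableSet_Ioi)]
    congr 2
    ext t
    exact ⟨fun h => ⟨h.2, h.1.2⟩, fun h => ⟨⟨hs.1.trans h.1, h.2⟩, h.1⟩⟩
  rw [← h1, ← h2, hswap]

lemma integral_triangle_of_hasDerivAt {x : ℝ} (hx1 : x ≤ 1) {φ : ℝ → ℂ} {K Q : ℝ → ℝ → ℝ} {C : ℝ}
    (hφ : AEStronglyMeasurable φ (volume.restrict (Set.Ioo 0 x)))
    (hφi : IntegrableOn (fun s => ‖φ s‖ * s ^ (-(3 / 8) : ℝ)) (Set.Ioo 0 x))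
    (hK : Measurable (Function.uncurry K))
    (hKb : ∀ s t, 0 < s → s < t → t < x → |K s t| ≤ C * s ^ (-(1 / 8) : ℝ) / t)
    (hKc : ∀ s ∈ Set.Ioo 0 x, ContinuousOn (K s) (Set.Icc s x))
    (hQ : ∀ s ∈ Set.Ioo 0 x, ∀ t ∈ Set.Icc s x, HasDerivAt (Q s) (K s t) t)
    (hQs : ∀ s ∈ Set.Ioo 0 x, Q s s = 0) :
    ∫ t in Set.Ioo 0 x, ∫ s in Set.Ioo 0 t, φ s * K s t =
      ∫ s in Set.Ioo 0 x, φ s * Q s x := by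
  rw [integral_triangle hx1 hφ hφi hK hKb]
  refine setIntegral_congr_fun measurableSet_Ioo fun s hs => ?_
  have h := intervalIntegral.integral_eq_sub_of_hasDerivAt_of_le hs.2.le
    (fun t ht => (hQ s hs t ht).continuousAt.continuousWithinAt)
    (fun t ht => hQ s hs t ⟨ht.1.le, ht.2.le⟩)
    (ContinuousOn.intervalIntegrable (by rw [Set.uIcc_of_le hs.2.le]; exact hKc s hs))
  rw [hQs s hs, sub_zero, intervalIntegral.integral_of_le hs.2.le,
    integral_Ioc_eq_integral_Ioo] at h
  rw [← h, integral_complex_ofReal]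

/-! ### Iterated integrals of the forms `dt/t` and `dt/(t-1)` -/

/-- The sum of all iterated integrals from `s` to `t` with `a` forms `dt/t` and `b` forms
`dt/(t-1)`. -/
noncomputable def logKer (a b : ℕ) (s t : ℝ) : ℝ :=
  (Real.log t - Real.log s) ^ a / a.factorial *
    ((Real.log (1 - t) - Real.log (1 - s)) ^ b / b.factorial)

lemma measurable_logKer (a b : ℕ) : Measurable (Function.uncurry (logKer a b)) := by
  unfold logKer Function.uncurry
  fun_prop

lemma abs_logKer_le (a b : ℕ) {s t x : ℝ} (hs : 0 < s) (hst : s < t) (htx : t ≤ x) (hx : x < 1) :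
    |logKer a b s t| ≤ 8 ^ a * ell b (1 - x) * s ^ (-(1 / 8) : ℝ) := by
  have ht0 : 0 < t := hs.trans hst
  have h1 : Real.log s ≤ Real.log t := Real.log_le_log hs hst.le
  have h2 : Real.log t ≤ 0 := Real.log_nonpos ht0.le (by linarith)
  have h3 : Real.log (1 - t) ≤ Real.log (1 - s) := Real.log_le_log (by linarith) (by linarith)
  have h4 : Real.log (1 - s) ≤ 0 := Real.log_nonpos (by linarith) (by linarith)
  have h5 : Real.log (1 - x) ≤ Real.log (1 - t) := Real.log_le_log (by linarith) (by linarith)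
  rw [logKer, abs_mul, abs_div, abs_div, abs_pow, abs_pow, Nat.abs_cast, Nat.abs_cast,
    abs_of_nonneg (sub_nonneg.2 h1), abs_of_nonpos (sub_nonpos.2 h3)]
  have h6 : (Real.log t - Real.log s) ^ a / a.factorial ≤ ell a s := by
    rw [ell]
    gcongr
    linarith
  have h7 : (-(Real.log (1 - t) - Real.log (1 - s))) ^ b / b.factorial ≤ ell b (1 - x) := by
    rw [ell]
    gcongr
    · linarith
    · linarith
  have h8 := ell_le a hs (by linarith : s ≤ 1)
  have h9 : 0 ≤ ell b (1 - x) := ell_nonneg b (by linarith) (by linarith)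
  calc _ ≤ ell a s * ell b (1 - x) := by
        refine mul_le_mul h6 h7 ?_ (ell_nonneg a hs.le (by linarith))
        exact div_nonneg (pow_nonneg (by linarith) _) (Nat.cast_nonneg _)
    _ ≤ (8 ^ a * s ^ (-(1 / 8) : ℝ)) * ell b (1 - x) := mul_le_mul_of_nonneg_right h8 h9
    _ = _ := by ring

/-- For `b = 0` the factor singular at `1` is absent, so the right end point `1` is allowed;
`integral_inv_mul_of_eq` depends on that. -/
lemma continuousOn_logKer (a b : ℕ) {s x : ℝ} (hs : 0 < s) (hb : b = 0 ∨ x < 1) :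
    ContinuousOn (logKer a b s) (Set.Icc s x) := by
  have h1 : ContinuousOn (fun t => Real.log t) (Set.Icc s x) :=
    Real.continuousOn_log.mono fun t ht => (hs.trans_le ht.1).ne'
  unfold logKer
  refine ContinuousOn.mul (((h1.sub continuousOn_const).pow a).div_const _) ?_
  rcases hb with rfl | hx
  · simpa using continuousOn_const
  · refine (((ContinuousOn.log (by fun_prop) fun t ht => ?_).sub
      continuousOn_const).pow b).div_const _
    have := ht.2
    intro h
    linarith

lemma hasDerivAt_pow_div_factorial (n : ℕ) (y : ℝ) :
    HasDerivAt (fun y : ℝ => y ^ (n + 1) / (n + 1).factorial) (y ^ n / n.factorial) y := by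
  refine ((hasDerivAt_pow (n + 1) y).div_const _).congr_deriv ?_
  have : (n.factorial : ℝ) ≠ 0 := Nat.cast_ne_zero.2 n.factorial_ne_zero
  have h2 : (n : ℝ) + 1 ≠ 0 := by positivity
  simp only [Nat.factorial_succ, Nat.cast_mul, Nat.cast_add, Nat.cast_one, Nat.add_sub_cancel]
  field_simp

lemma hasDerivAt_log_sub_pow (n : ℕ) (s : ℝ) {t : ℝ} (ht : 0 < t) :
    HasDerivAt (fun t => (Real.log t - Real.log s) ^ (n + 1) / (n + 1).factorial)
      ((Real.log t - Real.log s) ^ n / n.factorial / t) t :=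
  ((hasDerivAt_pow_div_factorial n _).comp t
    ((Real.hasDerivAt_log ht.ne').sub_const (Real.log s))).congr_deriv (by ring)

lemma hasDerivAt_log_one_sub_pow (n : ℕ) (s : ℝ) {t : ℝ} (ht : t < 1) :
    HasDerivAt (fun t => (Real.log (1 - t) - Real.log (1 - s)) ^ (n + 1) / (n + 1).factorial)
      ((Real.log (1 - t) - Real.log (1 - s)) ^ n / n.factorial / (t - 1)) t := by
  have h1 : 1 - t ≠ 0 := by linarith
  have h2 : HasDerivAt (fun t => Real.log (1 - t) - Real.log (1 - s)) (-1 / (1 - t)) t :=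
    (((hasDerivAt_id' t).const_sub 1).log h1).sub_const _
  refine ((hasDerivAt_pow_div_factorial n _).comp t h2).congr_deriv ?_
  rw [← neg_sub 1 t, div_neg, neg_div]
  ring

lemma hasDerivAt_logKer_succ_zero (a : ℕ) (s : ℝ) {t : ℝ} (ht : 0 < t) :
    HasDerivAt (logKer (a + 1) 0 s) (logKer a 0 s t / t) t := by
  unfold logKer
  simpa using hasDerivAt_log_sub_pow a s ht

lemma hasDerivAt_logKer_zero_succ (b : ℕ) (s : ℝ) {t : ℝ} (ht : t < 1) :
    HasDerivAt (logKer 0 (b + 1) s) (logKer 0 b s t / (t - 1)) t := by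
  unfold logKer
  simpa using hasDerivAt_log_one_sub_pow b s ht

/-- The product rule is the analytic counterpart of sorting words by their outermost letter, the
recursion that defines `J`. -/
lemma hasDerivAt_logKer_succ_succ (a b : ℕ) (s : ℝ) {t : ℝ} (ht0 : 0 < t) (ht : t < 1) :
    HasDerivAt (logKer (a + 1) (b + 1) s)
      (logKer a (b + 1) s t / t + logKer (a + 1) b s t / (t - 1)) t :=
  ((hasDerivAt_log_sub_pow a s ht0).mul (hasDerivAt_log_one_sub_pow b s ht)).congr_deriv (by
    unfold logKer; ring)

lemma logKer_self {a b : ℕ} (h : a ≠ 0 ∨ b ≠ 0) (s : ℝ) : logKer a b s s = 0 := by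
  rcases h with h | h <;> simp [logKer, h]

/-! ### Multiplication by powers of `e_0` -/

/-- After the exchange of integrals the inner one is `∫ log(t/s)^a/a! dt/t` from `s` to `x`, which
raises the power by one. -/
lemma integral_inv_mul_of_eq {x : ℝ} (hx1 : x ≤ 1) {φ F : ℝ → ℂ} (a : ℕ)
    (hφ : AEStronglyMeasurable φ (volume.restrict (Set.Ioo 0 x)))
    (hφi : IntegrableOn (fun s => ‖φ s‖ * s ^ (-(3 / 8) : ℝ)) (Set.Ioo 0 x))
    (hF : ∀ t ∈ Set.Ioo 0 x, F t = ∫ s in Set.Ioo 0 t, φ s * logKer a 0 s t) :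
    ∫ t in Set.Ioo 0 x, (t : ℂ)⁻¹ * F t = ∫ s in Set.Ioo 0 x, φ s * logKer (a + 1) 0 s x := by
  rw [← integral_triangle_of_hasDerivAt hx1 (K := fun s t => logKer a 0 s t / t) (C := 8 ^ a)
    hφ hφi ((measurable_logKer a 0).div measurable_snd) ?_ ?_ ?_ ?_]
  · refine setIntegral_congr_fun measurableSet_Ioo fun t ht => ?_
    rw [hF t ht, ← integral_const_mul]
    congr 1
    ext s
    push_cast
    ring
  · intro s t hs hst ht
    have ht0 : 0 < t := hs.trans hst
    rw [abs_div, abs_of_pos ht0]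
    have := abs_logKer_le a 0 hs hst le_rfl (ht.trans_le hx1)
    rw [ell_zero, mul_one] at this
    gcongr
  · intro s hs
    exact (continuousOn_logKer a 0 hs.1 (Or.inl rfl)).div continuousOn_id
      fun t ht => (hs.1.trans_le ht.1).ne'
  · intro s hs t ht
    exact hasDerivAt_logKer_succ_zero a s (hs.1.trans_le ht.1)
  · intro s _
    exact logKer_self (Or.inl a.succ_ne_zero) s

/-- Near `0` the integrand is of size `s^(-1/2-3/8) = s^(-7/8)`; on `[1/2,1)` the extra power is at
most `2` and `rho s / s` is integrable. The sum of the two bounds dominates everywhere. -/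
lemma integrableOn_rho_div_mul_rpow :
    IntegrableOn (fun s => rho s / s * s ^ (-(3 / 8) : ℝ)) (Set.Ioo 0 1) := by
  have hm : Measurable rho := by unfold rho; fun_prop
  refine Integrable.mono' (((integrableOn_rpow_Ioo (s := -(7 / 8)) (by norm_num)).const_mul 2).add
    ((integrableOn_rho_div.mono_set Set.Ioo_subset_Ioc_self).const_mul 2)) (by fun_prop) ?_
  refine (ae_restrict_iff' measurableSet_Ioo).2 (Eventually.of_forall fun s hs => ?_)
  have hs0 : 0 < s := hs.1
  have hr := rho_nonneg s
  rw [Real.norm_of_nonneg (by positivity), Pi.add_apply]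
  rcases le_total s (1 / 2) with h | h
  · have h1 : rho s ≤ 2 * s ^ (1 / 2 : ℝ) := by
      rw [rho, ← Real.sqrt_eq_rpow]
      rw [Real.sqrt_le_iff]
      refine ⟨by positivity, ?_⟩
      rw [mul_pow, Real.sq_sqrt hs0.le, div_le_iff₀ (by linarith)]
      nlinarith
    have h2 : s ^ (1 / 2 : ℝ) / s * s ^ (-(3 / 8) : ℝ) = s ^ (-(7 / 8) : ℝ) := by
      rw [div_eq_mul_inv, ← Real.rpow_neg_one, ← Real.rpow_add hs0, ← Real.rpow_add hs0]
      norm_num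
    have h3 : 0 ≤ 2 * (rho s / s) := by positivity
    calc rho s / s * s ^ (-(3 / 8) : ℝ) ≤ 2 * s ^ (1 / 2 : ℝ) / s * s ^ (-(3 / 8) : ℝ) := by gcongr
      _ = 2 * s ^ (-(7 / 8) : ℝ) := by rw [← h2]; ring
      _ ≤ _ := by linarith
  · have h1 : s ^ (-(3 / 8) : ℝ) ≤ 2 := by
      calc s ^ (-(3 / 8) : ℝ) ≤ s ^ (-1 : ℝ) :=
            Real.rpow_le_rpow_of_exponent_ge hs0 hs.2.le (by norm_num)
        _ = s⁻¹ := Real.rpow_neg_one s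
        _ ≤ (1 / 2)⁻¹ := inv_anti₀ (by norm_num) h
        _ = 2 := by norm_num
    have h2 : 0 ≤ 2 * s ^ (-(7 / 8) : ℝ) := by positivity
    have h3 : 0 ≤ rho s / s := by positivity
    nlinarith

lemma aestronglyMeasurable_inv_mul_Lx {z : ℂ} {C : ℝ} (h : LetterBound z C) {p : A} (hp : p ∈ B) :
    AEStronglyMeasurable (fun s : ℝ => (s : ℂ)⁻¹ * Lx z s p) (volume.restrict (Set.Ioo 0 1)) :=
  (Measurable.aestronglyMeasurable (by fun_prop)).mul
    (((continuousOn_Lx h hp).mono Set.Ioo_subset_Ico_self).aestronglyMeasurable measurableSet_Ioo)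

lemma exists_norm_inv_mul_Lx_le {z : ℂ} {C : ℝ} (h : LetterBound z C) {p : A} (hp : p ∈ B) :
    ∃ D, 0 ≤ D ∧ ∀ s ∈ Set.Ioo (0 : ℝ) 1, ‖(s : ℂ)⁻¹ * Lx z s p‖ ≤ D * (rho s / s) := by
  obtain ⟨D, hD, hb⟩ := exists_norm_Lx_le h hp
  refine ⟨D, hD, fun s hs => ?_⟩
  have hs0 : 0 < s := hs.1
  rw [norm_mul, norm_inv, Complex.norm_real, Real.norm_of_nonneg hs0.le]
  calc s⁻¹ * ‖Lx z s p‖ ≤ s⁻¹ * (D * rho s) := by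
        gcongr
        exact hb s hs0.le hs.2
    _ = _ := by ring

lemma integrableOn_norm_inv_mul_Lx {z : ℂ} {C : ℝ} (h : LetterBound z C) {p : A} (hp : p ∈ B) :
    IntegrableOn (fun s : ℝ => ‖(s : ℂ)⁻¹ * Lx z s p‖ * s ^ (-(3 / 8) : ℝ)) (Set.Ioo 0 1) := by
  obtain ⟨D, hD, hb⟩ := exists_norm_inv_mul_Lx_le h hp
  refine Integrable.mono' (integrableOn_rho_div_mul_rpow.const_mul D)
    ((aestronglyMeasurable_inv_mul_Lx h hp).norm.mul
      (Measurable.aestronglyMeasurable (by fun_prop))) ?_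
  refine (ae_restrict_iff' measurableSet_Ioo).2 (Eventually.of_forall fun s hs => ?_)
  have hs0 : 0 < s := hs.1
  rw [Real.norm_of_nonneg (by positivity), ← mul_assoc]
  exact mul_le_mul_of_nonneg_right (hb s hs) (by positivity)

lemma Lx_mul_e0_pow_succ {z : ℂ} {C : ℝ} (h : LetterBound z C) {p : A} (hp : p ∈ B) (a : ℕ)
    {x : ℝ} (hx0 : 0 < x) (hx : x < 1) :
    Lx z x (p * e0 ^ (a + 1)) =
      ∫ s in Set.Ioo 0 x, ((s : ℂ)⁻¹ * Lx z s p) * logKer a 0 s x := by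
  induction a generalizing x with
  | zero =>
    rw [zero_add, pow_one, (Lx_mul_e0 h hp hx0.le hx).2, intervalIntegral.integral_of_le hx0.le,
      integral_Ioc_eq_integral_Ioo]
    simp [logKer]
  | succ a ih =>
    rw [pow_succ, ← mul_assoc, (Lx_mul_e0 h (mul_e0_pow_mem_B hp _) hx0.le hx).2,
      intervalIntegral.integral_of_le hx0.le, integral_Ioc_eq_integral_Ioo]
    have hsub : Set.Ioo 0 x ⊆ Set.Ioo (0 : ℝ) 1 := Set.Ioo_subset_Ioo_right hx.le
    exact integral_inv_mul_of_eq hx.le a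
      ((aestronglyMeasurable_inv_mul_Lx h hp).mono_measure (Measure.restrict_mono hsub le_rfl))
      ((integrableOn_norm_inv_mul_Lx h hp).mono_set hsub)
      fun t ht => ih ht.1 (ht.2.trans hx)

lemma L_mul_e0_pow_succ {z : ℂ} (hz : z ∈ slit) {p : A} (hp : p ∈ B) (a : ℕ) :
    L z (p * e0 ^ (a + 1)) = ∫ s in Set.Ioo (0 : ℝ) 1, ((s : ℂ)⁻¹ * Lx z s p) * ell a s := by
  obtain ⟨C, h⟩ := exists_letterBound hz
  -- The term `log (1 - 1)` occurs only to the power `0`, so its default value plays no role.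
  have hell : ∀ (a : ℕ) (s : ℝ), logKer a 0 s 1 = ell a s := by
    intro a s
    simp [logKer, ell]
  cases a with
  | zero =>
    rw [zero_add, pow_one, (L_mul_e0 hz hp).2, intervalIntegral.integral_of_le zero_le_one,
      integral_Ioc_eq_integral_Ioo]
    simp [ell_zero]
  | succ a =>
    rw [pow_succ, ← mul_assoc, (L_mul_e0 hz (mul_e0_pow_mem_B hp _)).2,
      intervalIntegral.integral_of_le zero_le_one, integral_Ioc_eq_integral_Ioo]
    simp only [← hell]
    exact integral_inv_mul_of_eq le_rfl a (aestronglyMeasurable_inv_mul_Lx h hp)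
      (integrableOn_norm_inv_mul_Lx h hp) fun t ht => Lx_mul_e0_pow_succ h hp a ht.1 ht.2

/-! ### The sum of all words with given numbers of letters -/

/-- The sum of all words `e_z u`, where `u` has `a` letters `e_0` and `b` letters `e_1`. -/
noncomputable def J : ℕ → ℕ → A
  | 0, 0 => ez
  | a + 1, 0 => J a 0 * e0
  | 0, b + 1 => J 0 b * e1
  | a + 1, b + 1 => J a (b + 1) * e0 + J (a + 1) b * e1

lemma J_mem_B (a b : ℕ) : J a b ∈ B := by
  induction a, b using J.induct with
  | case1 => rw [J]; exact ez_mem_B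
  | case2 a ih => rw [J]; exact mul_e0_mem_B ih
  | case3 b ih => rw [J]; exact mul_e1_mem_B ih
  | case4 a b ih1 ih2 => rw [J]; exact add_mem (mul_e0_mem_B ih1) (mul_e1_mem_B ih2)

/-- One step in the computation of `J`. -/
lemma Lx_mul_e0_add_mul_e1 {z : ℂ} (hz : z ∈ slit) {p₀ p₁ : A} (hp₀ : p₀ ∈ B) (hp₁ : p₁ ∈ B)
    {P₀ P₁ Q : ℝ → ℝ → ℝ} {x C₀ C₁ : ℝ} (hx0 : 0 < x) (hx : x < 1)
    (h₀ : ∀ t ∈ Set.Ioo 0 x, Lx z t p₀ = ∫ s in Set.Ioo 0 t, ((s : ℂ) - z)⁻¹ * P₀ s t)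
    (h₁ : ∀ t ∈ Set.Ioo 0 x, Lx z t p₁ = ∫ s in Set.Ioo 0 t, ((s : ℂ) - z)⁻¹ * P₁ s t)
    (hm₀ : Measurable (Function.uncurry P₀)) (hm₁ : Measurable (Function.uncurry P₁))
    (hb₀ : ∀ s t, 0 < s → s < t → t < x → |P₀ s t| ≤ C₀ * s ^ (-(1 / 8) : ℝ))
    (hb₁ : ∀ s t, 0 < s → s < t → t < x → |P₁ s t| ≤ C₁ * s ^ (-(1 / 8) : ℝ))
    (hc₀ : ∀ s ∈ Set.Ioo 0 x, ContinuousOn (P₀ s) (Set.Icc s x))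
    (hc₁ : ∀ s ∈ Set.Ioo 0 x, ContinuousOn (P₁ s) (Set.Icc s x))
    (hQ : ∀ s ∈ Set.Ioo 0 x, ∀ t ∈ Set.Icc s x,
      HasDerivAt (Q s) (P₀ s t / t + P₁ s t / (t - 1)) t)
    (hQs : ∀ s ∈ Set.Ioo 0 x, Q s s = 0) :
    Lx z x (p₀ * e0 + p₁ * e1) = ∫ s in Set.Ioo 0 x, ((s : ℂ) - z)⁻¹ * Q s x := by
  obtain ⟨ε, hε, C, hC, -, hb⟩ := exists_bound_slit hz
  replace hb := hb z (Metric.mem_ball_self hε)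
  have hLB := LetterBound.of_le hC hb
  have hφm : Measurable fun s : ℝ => ((s : ℂ) - z)⁻¹ := by fun_prop
  have hφi : IntegrableOn (fun s : ℝ => ‖((s : ℂ) - z)⁻¹‖ * s ^ (-(3 / 8) : ℝ)) (Set.Ioo 0 x) := by
    refine Integrable.mono' (((integrableOn_rpow_Ioo (s := -(3 / 8)) (by norm_num)).mono_set
      (Set.Ioo_subset_Ioo_right hx.le)).const_mul C) (by fun_prop) ?_
    refine (ae_restrict_iff' measurableSet_Ioo).2 (Eventually.of_forall fun s hs => ?_)
    have hs0 : 0 < s := hs.1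
    rw [Real.norm_of_nonneg (by positivity)]
    exact mul_le_mul_of_nonneg_right (hb s ⟨hs0.le, (hs.2.trans hx).le⟩) (by positivity)
  have hint : ∀ (P : ℝ → ℝ → ℝ) (D : ℝ), Measurable (Function.uncurry P) →
      (∀ s t, 0 < s → s < t → t < x → |P s t| ≤ D * s ^ (-(1 / 8) : ℝ)) → ∀ t ∈ Set.Ioo 0 x,
      IntegrableOn (fun s : ℝ => ((s : ℂ) - z)⁻¹ * P s t) (Set.Ioo 0 t) := by
    intro P D hP hD t ht
    have hPt : Measurable fun s => P s t := hP.comp (measurable_id.prodMk measurable_const)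
    refine Integrable.mono' (((integrableOn_rpow_Ioo (s := -(1 / 8)) (by norm_num)).mono_set
      (Set.Ioo_subset_Ioo_right (ht.2.trans hx).le)).const_mul (C * D))
      (hφm.mul (Complex.measurable_ofReal.comp hPt)).aestronglyMeasurable ?_
    refine (ae_restrict_iff' measurableSet_Ioo).2 (Eventually.of_forall fun s hs => ?_)
    rw [norm_mul, Complex.norm_real, Real.norm_eq_abs, mul_assoc]
    exact mul_le_mul (hb s ⟨hs.1.le, (hs.2.trans (ht.2.trans hx)).le⟩) (hD s t hs.1 hs.2 ht.2)
      (abs_nonneg _) (by linarith)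
  obtain ⟨hi0, he0⟩ := Lx_mul_ι hLB .zero hp₀ hx0.le hx
  obtain ⟨hi1, he1⟩ := Lx_mul_ι hLB .one hp₁ hx0.le hx
  change Lx z x (p₀ * e0) = _ at he0
  change Lx z x (p₁ * e1) = _ at he1
  rw [map_add, he0, he1, ← intervalIntegral.integral_add hi0 hi1,
    intervalIntegral.integral_of_le hx0.le, integral_Ioc_eq_integral_Ioo,
    ← integral_triangle_of_hasDerivAt hx.le (K := fun s t => P₀ s t / t + P₁ s t / (t - 1))
      (C := C₀ + C₁ / (1 - x)) hφm.aestronglyMeasurable hφi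
      ((hm₀.div measurable_snd).add (hm₁.div (measurable_snd.sub_const 1))) ?_ ?_ hQ hQs]
  · refine setIntegral_congr_fun measurableSet_Ioo fun t ht => ?_
    simp only [Letter.pt]
    rw [h₀ t ht, h₁ t ht, ← integral_const_mul, ← integral_const_mul, ← integral_add
      ((hint P₀ C₀ hm₀ hb₀ t ht).const_mul _) ((hint P₁ C₁ hm₁ hb₁ t ht).const_mul _)]
    congr 1
    ext s
    push_cast
    ring
  · intro s t hs hst ht
    have ht0 : 0 < t := hs.trans hst
    have h1 := hb₀ s t hs hst ht
    have h2 := hb₁ s t hs hst ht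
    have h3 : 0 ≤ C₁ * s ^ (-(1 / 8) : ℝ) := (abs_nonneg _).trans h2
    have h4 : 0 < 1 - x := by linarith
    refine (abs_add_le _ _).trans ?_
    rw [abs_div, abs_div, abs_of_pos ht0, abs_of_neg (by linarith : t - 1 < 0), neg_sub]
    -- From `t < x < 1` follows `(1-x) t ≤ 1 - t`, which brings the second term to the common shape
    -- `const / t`.
    calc |P₀ s t| / t + |P₁ s t| / (1 - t)
        ≤ C₀ * s ^ (-(1 / 8) : ℝ) / t + C₁ * s ^ (-(1 / 8) : ℝ) / ((1 - x) * t) := by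
          refine add_le_add (by gcongr) (div_le_div₀ h3 h2 (by positivity) ?_)
          nlinarith
      _ = _ := by field_simp
  · intro s hs
    refine ((hc₀ s hs).div continuousOn_id fun t ht => (hs.1.trans_le ht.1).ne').add
      ((hc₁ s hs).div (continuousOn_id.sub continuousOn_const) fun t ht => ?_)
    have := ht.2
    intro h
    linarith

/-- With the variable `s` of `e_z` fixed, the remaining letters run through all shuffles of `e_0^a`
and `e_1^b`, and a sum over shuffles is the product of the two integrals from `s` to `x`. The
induction checks this by differentiating in `x`. -/
lemma Lx_J {z : ℂ} (hz : z ∈ slit) (a b : ℕ) {x : ℝ} (hx0 : 0 < x) (hx : x < 1) :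
    Lx z x (J a b) = ∫ s in Set.Ioo 0 x, ((s : ℂ) - z)⁻¹ * logKer a b s x := by
  have hbd : ∀ (a b : ℕ) {x : ℝ}, x < 1 → ∀ s t, 0 < s → s < t → t < x →
      |logKer a b s t| ≤ 8 ^ a * ell b (1 - x) * s ^ (-(1 / 8) : ℝ) :=
    fun a b x hx s t hs hst ht => abs_logKer_le a b hs hst ht.le hx
  have hz0 : ∀ t : ℝ, Lx z t 0 = ∫ s in Set.Ioo 0 t, ((s : ℂ) - z)⁻¹ * (0 : ℝ) := by simp
  induction a, b using J.induct generalizing x with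
  | case1 =>
    rw [J, ez, ← word_singleton, Lx_word, List.reverse_singleton, iterAux,
      intervalIntegral.integral_of_le hx0.le, integral_Ioc_eq_integral_Ioo]
    simp [logKer, iterAux, Letter.pt]
  | case2 a ih =>
    -- A zero term is inserted so that the border cases of the recursion fit the same step with a
    -- vanishing kernel.
    rw [J, ← add_zero (J a 0 * e0), ← zero_mul e1]
    refine Lx_mul_e0_add_mul_e1 hz (J_mem_B _ _) (zero_mem _) (P₀ := logKer a 0)
      (P₁ := fun _ _ => 0) (C₁ := 0) hx0 hx (fun t ht => ih ht.1 (ht.2.trans hx)) (fun t _ => hz0 t)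
      (measurable_logKer _ _) measurable_const (hbd _ _ hx) (by simp)
      (fun s hs => continuousOn_logKer _ _ hs.1 (Or.inr hx)) (fun _ _ => continuousOn_const)
      (fun s hs t ht => ?_) (fun s _ => logKer_self (by simp) s)
    simpa using hasDerivAt_logKer_succ_zero a s (hs.1.trans_le ht.1)
  | case3 b ih =>
    rw [J, ← zero_add (J 0 b * e1), ← zero_mul e0]
    refine Lx_mul_e0_add_mul_e1 hz (zero_mem _) (J_mem_B _ _) (P₁ := logKer 0 b)
      (P₀ := fun _ _ => 0) (C₀ := 0) hx0 hx (fun t _ => hz0 t) (fun t ht => ih ht.1 (ht.2.trans hx))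
      measurable_const (measurable_logKer _ _) (by simp) (hbd _ _ hx)
      (fun _ _ => continuousOn_const) (fun s hs => continuousOn_logKer _ _ hs.1 (Or.inr hx))
      (fun s hs t ht => ?_) (fun s _ => logKer_self (by simp) s)
    simpa using hasDerivAt_logKer_zero_succ b s (ht.2.trans_lt hx)
  | case4 a b ih1 ih2 =>
    rw [J]
    exact Lx_mul_e0_add_mul_e1 hz (J_mem_B _ _) (J_mem_B _ _) hx0 hx
      (fun t ht => ih1 ht.1 (ht.2.trans hx)) (fun t ht => ih2 ht.1 (ht.2.trans hx))
      (measurable_logKer _ _) (measurable_logKer _ _) (hbd _ _ hx) (hbd _ _ hx)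
      (fun s hs => continuousOn_logKer _ _ hs.1 (Or.inr hx))
      (fun s hs => continuousOn_logKer _ _ hs.1 (Or.inr hx))
      (fun s hs t ht => hasDerivAt_logKer_succ_succ a b s (hs.1.trans_le ht.1) (ht.2.trans_lt hx))
      (fun s _ => logKer_self (by simp) s)

/-! ### The integrand of the sum formula -/

/-- The kernel common to both sides of the sum formula. -/
noncomputable def sumKernel (z : ℂ) (T v : ℝ) : ℂ :=
  1 / (1 - v * T) - (z - 1) / (z * (1 - v * T) - T * (1 - v))

lemma sumKernel_eq {z : ℂ} (hz : z ∈ slit) {T v : ℝ} (hT : T ∈ Set.Ioo (0 : ℝ) 1)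
    (hv : v ∈ Set.Ioo (0 : ℝ) 1) :
    sumKernel z T v = (1 - T) / ((1 - v * T) * (z * (1 - v * T) - T * (1 - v))) := by
  have hvT : v * T < 1 := by nlinarith [hv.1, hv.2, hT.1, hT.2]
  have h1 := kernel_ne_zero hz ⟨hT.1.le, hT.2.le⟩ ⟨hv.1.le, hv.2.le⟩ hvT
  have h2 : (1 - (v : ℂ) * T) ≠ 0 := by
    have : (1 - v * T) ≠ 0 := by linarith
    exact_mod_cast this
  rw [sumKernel, div_sub_div _ _ h2 h1]
  congr 1
  ring

lemma inv_mul_Lam_sub {z : ℂ} (hz : z ∈ slit) (n : ℕ) {T : ℝ} (hT : T ∈ Set.Ioo (0 : ℝ) 1) :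
    (T : ℂ)⁻¹ * (Lam n T - Lam n (mob z T)) =
      ∫ v in Set.Ioo (0 : ℝ) 1, sumKernel z T v * ell n v := by
  have hT' : T ∈ Set.Ico (0 : ℝ) 1 := ⟨hT.1.le, hT.2⟩
  have hT0 := Complex.ofReal_ne_zero.2 hT.1.ne'
  rw [Lam, Lam, ← integral_sub ((noPole_ofReal hT').integrableOn n)
    ((noPole_mob hz hT').integrableOn n), ← integral_const_mul]
  congr 1
  ext v
  rw [mob_div_one_sub hz ⟨hT.1.le, hT.2.le⟩, sumKernel]
  rw [mul_comm (z - 1) (T : ℂ), mul_div_assoc, div_eq_mul_one_div (T : ℂ) (1 - v * T)]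
  field_simp

/-! ### The substitution `t = (1 - v) / (1 - v T)` -/

/-- The involution `v ↦ (1 - v) / (1 - v T)` of the unit interval. -/
noncomputable def flip (T v : ℝ) : ℝ := (1 - v) / (1 - v * T)

lemma one_sub_mul_pos {T v : ℝ} (hT : T ∈ Set.Ioo (0 : ℝ) 1) (hv : v ∈ Set.Ioo (0 : ℝ) 1) :
    0 < 1 - v * T := by nlinarith [hv.1, hv.2, hT.1, hT.2]

lemma flip_mem {T v : ℝ} (hT : T ∈ Set.Ioo (0 : ℝ) 1) (hv : v ∈ Set.Ioo (0 : ℝ) 1) :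
    flip T v ∈ Set.Ioo (0 : ℝ) 1 := by
  have h := one_sub_mul_pos hT hv
  refine ⟨div_pos (by linarith [hv.2]) h, ?_⟩
  rw [flip, div_lt_one h]
  nlinarith [hv.1, hv.2, hT.1, hT.2]

/-- Together with `one_sub_mul_flip` this gives `(1-t)/(1-Tt) = v` for `t = flip T v`, the purpose
of the substitution: the difference of logarithms becomes `log v`. -/
lemma one_sub_flip {T v : ℝ} (hT : T ∈ Set.Ioo (0 : ℝ) 1) (hv : v ∈ Set.Ioo (0 : ℝ) 1) :
    1 - flip T v = v * ((1 - T) / (1 - v * T)) := by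
  have h := (one_sub_mul_pos hT hv).ne'
  rw [flip]
  field_simp
  ring

lemma one_sub_mul_flip {T v : ℝ} (hT : T ∈ Set.Ioo (0 : ℝ) 1) (hv : v ∈ Set.Ioo (0 : ℝ) 1) :
    1 - T * flip T v = (1 - T) / (1 - v * T) := by
  have h := (one_sub_mul_pos hT hv).ne'
  have e : (1 - v) / (1 - v * T) * (1 - v * T) = 1 - v := div_mul_cancel₀ _ h
  rw [flip, eq_div_iff h]
  linear_combination -T * e

lemma flip_flip {T v : ℝ} (hT : T ∈ Set.Ioo (0 : ℝ) 1) (hv : v ∈ Set.Ioo (0 : ℝ) 1) :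
    flip T (flip T v) = v := by
  have h := one_sub_mul_pos hT hv
  have h2 : 0 < 1 - T := by linarith [hT.2]
  rw [flip, one_sub_flip hT hv, mul_comm (flip T v) T, one_sub_mul_flip hT hv,
    mul_div_cancel_right₀ _ (div_pos h2 h).ne']

lemma flip_image {T : ℝ} (hT : T ∈ Set.Ioo (0 : ℝ) 1) :
    flip T '' Set.Ioo 0 1 = Set.Ioo 0 1 := by
  ext t
  constructor
  · rintro ⟨v, hv, rfl⟩
    exact flip_mem hT hv
  · intro ht
    exact ⟨flip T t, flip_mem hT ht, flip_flip hT ht⟩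

lemma hasDerivAt_flip {T v : ℝ} (hT : T ∈ Set.Ioo (0 : ℝ) 1) (hv : v ∈ Set.Ioo (0 : ℝ) 1) :
    HasDerivAt (flip T) (-((1 - T) / (1 - v * T) ^ 2)) v := by
  have h := (one_sub_mul_pos hT hv).ne'
  refine (((hasDerivAt_id' v).const_sub 1).div (((hasDerivAt_id' v).mul_const T).const_sub 1)
    h).congr_deriv ?_
  rw [← neg_div]
  congr 1
  ring

lemma integral_flip {T : ℝ} (hT : T ∈ Set.Ioo (0 : ℝ) 1) (g : ℝ → ℂ) :
    ∫ t in Set.Ioo (0 : ℝ) 1, g t =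
      ∫ v in Set.Ioo (0 : ℝ) 1, ((1 - T) / (1 - v * T) ^ 2 : ℝ) * g (flip T v) := by
  have h := integral_image_eq_integral_abs_deriv_smul measurableSet_Ioo
    (fun v hv => (hasDerivAt_flip hT hv).hasDerivWithinAt (s := Set.Ioo 0 1))
    (fun v hv w hw hvw => by rw [← flip_flip hT hv, hvw, flip_flip hT hw]) g
  rw [flip_image hT] at h
  rw [h]
  refine setIntegral_congr_fun measurableSet_Ioo fun v hv => ?_
  have h2 : 0 < 1 - T := by linarith [hT.2]
  have h3 := one_sub_mul_pos hT hv
  simp only [abs_neg]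
  rw [abs_of_pos (by positivity), Complex.real_smul]

/-- Substitute `t = flip T v`. Of the sign, `(-1)^b` comes from `(log v)^b` against `(-log v)^b`,
and one more `-1` from `Tt - z = -(z(1-vT) - T(1-v))/(1-vT)`. -/
lemma integral_log_ratio {z : ℂ} (hz : z ∈ slit) (b : ℕ) {T : ℝ} (hT : T ∈ Set.Ioo (0 : ℝ) 1) :
    ∫ t in Set.Ioo (0 : ℝ) 1, ((T * t : ℝ) - z : ℂ)⁻¹ *
        ((Real.log (1 - t) - Real.log (1 - T * t)) ^ b / b.factorial : ℝ) =
      (-1) ^ (b + 1) * ∫ v in Set.Ioo (0 : ℝ) 1, sumKernel z T v * ell b v := by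
  rw [integral_flip hT, ← integral_const_mul]
  refine setIntegral_congr_fun measurableSet_Ioo fun v hv => ?_
  have h2 : 0 < 1 - T := by linarith [hT.2]
  have h3 := one_sub_mul_pos hT hv
  have hq : (1 - T) / (1 - v * T) ≠ 0 := (div_pos h2 h3).ne'
  have h1 := kernel_ne_zero hz ⟨hT.1.le, hT.2.le⟩ ⟨hv.1.le, hv.2.le⟩ (by linarith)
  have h3' : (1 - (v : ℂ) * T) ≠ 0 := by exact_mod_cast h3.ne'
  have h4 : ((T * flip T v : ℝ) - z : ℂ) =
      -((z * (1 - v * T) - T * (1 - v)) / (1 - v * T)) := by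
    have e : (1 - v : ℂ) / (1 - v * T) * (1 - v * T) = 1 - v := div_mul_cancel₀ _ h3'
    rw [flip]
    push_cast
    rw [← neg_div, eq_div_iff h3']
    linear_combination T * e
  rw [sumKernel_eq hz hT hv, one_sub_flip hT hv, one_sub_mul_flip hT hv,
    Real.log_mul hv.1.ne' hq, add_sub_cancel_right, h4, ell, neg_pow (Real.log v)]
  push_cast
  have hs : ((-1 : ℂ)) ^ b * (-1) ^ b = 1 := by rw [← mul_pow]; simp
  -- To be read with `d = 1 - vT`, `N = z(1-vT) - T(1-v)`, `t = 1 - T`, `l = (log v)^b` and `e =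
  -- (-1)^b`.
  have key : ∀ d N t l e : ℂ, d ≠ 0 → e * e = 1 →
      t / d ^ 2 * (-(d / N) * (l / b.factorial)) =
        e * -1 * (t / (d * N) * (e * l / b.factorial)) := by
    intro d N t l e hd he
    rw [show e * -1 * (t / (d * N) * (e * l / b.factorial)) =
      e * e * -(t / (d * N) * (l / b.factorial)) by ring, he]
    field_simp
  rw [inv_neg, inv_div, pow_succ]
  exact key _ _ _ _ _ h3' hs

/-! ### The sum formula for `r < k` in terms of `J` -/

lemma integrableOn_inv_mul_Lx_mul_ell {z : ℂ} {C : ℝ} (h : LetterBound z C) {p : A} (hp : p ∈ B)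
    (a : ℕ) : IntegrableOn (fun s : ℝ => ((s : ℂ)⁻¹ * Lx z s p) * ell a s) (Set.Ioo 0 1) := by
  refine Integrable.mono' ((integrableOn_norm_inv_mul_Lx h hp).const_mul (8 ^ a))
    ((aestronglyMeasurable_inv_mul_Lx h hp).mul (measurable_ell_ofReal a).aestronglyMeasurable) ?_
  refine (ae_restrict_iff' measurableSet_Ioo).2 (Eventually.of_forall fun s hs => ?_)
  rw [norm_mul, norm_ell a hs]
  have h1 : s ^ (-(1 / 8) : ℝ) ≤ s ^ (-(3 / 8) : ℝ) :=
    Real.rpow_le_rpow_of_exponent_ge hs.1 hs.2.le (by norm_num)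
  calc _ ≤ ‖(s : ℂ)⁻¹ * Lx z s p‖ * (8 ^ a * s ^ (-(3 / 8) : ℝ)) := by
        gcongr
        exact (ell_le a hs.1 hs.2.le).trans (by gcongr)
    _ = _ := by ring

lemma rhs_eq {z : ℂ} (hz : z ∈ slit) (a b : ℕ) :
    -L z (e1 * e0 ^ b * e0 ^ (a + 1)) + L z ((e1 - ez) * (e0 - ez) ^ b * e0 ^ (a + 1)) =
      ∫ T in Set.Ioo (0 : ℝ) 1,
        ell a T * ∫ v in Set.Ioo (0 : ℝ) 1, sumKernel z T v * ell b v := by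
  obtain ⟨C, hC⟩ := exists_letterBound hz
  have hB1 := mul_e0_pow_mem_B e1_mem_B b
  have hB2 := mul_e0_sub_ez_pow_mem_B (sub_mem e1_mem_B ez_mem_B) b
  rw [L_mul_e0_pow_succ hz hB1, L_mul_e0_pow_succ hz hB2, neg_add_eq_sub,
    ← integral_sub (integrableOn_inv_mul_Lx_mul_ell hC hB2 a)
      (integrableOn_inv_mul_Lx_mul_ell hC hB1 a)]
  refine setIntegral_congr_fun measurableSet_Ioo fun T hT => ?_
  rw [← inv_mul_Lam_sub hz b hT, Lx_e1_mul_e0_pow z hC b hT.1.le hT.2,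
    Lx_e1_sub_ez_mul_pow hz b hT.1.le hT.2]
  ring

lemma integrableOn_ell_one_sub (b : ℕ) : IntegrableOn (fun t => ell b (1 - t)) (Set.Ioo 0 1) := by
  rw [← intervalIntegrable_iff_integrableOn_Ioo_of_le zero_le_one]
  have h := ((intervalIntegrable_iff_integrableOn_Ioo_of_le zero_le_one).2
    (integrableOn_ell b)).comp_sub_left 1
  simpa using h.symm

/-- The scaling `s = T t` of the innermost variable: its Jacobian cancels the outer `1/t`, and `log
t - log s` becomes `-log T`, independent of `t`. -/
lemma L_J_mul_e0_eq {z : ℂ} (hz : z ∈ slit) (a b : ℕ) :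
    L z (J a b * e0) = ∫ t in Set.Ioo (0 : ℝ) 1, ∫ T in Set.Ioo (0 : ℝ) 1,
      ell a T * (((T * t : ℝ) - z : ℂ)⁻¹ *
        ((Real.log (1 - t) - Real.log (1 - T * t)) ^ b / b.factorial : ℝ)) := by
  rw [(L_mul_e0 hz (J_mem_B a b)).2, intervalIntegral.integral_of_le zero_le_one,
    integral_Ioc_eq_integral_Ioo]
  refine setIntegral_congr_fun measurableSet_Ioo fun t ht => ?_
  have ht0 : 0 < t := ht.1
  have h := intervalIntegral.integral_comp_mul_right (a := 0) (b := 1)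
    (fun s : ℝ => ((s : ℂ) - z)⁻¹ * (logKer a b s t : ℂ)) ht0.ne'
  rw [zero_mul, one_mul, intervalIntegral.integral_of_le ht0.le,
    intervalIntegral.integral_of_le zero_le_one, integral_Ioc_eq_integral_Ioo,
    integral_Ioc_eq_integral_Ioo, Complex.real_smul, Complex.ofReal_inv] at h
  rw [Lx_J hz a b ht.1 ht.2, ← h]
  refine setIntegral_congr_fun measurableSet_Ioo fun T hT => ?_
  rw [logKer, Real.log_mul hT.1.ne' ht0.ne', ell]
  push_cast
  ring

/-- The difference of logarithms is at most `-log(1-t)` in absolute value, so `C * ell a T * ell b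
(1-t)` dominates and the order of integration may be exchanged; the inner integral over `t` is then
`integral_log_ratio`. -/
lemma L_J_mul_e0 {z : ℂ} (hz : z ∈ slit) (a b : ℕ) :
    L z (J a b * e0) = (-1) ^ (b + 1) * ∫ T in Set.Ioo (0 : ℝ) 1,
        ell a T * ∫ v in Set.Ioo (0 : ℝ) 1, sumKernel z T v * ell b v := by
  obtain ⟨ε, hε, C, hC, -, hb⟩ := exists_bound_slit hz
  replace hb := hb z (Metric.mem_ball_self hε)
  rw [L_J_mul_e0_eq hz, integral_integral_swap, ← integral_const_mul]
  · refine setIntegral_congr_fun measurableSet_Ioo fun T hT => ?_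
    rw [integral_const_mul, integral_log_ratio hz b hT]
    ring
  · have hdom := Integrable.mul_prod (integrableOn_ell_one_sub b)
      ((integrableOn_ell a).const_mul C)
    refine Integrable.mono' hdom (Measurable.aestronglyMeasurable ?_) ?_
    · have h1 : Measurable fun p : ℝ × ℝ => (ell a p.2 : ℂ) :=
        (measurable_ell_ofReal a).comp measurable_snd
      unfold Function.uncurry
      exact h1.mul (by fun_prop)
    · rw [Measure.prod_restrict]
      refine (ae_restrict_iff' (measurableSet_Ioo.prod measurableSet_Ioo)).2
        (Eventually.of_forall ?_)
      rintro ⟨t, T⟩ ⟨ht, hT⟩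
      have ht0 : 0 < t := ht.1
      have ht1 : t < 1 := ht.2
      have hT0 : 0 < T := hT.1
      have hT1 : T < 1 := hT.2
      simp only [Function.uncurry]
      have hTt : T * t < t := by nlinarith
      have hTt0 : 0 < T * t := by positivity
      rw [norm_mul, norm_mul, norm_ell a hT, Complex.norm_real, Real.norm_eq_abs, abs_div, abs_pow,
        Nat.abs_cast]
      have h1 := hb (T * t) ⟨hTt0.le, by linarith⟩
      have h2 : Real.log (1 - t) ≤ Real.log (1 - T * t) :=
        Real.log_le_log (by linarith) (by linarith)
      have h3 : Real.log (1 - T * t) ≤ 0 := Real.log_nonpos (by linarith) (by linarith)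
      have h4 : |Real.log (1 - t) - Real.log (1 - T * t)| ^ b / b.factorial ≤ ell b (1 - t) := by
        rw [abs_of_nonpos (by linarith), ell]
        gcongr
        · linarith
        · linarith
      have h5 := ell_nonneg a hT0.le hT1.le
      calc _ ≤ ell a T * (C * ell b (1 - t)) := by gcongr
        _ = _ := by ring

lemma sum_formula_J {z : ℂ} (hz : z ∈ slit) (a b : ℕ) :
    (-1) ^ (b + 1) * L z (J a b * e0) =
      -L z (e1 * e0 ^ b * e0 ^ (a + 1)) + L z ((e1 - ez) * (e0 - ez) ^ b * e0 ^ (a + 1)) := by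
  rw [rhs_eq hz, L_J_mul_e0 hz, ← mul_assoc, ← mul_pow]
  simp

/-! ### The sum over the indices -/

/-- The compositions of `n` into `r` positive parts. -/
def comps (n r : ℕ) : Finset (Fin r → ℕ) :=
  (Finset.Nat.antidiagonalTuple r n).filter fun κ => ∀ i, 1 ≤ κ i

lemma mem_comps {n r : ℕ} {κ : Fin r → ℕ} :
    κ ∈ comps n r ↔ ∑ i, κ i = n ∧ ∀ i, 1 ≤ κ i := by
  simp [comps, Finset.Nat.mem_antidiagonalTuple]

lemma mem_indices {k r : ℕ} {κ : Fin (r + 1) → ℕ} :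
    κ ∈ indices k (r + 1) ↔ ∑ i, κ i = k ∧ (∀ i, 1 ≤ κ i) ∧ 2 ≤ κ (Fin.last r) := by
  rw [indices, Finset.mem_filter, Finset.Nat.mem_antidiagonalTuple]
  refine and_congr_right fun _ => and_congr_right fun _ =>
    ⟨fun h => h _ (by simp), fun h i hi => ?_⟩
  have : i = Fin.last r := Fin.ext (by simpa using hi)
  rwa [this]

lemma comps_eq_empty {n r : ℕ} (h : n < r) : comps n r = ∅ := by
  refine Finset.eq_empty_of_forall_notMem fun κ hκ => ?_
  obtain ⟨h1, h2⟩ := mem_comps.1 hκ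
  have : ∑ _i : Fin r, 1 ≤ ∑ i, κ i := Finset.sum_le_sum fun i _ => h2 i
  simp at this
  omega

lemma zWord_succ {r : ℕ} (κ : Fin (r + 1) → ℕ) :
    zWord κ = (List.ofFn fun i : Fin r =>
      (if (i : ℕ) = 0 then ez else e1) * e0 ^ (κ i.castSucc - 1)).prod *
        ((if r = 0 then ez else e1) * e0 ^ (κ (Fin.last r) - 1)) := by
  rw [zWord, List.ofFn_succ', List.concat_eq_append, List.prod_append]
  simp

/-- Increase the last part of a composition. -/
def incLast {r : ℕ} (κ : Fin (r + 1) → ℕ) : Fin (r + 1) → ℕ :=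
  Function.update κ (Fin.last r) (κ (Fin.last r) + 1)

/-- Decrease the last part of a composition. -/
def decLast {r : ℕ} (κ : Fin (r + 1) → ℕ) : Fin (r + 1) → ℕ :=
  Function.update κ (Fin.last r) (κ (Fin.last r) - 1)

lemma zWord_incLast {r : ℕ} {κ : Fin (r + 1) → ℕ} (h : 1 ≤ κ (Fin.last r)) :
    zWord (incLast κ) = zWord κ * e0 := by
  rw [zWord_succ, zWord_succ κ]
  have h1 : ∀ i : Fin r, incLast κ i.castSucc = κ i.castSucc := fun i =>
    Function.update_of_ne (Fin.castSucc_lt_last i).ne _ _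
  have h2 : incLast κ (Fin.last r) = κ (Fin.last r) + 1 := Function.update_self ..
  obtain ⟨m, hm⟩ := Nat.exists_eq_add_of_le' h
  simp only [h1, h2, hm, Nat.add_sub_cancel, mul_assoc, ← pow_succ]

lemma zWord_snoc_one {r : ℕ} (κ : Fin (r + 1) → ℕ) :
    zWord (Fin.snoc (α := fun _ => ℕ) κ 1 : Fin (r + 2) → ℕ) = zWord κ * e1 := by
  rw [zWord_succ]
  simp [zWord]

lemma sum_incLast {r : ℕ} (κ : Fin (r + 1) → ℕ) : ∑ i, incLast κ i = ∑ i, κ i + 1 := by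
  rw [Fin.sum_univ_castSucc, Fin.sum_univ_castSucc]
  have h1 : ∀ i : Fin r, incLast κ i.castSucc = κ i.castSucc := fun i =>
    Function.update_of_ne (Fin.castSucc_lt_last i).ne _ _
  have h2 : incLast κ (Fin.last r) = κ (Fin.last r) + 1 := Function.update_self ..
  simp only [h1, h2, add_assoc]

lemma incLast_decLast {r : ℕ} {κ : Fin (r + 1) → ℕ} (h : 1 ≤ κ (Fin.last r)) :
    incLast (decLast κ) = κ := by
  simp [incLast, decLast, Nat.sub_add_cancel h]

lemma decLast_incLast {r : ℕ} (κ : Fin (r + 1) → ℕ) : decLast (incLast κ) = κ := by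
  simp [incLast, decLast]

/-- Lowering the last part turns the condition `k_r ≥ 2` into plain positivity; on words it strips
the final `e_0`. -/
lemma sum_indices {M : Type*} [AddCommMonoid M] (n r : ℕ) (f : (Fin (r + 1) → ℕ) → M) :
    ∑ κ ∈ indices (n + 1) (r + 1), f κ = ∑ κ ∈ comps n (r + 1), f (incLast κ) := by
  refine Finset.sum_nbij' decLast incLast (fun κ hκ => ?_) (fun κ hκ => ?_) (fun κ hκ => ?_)
    (fun κ _ => decLast_incLast κ) fun κ hκ => ?_
  · obtain ⟨h1, h2, h3⟩ := mem_indices.1 hκ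
    have h4 := sum_incLast (decLast κ)
    rw [incLast_decLast (by omega), h1] at h4
    refine mem_comps.2 ⟨by omega, fun i => ?_⟩
    rcases eq_or_ne i (Fin.last r) with rfl | hi
    · rw [decLast, Function.update_self]; omega
    · rw [decLast, Function.update_of_ne hi]; exact h2 i
  · obtain ⟨h1, h2⟩ := mem_comps.1 hκ
    have h3 := h2 (Fin.last r)
    refine mem_indices.2 ⟨by rw [sum_incLast, h1], fun i => ?_, ?_⟩
    · rcases eq_or_ne i (Fin.last r) with rfl | hi
      · rw [incLast, Function.update_self]; omega
      · rw [incLast, Function.update_of_ne hi]; exact h2 i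
    · rw [incLast, Function.update_self]; omega
  · exact incLast_decLast (by have := (mem_indices.1 hκ).2.2; omega)
  · rw [incLast_decLast (by have := (mem_indices.1 hκ).2.2; omega)]

lemma indices_self {r : ℕ} : indices (r + 1) (r + 1) = ∅ := by
  have h := sum_indices r r fun _ => 1
  rw [comps_eq_empty (Nat.lt_succ_self r), Finset.sum_empty] at h
  simpa using h

lemma sum_comps_of_last_eq_one {M : Type*} [AddCommMonoid M] (n r : ℕ)
    (f : (Fin (r + 2) → ℕ) → M) :
    ∑ κ ∈ comps (n + 1) (r + 2) with ¬2 ≤ κ (Fin.last _), f κ =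
      ∑ κ ∈ comps n (r + 1), f (Fin.snoc (α := fun _ => ℕ) κ 1) := by
  refine Finset.sum_nbij' (fun κ => Fin.init κ) (fun κ => Fin.snoc (α := fun _ => ℕ) κ 1)
    (fun κ hκ => ?_) (fun κ hκ => ?_) (fun κ hκ => ?_) (fun κ _ => by simp) fun κ hκ => ?_
  · obtain ⟨h0, h3⟩ := Finset.mem_filter.1 hκ
    obtain ⟨h1, h2⟩ := mem_comps.1 h0
    have h4 := h2 (Fin.last _)
    rw [Fin.sum_univ_castSucc] at h1
    exact mem_comps.2 ⟨by simp only [Fin.init]; omega, fun i => h2 _⟩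
  · obtain ⟨h1, h2⟩ := mem_comps.1 hκ
    refine Finset.mem_filter.2 ⟨mem_comps.2 ⟨?_, fun i => ?_⟩, by simp⟩
    · rw [Fin.sum_univ_castSucc]
      simp [h1]
    · induction i using Fin.lastCases with
      | last => simp
      | cast i => simpa using h2 i
  all_goals
    obtain ⟨h0, h3⟩ := Finset.mem_filter.1 hκ
    obtain ⟨h1, h2⟩ := mem_comps.1 h0
    have h4 : κ (Fin.last _) = 1 := by have := h2 (Fin.last _); omega
    have h5 : (Fin.snoc (α := fun _ => ℕ) (Fin.init κ) 1 : Fin (r + 2) → ℕ) = κ := by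
      have h6 := Fin.snoc_init_self κ
      rwa [h4] at h6
    rw [h5]

lemma comps_filter (n r : ℕ) :
    (comps n (r + 1)).filter (fun κ => 2 ≤ κ (Fin.last _)) = indices n (r + 1) := by
  ext κ
  rw [Finset.mem_filter, mem_comps, mem_indices, and_assoc]

lemma sum_indices_zWord (n r : ℕ) :
    ∑ κ ∈ indices (n + 1) (r + 1), zWord κ = (∑ κ ∈ comps n (r + 1), zWord κ) * e0 := by
  rw [sum_indices, Finset.sum_mul]
  exact Finset.sum_congr rfl fun κ hκ => zWord_incLast ((mem_comps.1 hκ).2 _)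

/-- A composition whose last part is at least `2` gives a word ending in `e_0`; last part `1` gives
one ending in `e_1`. This is the recursion of `J`. -/
lemma sum_comps_zWord (n r : ℕ) :
    ∑ κ ∈ comps (n + 1) (r + 2), zWord κ =
      (∑ κ ∈ comps n (r + 2), zWord κ) * e0 + (∑ κ ∈ comps n (r + 1), zWord κ) * e1 := by
  rw [← Finset.sum_filter_add_sum_filter_not _ (fun κ => 2 ≤ κ (Fin.last _)), comps_filter,
    sum_indices_zWord, sum_comps_of_last_eq_one, Finset.sum_mul _ _ e1]
  simp only [zWord_snoc_one]

lemma comps_one_one : comps 1 1 = {fun _ => 1} := by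
  ext κ
  rw [mem_comps, Finset.mem_singleton]
  constructor
  · rintro ⟨h, -⟩
    ext i
    rw [Subsingleton.elim i 0]
    simpa using h
  · rintro rfl
    simp

lemma comps_filter_not_one (n : ℕ) :
    (comps (n + 2) 1).filter (fun κ => ¬2 ≤ κ (Fin.last 0)) = ∅ := by
  refine Finset.eq_empty_of_forall_notMem fun κ hκ => ?_
  obtain ⟨h0, h3⟩ := Finset.mem_filter.1 hκ
  have h1 := (mem_comps.1 h0).1
  simp at h1 h3
  omega

lemma sum_comps_zWord_eq_J (a b : ℕ) : ∑ κ ∈ comps (a + b + 1) (b + 1), zWord κ = J a b := by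
  induction a, b using J.induct with
  | case1 => rw [J, comps_one_one]; simp [zWord]
  | case2 a ih =>
    rw [J, ← ih, ← sum_indices_zWord,
      ← Finset.sum_filter_add_sum_filter_not _ (fun κ => 2 ≤ κ (Fin.last _)), comps_filter]
    rw [show a + 1 + 0 + 1 = a + 2 by rfl, comps_filter_not_one, Finset.sum_empty, add_zero]
  | case3 b ih =>
    rw [show 0 + (b + 1) + 1 = (b + 1) + 1 by omega, sum_comps_zWord, J, ← ih,
      comps_eq_empty (by omega), Finset.sum_empty, zero_mul, zero_add, zero_add]
  | case4 a b ih1 ih2 =>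
    rw [show a + 1 + (b + 1) + 1 = (a + b + 2) + 1 by omega, sum_comps_zWord, J, ← ih1, ← ih2,
      show a + (b + 1) + 1 = a + b + 2 by omega, show a + 1 + b + 1 = a + b + 2 by omega]

lemma sum_indices_zWord_eq_J (a b : ℕ) :
    ∑ κ ∈ indices (a + b + 2) (b + 1), zWord κ = J a b * e0 := by
  rw [sum_indices_zWord, sum_comps_zWord_eq_J]

lemma zWord_mem_B {r : ℕ} (κ : Fin (r + 1) → ℕ) : zWord κ ∈ B := by
  induction r with
  | zero => simpa [zWord] using mul_e0_pow_mem_B ez_mem_B _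
  | succ r ih =>
    rw [zWord_succ, if_neg r.succ_ne_zero, ← mul_assoc]
    exact mul_e0_pow_mem_B (mul_e1_mem_B (ih fun i => κ i.castSucc)) _

lemma zWord_mem_A0 {k r : ℕ} {κ : Fin (r + 1) → ℕ} (h : κ ∈ indices k (r + 1)) : zWord κ ∈ A0 := by
  have h2 := (mem_indices.1 h).2.2
  rw [← incLast_decLast (κ := κ) (by omega), zWord_incLast]
  · exact mul_e0_mem_A0 (zWord_mem_B _)
  · rw [decLast, Function.update_self]
    omega

/-! ### The limit `z → 1` of the iterated integrals -/

lemma letterBound_one : LetterBound 1 1 := by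
  simpa using letterBound_one_of_one_le le_rfl

lemma tendsto_inv_sub_pt (a : Letter) {t : ℝ} (ht : t < 1) :
    Tendsto (fun x : ℝ => ((t : ℂ) - a.pt x)⁻¹) (𝓝[>] 1) (𝓝 ((t : ℂ) - a.pt 1)⁻¹) := by
  cases a with
  | zero => exact tendsto_const_nhds
  | one => exact tendsto_const_nhds
  | z =>
    refine Tendsto.inv₀ (tendsto_const_nhds.sub ?_) ?_
    · exact (Complex.continuous_ofReal.tendsto' 1 1 (by simp)).mono_left nhdsWithin_le_nhds
    · rw [Letter.pt, ← Complex.ofReal_one, ← Complex.ofReal_sub, Complex.ofReal_ne_zero]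
      linarith

lemma eventually_letterBound : ∀ᶠ x : ℝ in 𝓝[>] 1, LetterBound (x : ℂ) 1 := by
  filter_upwards [self_mem_nhdsWithin] with x hx
  exact letterBound_one_of_one_le (le_of_lt hx)

lemma tendsto_iterAux {w : List Letter} (hw : w = [] ∨ Regular w) {t : ℝ} (ht0 : 0 ≤ t)
    (ht : t < 1) :
    Tendsto (fun x : ℝ => iterAux x w t) (𝓝[>] 1) (𝓝 (iterAux 1 w t)) := by
  induction w generalizing t with
  | nil => exact tendsto_const_nhds
  | cons a w ih =>
    replace hw : Regular (a :: w) := hw.resolve_left (by simp)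
    have hw' := (regular_cons_iff.1 hw).imp_left And.left
    obtain ⟨D, -, hD⟩ := exists_norm_integrand_le hw zero_le_one
    simp only [iterAux, intervalIntegral.integral_of_le ht0]
    refine tendsto_integral_filter_of_dominated_convergence _ ?_ ?_
      ((integrableOn_rho_div_mul ht).const_mul D) ?_
    · filter_upwards [eventually_letterBound] with x hx
      exact (integrableOn_integrand hx hw ht).aestronglyMeasurable
    · filter_upwards [eventually_letterBound] with x hx
      exact (ae_restrict_iff' measurableSet_Ioc).2 (Eventually.of_forall fun s hs =>
        hD x hx s ⟨hs.1, hs.2.trans_lt ht⟩)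
    · exact (ae_restrict_iff' measurableSet_Ioc).2 (Eventually.of_forall fun s hs =>
        (tendsto_inv_sub_pt a (hs.2.trans_lt ht)).mul (ih hw' hs.1.le (hs.2.trans_lt ht)))

lemma norm_inv_sub_zero_le (z : ℂ) {t : ℝ} (ht : t ∈ Set.Ioo (0 : ℝ) 1) :
    ‖((t : ℂ) - Letter.pt z .zero)⁻¹‖ ≤ 1 / t := by
  rw [Letter.pt, sub_zero, norm_inv, Complex.norm_real, Real.norm_of_nonneg ht.1.le, one_div]

lemma tendsto_iterAux_zero_cons {w : List Letter} (hw : Regular w) :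
    Tendsto (fun x : ℝ => iterAux x (.zero :: w) 1) (𝓝[>] 1) (𝓝 (iterAux 1 (.zero :: w) 1)) := by
  obtain ⟨D, -, hD⟩ := exists_norm_integrand_le_rho_div hw zero_le_one
  simp only [iterAux, intervalIntegral.integral_of_le zero_le_one, integral_Ioc_eq_integral_Ioo]
  refine tendsto_integral_filter_of_dominated_convergence _ ?_ ?_
    ((integrableOn_rho_div.mono_set Set.Ioo_subset_Ioc_self).const_mul D) ?_
  · filter_upwards [eventually_letterBound] with x hx
    exact (integrableOn_integrand_one hx hw fun t ht =>
      norm_inv_sub_zero_le _ ht).aestronglyMeasurable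
  · filter_upwards [eventually_letterBound] with x hx
    exact (ae_restrict_iff' measurableSet_Ioo).2 (Eventually.of_forall fun s hs =>
      hD x hx .zero s hs (norm_inv_sub_zero_le _ hs))
  · exact (ae_restrict_iff' measurableSet_Ioo).2 (Eventually.of_forall fun s hs =>
      (tendsto_inv_sub_pt .zero hs.2).mul (tendsto_iterAux (Or.inr hw) hs.1.le hs.2))

/-- The restriction to a final `e_0` is essential to the domination: at `z = 1` the letter `e_z`
acquires a pole at the end point. -/
lemma tendsto_L_mul_e0 {p : A} (hp : p ∈ B) :
    Tendsto (fun x : ℝ => L x (p * e0)) (𝓝[>] 1) (𝓝 (L 1 (p * e0))) := by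
  induction hp using Submodule.span_induction with
  | mem q hq =>
    obtain ⟨a, u, ha, rfl⟩ := hq
    rw [e0, ← word_singleton, ← word_append]
    simp only [L_word, iter, List.reverse_append (as := [a] ++ u)]
    exact tendsto_iterAux_zero_cons (regular_reverse ha u)
  | zero => simp
  | add p q _ _ hp hq =>
    simp only [add_mul, map_add]
    exact hp.add hq
  | smul c q _ hq =>
    simp only [smul_mul_assoc, map_smul]
    exact hq.const_smul c

/-- Only the singular points matter. At `z = 1` this identifies `e_z` with `e_1`, and it shows that
words without `e_z` do not depend on `z`. -/
lemma iterAux_congr {z z' : ℂ} {w w' : List Letter}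
    (h : w.map (Letter.pt z) = w'.map (Letter.pt z')) : iterAux z w = iterAux z' w' := by
  induction w generalizing w' with
  | nil =>
    rw [List.map_nil, eq_comm, List.map_eq_nil_iff] at h
    rw [h]
    rfl
  | cons a w ih =>
    cases w' with
    | nil => simp at h
    | cons b w' =>
      rw [List.map_cons, List.map_cons, List.cons.injEq] at h
      ext x
      rw [iterAux, iterAux, h.1, ih h.2]

lemma L_one_e1_sub_ez_mul (p : A) : L 1 ((e1 - ez) * p) = 0 := by
  have hp : p ∈ Submodule.span ℚ (Set.range word) := by
    rw [span_range_word]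
    exact Submodule.mem_top
  induction hp using Submodule.span_induction with
  | mem q hq =>
    obtain ⟨w, rfl⟩ := hq
    rw [sub_mul, map_sub, e1, ez, ← word_cons, ← word_cons, L_word, L_word, sub_eq_zero, iter, iter]
    refine congrFun (iterAux_congr ?_) 1
    simp [Letter.pt]
  | zero => simp
  | add p q _ _ hp hq => rw [mul_add, map_add, hp, hq, add_zero]
  | smul c q _ hq => rw [mul_smul_comm, map_smul, hq, smul_zero]

lemma L_e1_mul_e0_pow_eq (z : ℂ) (n : ℕ) : L z (e1 * e0 ^ n) = L 1 (ez * e0 ^ n) := by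
  rw [e1, ez, e0, ← word_replicate, ← word_cons, ← word_cons, L_word, L_word, iter, iter]
  refine congrFun (iterAux_congr ?_) 1
  simp [Letter.pt]

/-! ### The sign of the iterated integrals at `z = 1` -/

/-- The sign of the form `dt / (t - a)` on `(0,1)` at `z = 1`. -/
noncomputable def Letter.sgn : Letter → ℂ
  | .zero => 1
  | .one => -1
  | .z => -1

lemma inv_sub_pt_eq_sgn (a : Letter) {t : ℝ} (ht : t ∈ Set.Ioo (0 : ℝ) 1) :
    ((t : ℂ) - a.pt 1)⁻¹ = a.sgn * (‖((t : ℂ) - a.pt 1)⁻¹‖ : ℝ) := by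
  have h1 : ((t : ℂ) - 1)⁻¹ = (-1) * (‖((t : ℂ) - 1)⁻¹‖ : ℝ) := by
    rw [norm_inv_sub_one ht.2]
    push_cast
    rw [← neg_sub, inv_neg, one_div, neg_one_mul]
  cases a with
  | zero =>
    rw [Letter.pt, Letter.sgn, sub_zero, one_mul, norm_inv, Complex.norm_real,
      Real.norm_of_nonneg ht.1.le, Complex.ofReal_inv]
  | one => exact h1
  | z => exact h1

lemma measurable_absIterAux (z : ℂ) (w : List Letter) : Measurable (absIterAux z w) := by
  refine Monotone.measurable fun x y hxy => ?_
  cases w with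
  | nil => exact le_rfl
  | cons a w => exact lintegral_mono_set (Set.Ioo_subset_Ioo_right hxy)

lemma absIterAux_lt_top {z : ℂ} {C : ℝ} (h : LetterBound z C) {w : List Letter}
    (hw : w = [] ∨ Regular w) {x : ℝ} (hx0 : 0 ≤ x) (hx : x < 1) : absIterAux z w x < ⊤ := by
  rcases hw with rfl | ⟨u, a, ha, rfl⟩
  · simp [absIterAux]
  · exact (absIterAux_le h ha u hx0 hx).trans_lt ENNReal.ofReal_lt_top

/-- At `z = 1` each form has constant sign on `(0,1)`, so nothing cancels. The hypothesis concerns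
`t < 1` only while `x = 1` is allowed, which brings in the end point. -/
lemma iterAux_cons_eq_sgn {a : Letter} {w : List Letter} {s : ℂ} (hw : w = [] ∨ Regular w) {x : ℝ}
    (hx0 : 0 ≤ x) (hx : x ≤ 1)
    (h : ∀ t, 0 ≤ t → t < 1 → iterAux 1 w t = s * (absIterAux 1 w t).toReal) :
    iterAux 1 (a :: w) x = a.sgn * s * (absIterAux 1 (a :: w) x).toReal := by
  have hm : Measurable fun t : ℝ => ‖((t : ℂ) - a.pt 1)⁻¹‖ₑ * absIterAux 1 w t :=
    (measurable_inv_sub _).enorm.mul (measurable_absIterAux 1 w)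
  rw [iterAux, absIterAux, ← integral_toReal hm.aemeasurable, ← integral_complex_ofReal,
    ← integral_const_mul, intervalIntegral.integral_of_le hx0, integral_Ioc_eq_integral_Ioo]
  · refine setIntegral_congr_fun measurableSet_Ioo fun t ht => ?_
    rw [h t ht.1.le (ht.2.trans_le hx), inv_sub_pt_eq_sgn a ⟨ht.1, ht.2.trans_le hx⟩,
      ENNReal.toReal_mul, toReal_enorm, Complex.ofReal_mul, norm_mul, Complex.norm_real, norm_norm]
    have : ‖a.sgn‖ = 1 := by cases a <;> simp [Letter.sgn]
    rw [this, one_mul]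
    ring
  · refine (ae_restrict_iff' measurableSet_Ioo).2 (Eventually.of_forall fun t ht => ?_)
    exact ENNReal.mul_lt_top enorm_lt_top
      (absIterAux_lt_top letterBound_one hw ht.1.le (ht.2.trans_le hx))

lemma iterAux_one_eq_sgn {w : List Letter} (hw : w = [] ∨ Regular w) {x : ℝ} (hx0 : 0 ≤ x)
    (hx : x < 1) :
    iterAux 1 w x = (w.map Letter.sgn).prod * (absIterAux 1 w x).toReal := by
  induction w generalizing x with
  | nil => simp [iterAux, absIterAux]
  | cons a w ih =>
    have hw' := (regular_cons_iff.1 (hw.resolve_left (by simp))).imp_left And.left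
    rw [iterAux_cons_eq_sgn hw' hx0 hx.le fun t ht0 ht => ih hw' ht0 ht, List.map_cons,
      List.prod_cons]

/-! ### Power series of the iterated integrals at `z = 1` -/

lemma lintegral_monomial {c : ℝ} (hc : 0 ≤ c) (n : ℕ) {x : ℝ} (hx : 0 ≤ x) :
    ∫⁻ t in Set.Ioo 0 x, ENNReal.ofReal (c * t ^ n) =
      ENNReal.ofReal (c / (n + 1 : ℕ) * x ^ (n + 1)) := by
  have hint : IntervalIntegrable (fun t : ℝ => c * t ^ n) volume 0 x :=
    Continuous.intervalIntegrable (by fun_prop) _ _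
  rw [setLIntegral_congr Ioo_ae_eq_Ioc, ← ofReal_integral_eq_lintegral_ofReal
    ((intervalIntegrable_iff_integrableOn_Ioc_of_le hx).1 hint),
    ← intervalIntegral.integral_of_le hx, intervalIntegral.integral_const_mul, integral_pow]
  · congr 1
    push_cast
    simp
    ring
  · refine (ae_restrict_iff' measurableSet_Ioc).2 (Eventually.of_forall fun t ht => ?_)
    exact mul_nonneg hc (pow_nonneg ht.1.le n)

section Series

variable {ι : Type*} [Countable ι] {c : ι → ℝ} {e : ι → ℕ} {f : ℝ → ℝ≥0∞}

lemma lintegral_inv_mul_series (hc : ∀ i, 0 ≤ c i) (he : ∀ i, 1 ≤ e i)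
    (hf : ∀ t ∈ Set.Ioo (0 : ℝ) 1, f t = ∑' i, ENNReal.ofReal (c i * t ^ e i)) {x : ℝ}
    (hx0 : 0 ≤ x) (hx : x ≤ 1) :
    ∫⁻ t in Set.Ioo 0 x, ‖((t : ℂ) - 0)⁻¹‖ₑ * f t =
      ∑' i, ENNReal.ofReal (c i / e i * x ^ e i) := by
  have h1 : ∫⁻ t in Set.Ioo 0 x, ‖((t : ℂ) - 0)⁻¹‖ₑ * f t =
      ∫⁻ t in Set.Ioo 0 x, ∑' i, ENNReal.ofReal (c i * t ^ (e i - 1)) := by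
    refine setLIntegral_congr_fun measurableSet_Ioo fun t ht => ?_
    have ht0 : 0 < t := ht.1
    rw [hf t ⟨ht.1, ht.2.trans_le hx⟩, ← ENNReal.tsum_mul_left]
    refine tsum_congr fun i => ?_
    rw [sub_zero, ← ofReal_norm, norm_inv, Complex.norm_real, Real.norm_of_nonneg ht0.le,
      ← ENNReal.ofReal_mul (by positivity)]
    congr 1
    obtain ⟨m, hm⟩ := Nat.exists_eq_add_of_le' (he i)
    rw [hm, Nat.add_sub_cancel, pow_succ]
    field_simp
  rw [h1, lintegral_tsum fun i => by fun_prop]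
  refine tsum_congr fun i => ?_
  rw [lintegral_monomial (hc i) _ hx0, Nat.sub_add_cancel (he i)]

/-- The geometric series `1/(1-t) = ∑ t^j` creates a new summation index, the gap to the next entry
of the increasing sequence. Values in `[0,∞]` permit termwise integration before any convergence is
known. -/
lemma lintegral_inv_sub_one_mul_series (hc : ∀ i, 0 ≤ c i)
    (hf : ∀ t ∈ Set.Ioo (0 : ℝ) 1, f t = ∑' i, ENNReal.ofReal (c i * t ^ e i)) {x : ℝ}
    (hx0 : 0 ≤ x) (hx : x ≤ 1) :
    ∫⁻ t in Set.Ioo 0 x, ‖((t : ℂ) - 1)⁻¹‖ₑ * f t =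
      ∑' p : ι × ℕ, ENNReal.ofReal (c p.1 / (e p.1 + p.2 + 1 : ℕ) * x ^ (e p.1 + p.2 + 1)) := by
  have h1 : ∫⁻ t in Set.Ioo 0 x, ‖((t : ℂ) - 1)⁻¹‖ₑ * f t =
      ∫⁻ t in Set.Ioo 0 x, ∑' p : ι × ℕ, ENNReal.ofReal (c p.1 * t ^ (e p.1 + p.2)) := by
    refine setLIntegral_congr_fun measurableSet_Ioo fun t ht => ?_
    have ht0 : 0 < t := ht.1
    have ht1 : t < 1 := ht.2.trans_le hx
    rw [hf t ⟨ht.1, ht1⟩, ENNReal.tsum_prod', ← ENNReal.tsum_mul_left]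
    refine tsum_congr fun i => ?_
    have hg : ‖((t : ℂ) - 1)⁻¹‖ₑ = ∑' j : ℕ, ENNReal.ofReal (t ^ j) := by
      rw [← ofReal_norm, norm_inv_sub_one ht1, one_div, ← tsum_geometric_of_lt_one ht0.le ht1,
        ENNReal.ofReal_tsum_of_nonneg (fun j => by positivity)
          (summable_geometric_of_lt_one ht0.le ht1)]
    rw [hg, mul_comm, ← ENNReal.tsum_mul_left]
    refine tsum_congr fun j => ?_
    rw [← ENNReal.ofReal_mul (mul_nonneg (hc i) (by positivity)), pow_add, mul_assoc]
  rw [h1, lintegral_tsum fun i => by fun_prop]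
  refine tsum_congr fun p => ?_
  rw [lintegral_monomial (hc p.1) _ hx0]

lemma absIterAux_replicate_zero {z : ℂ} {w : List Letter} (hc : ∀ i, 0 ≤ c i) (he : ∀ i, 1 ≤ e i)
    (hf : ∀ x, 0 ≤ x → x ≤ 1 → absIterAux z w x = ∑' i, ENNReal.ofReal (c i * x ^ e i))
    (n : ℕ) {x : ℝ} (hx0 : 0 ≤ x) (hx : x ≤ 1) :
    absIterAux z (List.replicate n .zero ++ w) x =
      ∑' i, ENNReal.ofReal (c i / e i ^ n * x ^ e i) := by
  induction n generalizing x with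
  | zero => simpa using hf x hx0 hx
  | succ n ih =>
    rw [List.replicate_succ, List.cons_append, absIterAux]
    refine (lintegral_inv_mul_series (fun i => div_nonneg (hc i) (by positivity)) he
      (fun t ht => ih ht.1.le ht.2.le) hx0 hx).trans (tsum_congr fun i => ?_)
    rw [div_div, pow_succ]

end Series

/-! ### Multiple zeta values -/

/-- The largest entry of an increasing sequence, `0` for the empty one. -/
def IncSeq.top {r : ℕ} (m : IncSeq r) : ℕ := Finset.univ.sup m.1

lemma IncSeq.top_succ {r : ℕ} (m : IncSeq (r + 1)) : m.top = m.1 (Fin.last r) :=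
  le_antisymm (Finset.sup_le fun i _ => m.2.2.monotone (Fin.le_last i))
    (Finset.le_sup (f := m.1) (Finset.mem_univ (Fin.last r)))

lemma IncSeq.le_top {r : ℕ} (m : IncSeq r) (i : Fin r) : m.1 i ≤ m.top :=
  Finset.le_sup (f := m.1) (Finset.mem_univ i)

/-- Append an entry to an increasing sequence. -/
def IncSeq.snoc {r : ℕ} (m : IncSeq r) (j : ℕ) : IncSeq (r + 1) :=
  ⟨Fin.snoc (α := fun _ => ℕ) m.1 (m.top + j + 1), fun i => by
      induction i using Fin.lastCases with
      | last => simp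
      | cast i => simpa using m.2.1 i,
    fun i i' h => by
      induction i' using Fin.lastCases with
      | last =>
        induction i using Fin.lastCases with
        | last => exact absurd h (lt_irrefl _)
        | cast i =>
          have := m.le_top i
          simp only [Fin.snoc_castSucc, Fin.snoc_last]
          omega
      | cast i' =>
        induction i using Fin.lastCases with
        | last => exact absurd h (not_lt.2 (Fin.le_last _))
        | cast i =>
          simp only [Fin.snoc_castSucc]
          exact m.2.2 (Fin.castSucc_lt_castSucc_iff.1 h)⟩

/-- Remove the last entry of an increasing sequence. -/
def IncSeq.init {r : ℕ} (m : IncSeq (r + 1)) : IncSeq r :=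
  ⟨fun i => m.1 i.castSucc, fun _ => m.2.1 _, fun _ _ h => m.2.2 (Fin.castSucc_lt_castSucc_iff.2 h)⟩

lemma IncSeq.top_init_lt {r : ℕ} (m : IncSeq (r + 1)) : m.init.top < m.1 (Fin.last r) :=
  (Finset.sup_lt_iff (m.2.1 _)).2 fun i _ => m.2.2 (Fin.castSucc_lt_last i)

/-- An increasing sequence is a shorter one together with the gap to the last entry. -/
def incSeqEquiv (r : ℕ) : IncSeq r × ℕ ≃ IncSeq (r + 1) where
  toFun p := p.1.snoc p.2
  invFun m := (m.init, m.1 (Fin.last r) - m.init.top - 1)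
  left_inv p := by
    have h : (p.1.snoc p.2).init = p.1 := Subtype.ext (by
      ext i
      simp [IncSeq.init, IncSeq.snoc])
    refine Prod.ext h ?_
    simp only [h]
    simp only [IncSeq.snoc, Fin.snoc_last]
    omega
  right_inv m := Subtype.ext (by
    have h := m.top_init_lt
    ext i
    induction i using Fin.lastCases with
    | last =>
      simp only [IncSeq.snoc, Fin.snoc_last]
      omega
    | cast i => simp [IncSeq.snoc, IncSeq.init])

lemma mzvTerm_nonneg {r : ℕ} (κ : Fin r → ℕ) (m : IncSeq r) : 0 ≤ mzvTerm κ m :=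
  div_nonneg zero_le_one (Finset.prod_nonneg fun _ _ => by positivity)

lemma mzvTerm_snoc {r : ℕ} (κ : Fin (r + 1) → ℕ) (m : IncSeq r) (j : ℕ) :
    mzvTerm κ (m.snoc j) =
      mzvTerm (fun i => κ i.castSucc) m / (m.top + j + 1 : ℕ) ^ κ (Fin.last r) := by
  rw [mzvTerm, mzvTerm, Fin.prod_univ_castSucc, div_div]
  simp [IncSeq.snoc]

/-- The letters of `zWord κ`, from the last one to the first one. -/
def zLetters : {r : ℕ} → (Fin r → ℕ) → List Letter
  | 0, _ => []
  | r + 1, κ => List.replicate (κ (Fin.last r) - 1) .zero ++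
      (if r = 0 then .z else .one) :: zLetters fun i : Fin r => κ i.castSucc

lemma word_reverse_zLetters {r : ℕ} (κ : Fin r → ℕ) : word (zLetters κ).reverse = zWord κ := by
  induction r with
  | zero => simp [zLetters, zWord, word]
  | succ r ih =>
    rw [zWord_succ, zLetters, List.reverse_append, List.reverse_cons, List.reverse_replicate,
      word_append, word_append, word_replicate, ih, word_singleton, mul_assoc]
    congr 2
    split_ifs <;> rfl

lemma prod_sgn_zLetters {r : ℕ} (κ : Fin r → ℕ) :
    ((zLetters κ).map Letter.sgn).prod = (-1) ^ r := by
  induction r with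
  | zero => simp [zLetters]
  | succ r ih =>
    rw [zLetters, List.map_append, List.map_cons, List.prod_append, List.prod_cons, ih, pow_succ']
    split_ifs <;> simp [Letter.sgn]

lemma regular_append {w : List Letter} (u : List Letter) (hw : Regular w) : Regular (u ++ w) := by
  obtain ⟨v, a, ha, rfl⟩ := hw
  exact ⟨u ++ v, a, ha, (List.append_assoc ..).symm⟩

lemma regular_zLetters {r : ℕ} (κ : Fin (r + 1) → ℕ) : Regular (zLetters κ) := by
  induction r with
  | zero =>
    rw [zLetters]
    exact regular_append _ (regular_singleton (by simp))
  | succ r ih =>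
    rw [zLetters]
    exact regular_append _ ((ih _).cons _)

/-- Each letter other than `e_0` appends an entry `m_i` and divides by it; each following `e_0`
divides by it once more. As an identity in `[0,∞]` it also holds at `x = 1`. -/
lemma absIterAux_zLetters {r : ℕ} {κ : Fin r → ℕ} (hκ : ∀ i, 1 ≤ κ i) {x : ℝ} (hx0 : 0 ≤ x)
    (hx : x ≤ 1) :
    absIterAux 1 (zLetters κ) x = ∑' m : IncSeq r, ENNReal.ofReal (mzvTerm κ m * x ^ m.top) := by
  induction r generalizing x with
  | zero =>
    have : Unique (IncSeq 0) :=
      ⟨⟨⟨Fin.elim0, fun i => i.elim0, fun i => i.elim0⟩⟩, fun m => Subtype.ext (by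
        ext i; exact i.elim0)⟩
    rw [tsum_eq_single default fun m hm => absurd (Subsingleton.elim m default) hm]
    simp [zLetters, absIterAux, mzvTerm, IncSeq.top]
  | succ r ih =>
    have h1 : ∀ x : ℝ, 0 ≤ x → x ≤ 1 →
        absIterAux 1 ((if r = 0 then .z else .one) :: zLetters fun i : Fin r => κ i.castSucc) x =
        ∑' p : IncSeq r × ℕ, ENNReal.ofReal (mzvTerm (fun i => κ i.castSucc) p.1 /
          (p.1.top + p.2 + 1 : ℕ) * x ^ (p.1.top + p.2 + 1)) := by
      intro x hx0 hx
      rw [← lintegral_inv_sub_one_mul_series (mzvTerm_nonneg fun i => κ i.castSucc)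
        (fun t ht => ih (κ := fun i => κ i.castSucc) (fun i => hκ _) ht.1.le ht.2.le) hx0 hx,
        absIterAux]
      split_ifs <;> rfl
    rw [zLetters, absIterAux_replicate_zero
      (fun p => div_nonneg (mzvTerm_nonneg _ _) (Nat.cast_nonneg _)) (fun p => by omega) h1 _
      hx0 hx,
      ← (incSeqEquiv r).tsum_eq]
    refine tsum_congr fun p => ?_
    have h2 : (incSeqEquiv r p).top = p.1.top + p.2 + 1 := by
      rw [IncSeq.top_succ]
      simp [incSeqEquiv, IncSeq.snoc]
    rw [h2]
    congr 2
    change _ = mzvTerm κ (p.1.snoc p.2)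
    rw [mzvTerm_snoc, div_div, ← pow_succ', Nat.sub_add_cancel (hκ _)]

lemma zLetters_of_mem_indices {k r : ℕ} {κ : Fin (r + 1) → ℕ} (h : κ ∈ indices k (r + 1)) :
    ∃ w, Regular w ∧ zLetters κ = .zero :: w := by
  obtain ⟨m, hm⟩ := Nat.exists_eq_add_of_le' (mem_indices.1 h).2.2
  have h1 := regular_zLetters (decLast κ)
  have h2 : (fun i : Fin r => decLast κ i.castSucc) = fun i => κ i.castSucc := funext fun i =>
    Function.update_of_ne (Fin.castSucc_lt_last i).ne _ _
  have h3 : decLast κ (Fin.last r) = m + 1 := by rw [decLast, Function.update_self, hm]; rfl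
  refine ⟨_, h1, ?_⟩
  rw [zLetters, zLetters, h2, h3, hm]
  rfl

lemma tsum_ofReal_mzvTerm {k r : ℕ} {κ : Fin (r + 1) → ℕ} (h : κ ∈ indices k (r + 1)) :
    ∑' m, ENNReal.ofReal (mzvTerm κ m) = absIterAux 1 (zLetters κ) 1 := by
  rw [absIterAux_zLetters (mem_indices.1 h).2.1 zero_le_one le_rfl]
  simp

/-- Because `k_r ≥ 2`, the outermost letter is `e_0`, so the absolute integral equal to this series
is finite. -/
lemma summable_mzvTerm {k r : ℕ} {κ : Fin (r + 1) → ℕ} (h : κ ∈ indices k (r + 1)) :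
    Summable (mzvTerm κ) := by
  obtain ⟨w, hw, hz⟩ := zLetters_of_mem_indices h
  have h1 : ∑' m, ENNReal.ofReal (mzvTerm κ m) ≠ ⊤ := by
    rw [tsum_ofReal_mzvTerm h, hz]
    exact (absIterAux_one_lt_top letterBound_one hw fun t ht => norm_inv_sub_zero_le _ ht).ne
  exact (ENNReal.summable_toReal h1).congr fun m => ENNReal.toReal_ofReal (mzvTerm_nonneg κ m)

lemma L_one_zWord {k r : ℕ} {κ : Fin (r + 1) → ℕ} (h : κ ∈ indices k (r + 1)) :
    L 1 (zWord κ) = (-1) ^ (r + 1) * (mzv κ : ℂ) := by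
  obtain ⟨w, hw, hz⟩ := zLetters_of_mem_indices h
  have h1 : (absIterAux 1 (zLetters κ) 1).toReal = mzv κ := by
    rw [← tsum_ofReal_mzvTerm h, ← ENNReal.ofReal_tsum_of_nonneg (mzvTerm_nonneg κ)
      (summable_mzvTerm h), ENNReal.toReal_ofReal (tsum_nonneg (mzvTerm_nonneg κ)), mzv]
  rw [← h1, ← prod_sgn_zLetters κ, ← word_reverse_zLetters, L_word, iter, List.reverse_reverse, hz,
    List.map_cons, List.prod_cons]
  exact iterAux_cons_eq_sgn (Or.inr hw) zero_le_one le_rfl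
    fun t ht0 ht => iterAux_one_eq_sgn (Or.inr hw) ht0 ht

lemma tendsto_L_zWord {k r : ℕ} {κ : Fin (r + 1) → ℕ} (h : κ ∈ indices k (r + 1)) :
    Tendsto (fun x : ℝ => L x (zWord κ)) (𝓝[>] 1) (𝓝 ((-1) ^ (r + 1) * (mzv κ : ℂ))) := by
  have h1 := (mem_indices.1 h).2.2
  rw [← L_one_zWord h, ← incLast_decLast (κ := κ) (by omega), zWord_incLast]
  · exact tendsto_L_mul_e0 (zWord_mem_B _)
  · rw [decLast, Function.update_self]
    omega

lemma const_mem_indices {k : ℕ} (hk : 2 ≤ k) : (fun _ : Fin 1 => k) ∈ indices k (0 + 1) :=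
  mem_indices.2 ⟨by simp, fun _ => by omega, hk⟩

lemma L_e1_mul_e0_pow_eq_mzv (z : ℂ) {k : ℕ} (hk : 2 ≤ k) :
    L z (e1 * e0 ^ (k - 1)) = -((mzv fun _ : Fin 1 => k : ℝ) : ℂ) := by
  have h := L_one_zWord (const_mem_indices hk)
  rw [L_e1_mul_e0_pow_eq]
  simpa [zWord] using h

/-! ### The sum formula -/

lemma rhs_mem_A0 {k r : ℕ} (hk : 2 ≤ k) (hr : r < k) :
    (e1 - ez) * (e0 - ez) ^ r * e0 ^ (k - (r + 1)) ∈ A0 := by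
  have hB := sub_mem e1_mem_B ez_mem_B
  rcases Nat.lt_or_ge (r + 1) k with h | h
  · obtain ⟨a, ha⟩ := Nat.exists_eq_add_of_lt h
    rw [show k - (r + 1) = a + 1 by omega, pow_succ, ← mul_assoc]
    exact mul_e0_mem_A0 (mul_e0_pow_mem_B (mul_e0_sub_ez_pow_mem_B hB r) a)
  -- No trailing `e_0` is left when `r + 1 = k`; the last factor `e_0 - e_z` has to be expanded, and
  -- it exists because `k ≥ 2`.
  · obtain ⟨n, rfl⟩ : ∃ n, r = n + 1 := ⟨r - 1, by omega⟩
    rw [show k - (n + 1 + 1) = 0 by omega, pow_zero, mul_one, pow_succ, ← mul_assoc, mul_sub]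
    exact sub_mem (mul_e0_mem_A0 (mul_e0_sub_ez_pow_mem_B hB n))
      (mul_ez_mem_A0 (mul_e0_sub_ez_pow_mem_B hB n))

lemma sum_formula {k r : ℕ} (hk : 2 ≤ k) (hr : r < k) {z : ℂ} (hz : z ∈ slit) :
    (-1) ^ (r + 1) * ∑ κ ∈ indices k (r + 1), L z (zWord κ) =
      -L z (e1 * e0 ^ (k - 1)) + L z ((e1 - ez) * (e0 - ez) ^ r * e0 ^ (k - (r + 1))) := by
  rcases Nat.lt_or_ge (r + 1) k with h | h
  · obtain ⟨a, rfl⟩ : ∃ a, k = a + r + 2 := ⟨k - r - 2, by omega⟩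
    rw [← map_sum, sum_indices_zWord_eq_J, sum_formula_J hz, mul_assoc e1, ← pow_add,
      show a + r + 2 - 1 = r + (a + 1) by omega, show a + r + 2 - (r + 1) = a + 1 by omega]
  · obtain ⟨n, rfl⟩ : ∃ n, r = n + 1 := ⟨r - 1, by omega⟩
    obtain rfl : k = n + 2 := by omega
    rw [indices_self, Finset.sum_empty, mul_zero, show n + 2 - 1 = n + 1 by omega,
      show n + 2 - (n + 1 + 1) = 0 by omega, pow_zero, mul_one, L_e1_mul_e0_pow_succ hz,
      L_e1_sub_ez_mul_pow_succ hz, neg_neg, add_neg_cancel]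

lemma tendsto_lhs (k r : ℕ) :
    Tendsto (fun x : ℝ => (-1) ^ (r + 1) * ∑ κ ∈ indices k (r + 1), L (x : ℂ) (zWord κ)) (𝓝[>] 1)
      (𝓝 ((∑ κ ∈ indices k (r + 1), mzv κ : ℝ) : ℂ)) := by
  have h := (tendsto_finsetSum (indices k (r + 1))
    fun κ hκ => tendsto_L_zWord hκ).const_mul ((-1 : ℂ) ^ (r + 1))
  rw [← Finset.mul_sum, ← mul_assoc, ← mul_pow] at h
  simpa using h

/-- The first term does not depend on `z`; the second tends to its value at `z = 1`, which is `0`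
because of the factor `e_1 - e_z`. The trailing `e_0` needed for this limit exists since `r + 1 <
k`. -/
lemma tendsto_rhs {k r : ℕ} (hk : 2 ≤ k) (hr : r + 1 < k) :
    Tendsto (fun x : ℝ => -L (x : ℂ) (e1 * e0 ^ (k - 1)) +
        L (x : ℂ) ((e1 - ez) * (e0 - ez) ^ r * e0 ^ (k - (r + 1)))) (𝓝[>] 1)
      (𝓝 ((mzv fun _ : Fin 1 => k : ℝ) : ℂ)) := by
  obtain ⟨a, rfl⟩ : ∃ a, k = a + r + 2 := ⟨k - r - 2, by omega⟩
  have h := tendsto_L_mul_e0 (mul_e0_pow_mem_B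
    (mul_e0_sub_ez_pow_mem_B (sub_mem e1_mem_B ez_mem_B) r) a)
  rw [mul_assoc, mul_assoc, L_one_e1_sub_ez_mul, ← mul_assoc, ← pow_succ] at h
  simp only [L_e1_mul_e0_pow_eq_mzv _ hk, neg_neg, show a + r + 2 - (r + 1) = a + 1 by omega]
  simpa using h.const_add _

lemma ofReal_mem_slit {x : ℝ} (hx : 1 < x) : (x : ℂ) ∈ slit := by
  rintro ⟨t, ht, h⟩
  have : t = x := Complex.ofReal_injective h
  linarith [ht.2]

end SumFormula

open SumFormula
theorem theorem1p2 :
    -- the iterated integrals converge absolutely and are holomorphic in `z`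
    (∀ w : List Letter, word w ∈ A0 → ∀ z ∈ slit, ConvergesAbsolutely z w) ∧
    (∀ x ∈ A0, DifferentiableOn ℂ (fun z => L z x) slit) ∧
    ∀ k r : ℕ, 2 ≤ k → 1 ≤ r → r ≤ k →
      -- all arguments of `L` below lie in its domain
      (∀ κ ∈ indices k r, zWord κ ∈ A0) ∧
      e1 * e0 ^ (k - 1) ∈ A0 ∧
      (e1 - ez) * (e0 - ez) ^ (r - 1) * e0 ^ (k - r) ∈ A0 ∧
      -- the sum formula
      (∀ z ∈ slit,
        (-1) ^ r * ∑ κ ∈ indices k r, L z (zWord κ) =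
          -L z (e1 * e0 ^ (k - 1)) + L z ((e1 - ez) * (e0 - ez) ^ (r - 1) * e0 ^ (k - r))) ∧
      -- the limit `z → 1 + 0`
      (r < k →
        (∀ κ ∈ indices k r, Summable (mzvTerm κ)) ∧
        Summable (mzvTerm fun _ : Fin 1 => k) ∧
        Tendsto (fun x : ℝ => (-1) ^ r * ∑ κ ∈ indices k r, L (x : ℂ) (zWord κ)) (𝓝[>] 1)
          (𝓝 ((∑ κ ∈ indices k r, mzv κ : ℝ) : ℂ)) ∧
        Tendsto (fun x : ℝ => -L (x : ℂ) (e1 * e0 ^ (k - 1)) +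
            L (x : ℂ) ((e1 - ez) * (e0 - ez) ^ (r - 1) * e0 ^ (k - r))) (𝓝[>] 1)
          (𝓝 ((mzv fun _ : Fin 1 => k : ℝ) : ℂ)) ∧
        ∑ κ ∈ indices k r, mzv κ = mzv fun _ : Fin 1 => k) := by
  refine ⟨fun w hw z hz => convergesAbsolutely_of_admissible (admissible_of_word_mem_A0 hw) hz,
    fun x hx => differentiableOn_L hx, fun k r hk hr hrk => ?_⟩
  obtain ⟨r, rfl⟩ : ∃ s, r = s + 1 := ⟨r - 1, by omega⟩
  rw [Nat.add_sub_cancel]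
  refine ⟨fun κ hκ => zWord_mem_A0 hκ, ?_, rhs_mem_A0 hk hrk,
    fun z hz => sum_formula hk hrk hz, fun hlt => ⟨fun κ hκ => summable_mzvTerm hκ,
      summable_mzvTerm (const_mem_indices hk), tendsto_lhs k r, tendsto_rhs hk hlt, ?_⟩⟩
  · rw [show k - 1 = k - 2 + 1 by omega, pow_succ, ← mul_assoc]
    exact mul_e0_mem_A0 (mul_e0_pow_mem_B e1_mem_B _)
  -- Both sides agree for every real `x > 1`, so their limits agree.
  · have h := tendsto_nhds_unique ((tendsto_lhs k r).congr' ?_) (tendsto_rhs hk hlt)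
    · exact_mod_cast h
    · filter_upwards [self_mem_nhdsWithin] with x hx
      exact sum_formula hk hrk (ofReal_mem_slit hx)
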